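/- Let $d\ge 3$. For finite graphs $H,G$ (with $G$ nonempty) let $t(H,G)=\hom(H,G)/|V(G)|^{|V(H)|}$ denote the homomorphism density, and let $e$ be the graph with two nodes and one edge. A graph is called $d$-sparse if it contains no complete bipartite graph $K_{a,b}$ with $a,b\ge 1$ and $a+b>d$ as a (not necessarily induced) subgraph. For a finite simple $d$-sparse graph $H$, let $t(H,d)\in[0,\infty]$ be its ortho-homomorphism number, defined as follows. Let $v_1,\dots,v_n$ be any ordering of the nodes of $H$, and let $N^-(v_j)=\{v_i:\ i<j,\ v_iv_j\in E(H)\}$ and $n_j=|N^-(v_j)|$. Choose random unit vectors $x_{v_1},\dots,x_{v_n}\in\mathbb R^d$ one by one, $x_{v_j}$ being uniformly distributed on the unit sphere of the orthogonal complement of $\{x_u:\ u\in N^-(v_j)\}$; let $\rho$ be the distribution of $x=(x_v)_{v\in V(H)}$. Then \[ t(H,d)=\int \prod_{j=1}^n \frac{A_{d-1}^{\,n_j-1}A_{d-n_j-1}}{A_{d-2}^{\,n_j}}\cdot\frac{1}{\operatorname{Det}\big(x_u:\ u\in N^-(v_j)\big)}\,d\rho(x), \] where $A_k$ is the surface area of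 the unit sphere $S^k$ and $\operatorname{Det}(y_1,\dots,y_m)=\sqrt{\det\big(y_i^{\sf T}y_j\big)_{i,j=1}^m}$ (equal to $1$ for $m=0$). The value does not depend on the ordering. Theorem. For every $d\ge 3$ there is a sequence $G_1,G_2,\dots$ of finite simple graphs, each with at least one edge, such that for every finite $d$-sparse bipartite graph $H$ (and with $t(H,d)$ computed from any ordering of $V(H)$), \[ \lim_{i\to\infty}\frac{t(H,G_i)}{t(e,G_i)^{|E(H)|}}=t(H,d), \] where the limit is in $[0,\infty]$; in particular, the ratios tend to infinity if $t(H,d)=\infty$. -/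

import Mathlib

open MeasureTheory Filter Topology
open scoped ENNReal

noncomputable section

namespace OrthoGraph

/-- The Euclidean space of dimension `d`. -/
abbrev E (d : ℕ) : Type := EuclideanSpace ℝ (Fin d)

/-! ### Finite graphs -/

/-- A graph is `d`-sparse if it has no complete bipartite subgraph `K_{a,b}` (with `a, b ≥ 1`,
not necessarily induced) such that `a + b > d`. -/
def DSparse {V : Type*} (d : ℕ) (H : SimpleGraph V) : Prop :=
  ∀ A B : Finset V, A.Nonempty → B.Nonempty → (∀ a ∈ A, ∀ b ∈ B, H.Adj a b) →
    A.card + B.card ≤ d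

/-- The homomorphism density `t(H, G) = hom(H, G) / |V(G)| ^ |V(H)|` of finite graphs. -/
def homDensity {V W : Type*} (H : SimpleGraph V) (G : SimpleGraph W) : ℝ :=
  (Nat.card (H →g G) : ℝ) / (Nat.card W : ℝ) ^ Nat.card V

/-- The graph `e` with two nodes and one edge. -/
def singleEdge : SimpleGraph (Fin 2) := ⊤

/-! ### Spheres and determinants -/

/-- The surface area `A_k = 2 π ^ ((k + 1) / 2) / Γ((k + 1) / 2)` of the unit sphere `S^k`. -/
def sphereArea (k : ℕ) : ℝ :=
  2 * Real.pi ^ (((k : ℝ) + 1) / 2) / Real.Gamma (((k : ℝ) + 1) / 2)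

/-- The surface measure on the unit sphere of a linear subspace `L`, as a measure on `L`. The
volume on `L` is the Lebesgue measure of the inner product space `L`; it is given explicitly, as
opposed to the restriction to `L` of the Lebesgue measure of the ambient space. -/
def subspaceSurface {d : ℕ} (L : Submodule ℝ (E d)) : Measure L :=
  (@volume L measureSpaceOfInnerProductSpace).toSphere.map Subtype.val

/-- The uniform probability distribution on the unit sphere `L ∩ S^{d-1}` of a nonzero linear
subspace `L` of `ℝ^d`, as a measure on `ℝ^d`: the normalized surface measure. -/
def uniformSphere {d : ℕ} (L : Submodule ℝ (E d)) : Measure (E d) :=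
  (subspaceSurface L Set.univ)⁻¹ • (subspaceSurface L).map Subtype.val

open scoped Classical in
/-- The generalized determinant `Det(x_i : i ∈ S) = √ det (x_iᵀ x_j)` of a finite family of
vectors, which is `1` if `S` is empty. -/
def genDet {ι : Type*} [Fintype ι] {d : ℕ} (x : ι → E d) (S : Set ι) : ℝ :=
  √ (Matrix.gram ℝ (fun i : S => x i)).det

/-- The function
`s_{d,n}(x_1, …, x_n) = A_{d-1}^(n-1) A_{d-n-1} / (A_{d-2}^n Det(x_1, …, x_n))`
of the vectors `x_i`, `i ∈ S`, where `n = |S|`; it is infinite where the vectors are linearly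
dependent. -/
def sDensity {ι : Type*} [Fintype ι] (d : ℕ) (x : ι → E d) (S : Set ι) : ℝ≥0∞ :=
  ENNReal.ofReal (sphereArea (d - 1) ^ ((S.ncard : ℤ) - 1) * sphereArea (d - S.ncard - 1) /
      sphereArea (d - 2) ^ S.ncard) /
    ENNReal.ofReal (genDet x S)

/-! ### Random sequential ortho-homomorphisms and the ortho-homomorphism number -/

/-- The distribution of the random sequential ortho-homomorphism of a graph on `{0, …, n-1}`, the
nodes being processed in their natural order: each node in turn is mapped to a uniform random
point of the unit sphere of the orthogonal complement of the images of its earlier neighbors. -/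
def seqMeasure (d : ℕ) : (n : ℕ) → SimpleGraph (Fin n) → Measure (Fin n → E d)
  | 0, _ => Measure.dirac Fin.elim0
  | n + 1, G =>
      (seqMeasure d n (G.comap Fin.castSucc)).bind fun x =>
        (uniformSphere
          (Submodule.span ℝ (x '' {i | G.Adj i.castSucc (Fin.last n)}))ᗮ).map
            (fun y => Fin.snoc (α := fun _ => E d) x y)

/-- The density function `f(x) = ∏_v s_{d, n_v}(x_u : u an earlier neighbor of v)`, where `n_v` is
the number of earlier neighbors of `v`. -/
def orthoDensity (d : ℕ) {n : ℕ} (G : SimpleGraph (Fin n)) (x : Fin n → E d) : ℝ≥0∞ :=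
  ∏ v : Fin n, sDensity d x {u | u < v ∧ G.Adj u v}

/-- The order-independent measure `φ = f · ρ` on ortho-homomorphisms, constructed from the
natural order of the nodes. -/
def orthoMeasure (d : ℕ) {n : ℕ} (G : SimpleGraph (Fin n)) : Measure (Fin n → E d) :=
  (seqMeasure d n G).withDensity (orthoDensity d G)

/-- The ortho-homomorphism number `t(H, d) ∈ [0, ∞]`: the total mass of the measure `φ` of `H`,
constructed from the ordering `p` of the nodes of `H`. -/
def orthoNumber (d : ℕ) {V : Type*} {n : ℕ} (H : SimpleGraph V) (p : Fin n ≃ V) : ℝ≥0∞ :=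
  orthoMeasure d (H.comap p) Set.univ

end OrthoGraph

end

/-! The graphs $G_i$ discretize approximate orthogonality. Their nodes are the nonzero points of
$N^{-1}\mathbb Z^d$ in the open unit ball, and two of them are joined when the inner product of
their normalizations is below $\varepsilon$ in absolute value. For fixed $\varepsilon$ and
$N\to\infty$, counting lattice points in a bounded region with null boundary shows that $t(H,G)$
tends to the probability `nearDensity d H ε` that independent uniform unit vectors are
$\varepsilon$-nearly orthogonal along the edges of $H$ (`tendsto_homDensity_latticeGraph`). The
boundary is null for all but countably many $\varepsilon$.

Now let $\varepsilon\to0$ and let $H$ be bipartite with a colour class $W$. Given the images of the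
other class, the nodes of $W$ are independent, so the probability is the integral of a product of
cap measures. A cap cut out by $n$ independent unit vectors has measure asymptotic to
$(2\varepsilon)^n\kappa^n s_{d,n}$ with $\kappa=A_{d-2}/A_{d-1}$ (`tendsto_cap`), and after division
by $(2\varepsilon)^n$ it is at most a constant times this limit (`cap_div_le`). Dominated
convergence, or Fatou's lemma if the limit integral is infinite, gives `tendsto_nearDensity`. For a
single edge the limit is $\kappa$, so in the ratio all powers of $2\varepsilon$ and $\kappa$ cancel
and $\int\prod_{w\in W}s_{d,n_w}$ remains.

This integral is $t(H,d)$ for an ordering that puts $W$ last (`orthoNumber_bipartite`). Any other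
ordering gives the same value by `addNodes_perm`. Exchanging two consecutive non-adjacent nodes is
Tonelli's theorem. Exchanging two adjacent ones, with at most $d-2$ earlier nodes, rests on a
symmetry of pairs of orthogonal unit vectors in two subspaces (`lintegral_surf_swap`), proved as the
limit of a manifestly symmetric thickened integral. With more nodes, sparsity makes the complement
of $H$ connected on them, so exchanges of non-adjacent nodes suffice to change the last node.

A diagonal choice of $\varepsilon_i\to0$ and $N$ large then serves all $H$ at once, since there are
finitely many graphs on each $\{0,\dots,k-1\}$. -/

open MeasureTheory Filter Topology
open scoped ENNReal

noncomputable section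

namespace OrthoGraph

/-! ### Gaussian measure and polar coordinates. -/

section Gaussian

variable {F : Type*} [NormedAddCommGroup F] [InnerProductSpace ℝ F] [MeasurableSpace F]
  [BorelSpace F] [FiniteDimensional ℝ F]

/-- The radial projection to the unit sphere. -/
def nrm (x : F) : F := ‖x‖⁻¹ • x

@[fun_prop]
theorem measurable_nrm : Measurable (nrm : F → F) := by
  unfold nrm; fun_prop

omit [MeasurableSpace F] [BorelSpace F] [FiniteDimensional ℝ F] in
theorem norm_nrm {x : F} (hx : x ≠ 0) : ‖nrm x‖ = 1 := by
  have : ‖x‖ ≠ 0 := norm_ne_zero_iff.2 hx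
  simp [nrm, norm_smul, this]

/-- The normalized Gaussian weight. -/
def gaussWeight (r : ℝ) : ℝ≥0∞ := ENNReal.ofReal (Real.exp (-Real.pi * r ^ 2))

@[fun_prop]
theorem measurable_gaussWeight : Measurable gaussWeight := by
  unfold gaussWeight; fun_prop

variable (F) in
/-- The Gaussian probability measure with density `exp (-π |x| ^ 2)`. -/
def gauss : Measure F := volume.withDensity fun x => gaussWeight ‖x‖

theorem lintegral_gaussWeight : ∫⁻ x : F, gaussWeight ‖x‖ = 1 := by
  unfold gaussWeight
  have h := GaussianFourier.integral_rexp_neg_mul_sq_norm (V := F) Real.pi_pos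
  rw [div_self Real.pi_pos.ne', Real.one_rpow] at h
  rw [← ofReal_integral_eq_lintegral_ofReal, h, ENNReal.ofReal_one]
  · by_contra hc
    rw [integral_undef hc] at h
    exact zero_ne_one h
  · exact Eventually.of_forall fun x => (Real.exp_pos _).le

instance : IsProbabilityMeasure (gauss F) :=
  ⟨by rw [gauss, withDensity_apply _ MeasurableSet.univ, Measure.restrict_univ,
    lintegral_gaussWeight]⟩

theorem lintegral_gauss {f : F → ℝ≥0∞} (hf : Measurable f) :
    ∫⁻ x, f x ∂gauss F = ∫⁻ x, gaussWeight ‖x‖ * f x := by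
  rw [gauss, lintegral_withDensity_eq_lintegral_mul _ (by fun_prop) hf]
  rfl

/-- Integration along the orthogonal decomposition of a Euclidean space. -/
theorem lintegral_orthogonal_decomposition (N : Submodule ℝ F) {f : N × Nᗮ → ℝ≥0∞}
    (hf : Measurable f) :
    ∫⁻ x : F, f (N.orthogonalProjectionOnto x, Nᗮ.orthogonalProjectionOnto x) =
      ∫⁻ z : N, ∫⁻ w : Nᗮ, f (z, w) ∂(@volume _ measureSpaceOfInnerProductSpace)
        ∂(@volume _ measureSpaceOfInnerProductSpace) := by
  have h1 : MeasurePreserving (fun x : F => (N.orthogonalProjectionOnto x,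
      Nᗮ.orthogonalProjectionOnto x)) volume
      ((@volume N measureSpaceOfInnerProductSpace).prod
        (@volume Nᗮ measureSpaceOfInnerProductSpace)) := by
    have h := (WithLp.volume_preserving_ofLp _ _).comp N.orthogonalDecomposition.measurePreserving
    have h2 : (fun x : F => (N.orthogonalProjectionOnto x, Nᗮ.orthogonalProjectionOnto x)) =
        WithLp.ofLp ∘ N.orthogonalDecomposition := by
      ext x <;> simp [Submodule.orthogonalDecomposition_apply]
    rw [h2]
    exact h
  rw [← lintegral_prod _ hf.aemeasurable, ← h1.lintegral_comp hf]

/-- The Gaussian weight is multiplicative over `N` and `Nᗮ` by Pythagoras, and the factor on `Nᗮ`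
integrates to 1. Hence the projection of a standard Gaussian vector is standard Gaussian in the
subspace. -/
theorem lintegral_gauss_starProjection (N : Submodule ℝ F) {f : F → ℝ≥0∞} (hf : Measurable f) :
    ∫⁻ x, f (N.starProjection x) ∂gauss F = ∫⁻ z : N, f z ∂gauss N := by
  rw [lintegral_gauss (f := fun x => f (N.starProjection x)) (by fun_prop),
    lintegral_gauss (f := fun z : N => f z) (by fun_prop)]
  have h := lintegral_orthogonal_decomposition N
    (f := fun p => gaussWeight ‖p.1‖ * f p.1 * gaussWeight ‖p.2‖)
    (by fun_prop)
  calc _ = _ := lintegral_congr fun x => ?_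
    _ = _ := h
    _ = _ := lintegral_congr fun z => ?_
  · rw [mul_right_comm]
    congr 1
    unfold gaussWeight
    rw [← ENNReal.ofReal_mul (Real.exp_pos _).le, ← Real.exp_add, ← mul_add,
      ← Submodule.norm_sq_eq_add_norm_sq_projection]
  · dsimp only
    rw [lintegral_const_mul _ (by fun_prop),
      lintegral_gaussWeight, mul_one]

/-- Integration in polar coordinates. -/
theorem lintegral_polar [Nontrivial F] {f : F → ℝ≥0∞} (hf : Measurable f) {ρ : ℝ → ℝ≥0∞}
    (hρ : Measurable ρ) :
    ∫⁻ x : F, f (nrm x) * ρ ‖x‖ =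
      (∫⁻ y, f y ∂((volume : Measure F).toSphere.map Subtype.val)) *
        ∫⁻ r in Set.Ioi (0 : ℝ), ENNReal.ofReal (r ^ (Module.finrank ℝ F - 1)) * ρ r := by
  have h := (volume : Measure F).measurePreserving_homeomorphUnitSphereProd.lintegral_comp
    (f := fun p => f p.1 * ρ p.2) (by fun_prop)
  rw [lintegral_map hf measurable_subtype_coe]
  rw [lintegral_prod_mul (f := fun p : Metric.sphere (0 : F) 1 => f p)
    (g := fun p : Set.Ioi (0 : ℝ) => ρ p) (by fun_prop) (by fun_prop)] at h
  have h2 : ∫⁻ r : Set.Ioi (0 : ℝ), ρ r ∂Measure.volumeIoiPow (Module.finrank ℝ F - 1) =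
      ∫⁻ r in Set.Ioi (0 : ℝ), ENNReal.ofReal (r ^ (Module.finrank ℝ F - 1)) * ρ r := by
    rw [Measure.volumeIoiPow, lintegral_withDensity_eq_lintegral_mul _ (by fun_prop) (by fun_prop)]
    simp only [Pi.mul_apply]
    rw [lintegral_subtype_comap measurableSet_Ioi (fun r : ℝ =>
      ENNReal.ofReal (r ^ (Module.finrank ℝ F - 1)) * ρ r)]
  rw [← h2, ← h]
  simp only [homeomorphUnitSphereProd_apply_fst_coe, homeomorphUnitSphereProd_apply_snd_coe]
  rw [lintegral_subtype_comap (measurableSet_singleton _).compl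
    (fun x : F => f (‖x‖⁻¹ • x) * ρ ‖x‖)]
  -- The origin, which polar coordinates miss, is a null set.
  rw [← lintegral_add_compl (μ := volume) (fun x : F => f (nrm x) * ρ ‖x‖)
    (measurableSet_singleton 0)]
  simp [nrm]

theorem sphereArea_pos (k : ℕ) : 0 < sphereArea k := by
  unfold sphereArea
  have := Real.Gamma_pos_of_pos (show 0 < ((k : ℝ) + 1) / 2 by positivity)
  have := Real.pi_pos
  positivity

/-- The surface is the dimension $k$ times the volume of the ball; $\Gamma(k/2+1)=(k/2)\Gamma(k/2)$
turns this into the formula for $A_{k-1}$. -/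
theorem toSphere_univ [Nontrivial F] :
    (volume : Measure F).toSphere Set.univ =
      ENNReal.ofReal (sphereArea (Module.finrank ℝ F - 1)) := by
  have hk : 0 < Module.finrank ℝ F := Module.finrank_pos
  rw [Measure.toSphere_apply_univ, InnerProductSpace.volume_ball, ENNReal.ofReal_one, one_pow,
    one_mul, ← ENNReal.ofReal_natCast, ← ENNReal.ofReal_mul (by positivity)]
  congr 1
  unfold sphereArea
  rw [Nat.cast_sub (by omega : 1 ≤ _), Nat.cast_one, sub_add_cancel]
  have hk' : (0 : ℝ) < Module.finrank ℝ F := by exact_mod_cast hk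
  rw [Real.Gamma_add_one (by positivity), Real.sqrt_eq_rpow, ← Real.rpow_natCast,
    ← Real.rpow_mul Real.pi_pos.le]
  have := Real.Gamma_pos_of_pos (show 0 < (Module.finrank ℝ F : ℝ) / 2 by positivity)
  field_simp

/-- The total Gaussian mass of $\mathbb R^{k+1}$ in polar coordinates. It lets radial integrals
cancel against sphere areas without being evaluated. -/
theorem lintegral_rpow_gaussWeight (k : ℕ) :
    ENNReal.ofReal (sphereArea k) *
      ∫⁻ r in Set.Ioi (0 : ℝ), ENNReal.ofReal (r ^ k) * gaussWeight r = 1 := by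
  have h := lintegral_polar (F := EuclideanSpace ℝ (Fin (k + 1))) (f := fun _ => 1)
    measurable_const measurable_gaussWeight
  simp only [one_mul, lintegral_gaussWeight, lintegral_one] at h
  rw [Measure.map_apply measurable_subtype_coe MeasurableSet.univ, Set.preimage_univ,
    toSphere_univ] at h
  simpa using h.symm

end Gaussian

/-! ### Uniform measures on spheres of subspaces as normalized Gaussian projections. -/

section Sphere

variable {d : ℕ}

theorem lintegral_subspaceSurface_univ {L : Submodule ℝ (E d)} (hL : L ≠ ⊥) :
    subspaceSurface L Set.univ = ENNReal.ofReal (sphereArea (Module.finrank ℝ L - 1)) := by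
  have : Nontrivial L := Submodule.nontrivial_iff_ne_bot.2 hL
  rw [subspaceSurface, Measure.map_apply measurable_subtype_coe MeasurableSet.univ,
    Set.preimage_univ, toSphere_univ]

/-- The surface measure of the unit sphere of a subspace, as a measure on the ambient space. -/
def surf (L : Submodule ℝ (E d)) : Measure (E d) := (subspaceSurface L).map Subtype.val

/-- Direction and length of a projected Gaussian vector are independent. The weight `ρ` is kept
general because it is needed both for `ρ = 1` and for `ρ r = r`. -/
theorem lintegral_gauss_radial {L : Submodule ℝ (E d)} (hL : L ≠ ⊥) {f : E d → ℝ≥0∞}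
    (hf : Measurable f) {ρ : ℝ → ℝ≥0∞} (hρ : Measurable ρ) :
    ∫⁻ g, f (nrm (L.starProjection g)) * ρ ‖L.starProjection g‖ ∂gauss (E d) =
      (∫⁻ y, f y ∂surf L) * ∫⁻ r in Set.Ioi (0 : ℝ),
        ENNReal.ofReal (r ^ (Module.finrank ℝ L - 1)) * (gaussWeight r * ρ r) := by
  have : Nontrivial L := Submodule.nontrivial_iff_ne_bot.2 hL
  rw [lintegral_gauss_starProjection L (f := fun x => f (nrm x) * ρ ‖x‖)
    (by fun_prop), lintegral_gauss
    (f := fun z : L => f (nrm z) * ρ ‖(z : E d)‖) (by fun_prop)]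
  have h := lintegral_polar (F := L) (f := fun x => f x) (by fun_prop)
    (measurable_gaussWeight.mul hρ)
  simp only [Pi.mul_apply] at h
  rw [surf, lintegral_map hf measurable_subtype_coe]
  refine Eq.trans (lintegral_congr fun z => ?_) h
  simp only [nrm, Submodule.coe_norm, Submodule.coe_smul]
  ring

theorem lintegral_surf {L : Submodule ℝ (E d)} (hL : L ≠ ⊥) {f : E d → ℝ≥0∞}
    (hf : Measurable f) :
    ∫⁻ y, f y ∂surf L = ENNReal.ofReal (sphereArea (Module.finrank ℝ L - 1)) *
      ∫⁻ g, f (nrm (L.starProjection g)) ∂gauss (E d) := by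
  have h := lintegral_gauss_radial hL hf (ρ := fun _ => 1) measurable_const
  simp only [mul_one] at h
  rw [h, mul_left_comm, lintegral_rpow_gaussWeight, mul_one]

theorem uniformSphere_eq {L : Submodule ℝ (E d)} :
    uniformSphere L = (subspaceSurface L Set.univ)⁻¹ • surf L := rfl

theorem lintegral_uniformSphere {L : Submodule ℝ (E d)} (hL : L ≠ ⊥) {f : E d → ℝ≥0∞}
    (hf : Measurable f) :
    ∫⁻ y, f y ∂uniformSphere L = ∫⁻ g, f (nrm (L.starProjection g)) ∂gauss (E d) := by
  rw [uniformSphere_eq, lintegral_smul_measure, lintegral_subspaceSurface_univ hL,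
    lintegral_surf hL hf, smul_eq_mul, ← mul_assoc, ENNReal.inv_mul_cancel, one_mul]
  · simpa using sphereArea_pos _
  · exact ENNReal.ofReal_ne_top

/-- The source measure no longer depends on `L`. Measurability of the uniform distribution as a
function of `L` is thereby reduced to measurability of a projection, which is a main reason for
using Gaussian vectors. -/
theorem uniformSphere_eq_map {L : Submodule ℝ (E d)} (hL : L ≠ ⊥) :
    uniformSphere L = (gauss (E d)).map fun g => nrm (L.starProjection g) := by
  have hm : Measurable fun g : E d => nrm (L.starProjection g) :=
    measurable_nrm.comp (by fun_prop)
  ext s hs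
  rw [← lintegral_indicator_one hs, lintegral_uniformSphere hL (measurable_one.indicator hs),
    ← lintegral_map (measurable_one.indicator hs) hm, lintegral_indicator_one hs]

theorem isProbabilityMeasure_uniformSphere {L : Submodule ℝ (E d)} (hL : L ≠ ⊥) :
    IsProbabilityMeasure (uniformSphere L) := by
  rw [uniformSphere_eq_map hL]
  exact Measure.isProbabilityMeasure_map (measurable_nrm.comp (by fun_prop)).aemeasurable

end Sphere

end OrthoGraph

end

open MeasureTheory Filter Topology
open scoped ENNReal

noncomputable section

namespace OrthoGraph

open scoped RealInnerProductSpace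

/-! ### Projections to orthogonal complements. -/

section Projection

variable {F : Type*} [NormedAddCommGroup F] [InnerProductSpace ℝ F] [FiniteDimensional ℝ F]

/-- One Gram–Schmidt step inside `N`. The convention `x / 0 = 0` makes the formula right also when
`v` is orthogonal to `N`, where nothing has to be subtracted. -/
theorem starProjection_inf_orthogonal_singleton (N : Submodule ℝ F) (v g : F) :
    (N ⊓ (ℝ ∙ v)ᗮ).starProjection g = N.starProjection g -
      (⟪N.starProjection v, N.starProjection g⟫ / ‖N.starProjection v‖ ^ 2) •
        N.starProjection v := by
  set e := N.starProjection v
  set r := N.starProjection g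
  have he : e ∈ N := N.starProjection_apply_mem v
  have hr : r ∈ N := N.starProjection_apply_mem g
  have hv : ∀ z ∈ N, ⟪v, z⟫ = ⟪e, z⟫ := fun z hz => by
    have : ⟪v - e, z⟫ = 0 := N.starProjection_inner_eq_zero v z hz
    rwa [inner_sub_left, sub_eq_zero] at this
  apply Submodule.eq_starProjection_of_mem_of_inner_eq_zero (K := N ⊓ (ℝ ∙ v)ᗮ)
  · refine ⟨N.sub_mem hr (N.smul_mem _ he), Submodule.mem_orthogonal_singleton_iff_inner_right.2 ?_⟩
    rw [hv _ (N.sub_mem hr (N.smul_mem _ he)), inner_sub_right, inner_smul_right,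
      real_inner_self_eq_norm_sq]
    rcases eq_or_ne e 0 with h0 | h0
    · simp [h0]
    · have : ‖e‖ ≠ 0 := norm_ne_zero_iff.2 h0
      field_simp
      simp
  · rintro w ⟨hw, hw2⟩
    have h1 : ⟪g - r, w⟫ = 0 := N.starProjection_inner_eq_zero g w hw
    have h2 : ⟪e, w⟫ = 0 := by
      rw [← hv w hw]; exact Submodule.mem_orthogonal_singleton_iff_inner_right.1 hw2
    rw [← sub_add, inner_add_left, h1, inner_smul_left, h2]
    simp

end Projection

universe u

variable {ι : Type u} {d : ℕ}

/-- The orthogonal complement of the vectors with labels in `S`. -/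
abbrev perp (x : ι → E d) (S : Set ι) : Submodule ℝ (E d) := (Submodule.span ℝ (x '' S))ᗮ

theorem perp_insert (x : ι → E d) (v : ι) (S : Set ι) :
    perp x (insert v S) = perp x S ⊓ (ℝ ∙ x v)ᗮ := by
  rw [perp, Set.image_insert_eq, Submodule.span_insert, ← Submodule.inf_orthogonal, inf_comm]

/-- The projection need not be continuous in `x`, because the rank of the family can jump; building
it by Gram–Schmidt steps with a total division still shows that it is measurable. -/
theorem measurable_starProjection_perp [Finite ι] (S : Set ι) :
    Measurable fun p : (ι → E d) × E d => (perp p.1 S).starProjection p.2 := by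
  induction S, S.toFinite using Set.Finite.induction_on with
  | empty => simpa using measurable_snd
  | @insert v S hv hS ih =>
    simp only [perp_insert, starProjection_inf_orthogonal_singleton]
    have h1 : Measurable fun p : (ι → E d) × E d => (perp p.1 S).starProjection (p.1 v) :=
      ih.comp (measurable_fst.prodMk ((measurable_pi_apply v).comp measurable_fst))
    exact ih.sub (((h1.inner ih).div (h1.norm.pow_const 2)).smul h1)

/-! ### Gram determinants and the density of a node. -/

section Gram

variable [Fintype ι]

theorem measurable_genDet (S : Set ι) : Measurable fun x : ι → E d => genDet x S := by
  classical
  unfold genDet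
  apply Continuous.measurable
  refine Real.continuous_sqrt.comp (Continuous.matrix_det ?_)
  refine continuous_matrix fun i j => ?_
  simp only [Matrix.gram_apply]
  fun_prop

theorem genDet_nonneg (x : ι → E d) (S : Set ι) : 0 ≤ genDet x S := Real.sqrt_nonneg _

theorem genDet_empty (x : ι → E d) : genDet x ∅ = 1 := by
  simp [genDet]

theorem genDet_ne_zero_iff (x : ι → E d) (S : Set ι) :
    genDet x S ≠ 0 ↔ LinearIndependent ℝ fun i : S => x i := by
  classical
  rw [genDet, Real.sqrt_ne_zero (Matrix.posSemidef_gram ℝ _).det_nonneg,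
    Matrix.det_gram_ne_zero_iff_linearIndependent]

/-- Base times height. Write `x v = e + ∑ c i • x i` with `e` orthogonal to the old vectors; then
the new Gram matrix is congruent, by a unipotent block matrix built from `c`, to the block sum of
the old Gram matrix and `‖e‖ ^ 2`. No linear independence is needed. -/
theorem genDet_insert (x : ι → E d) {v : ι} {S : Set ι} (hv : v ∉ S) :
    genDet x (insert v S) = genDet x S * ‖(perp x S).starProjection (x v)‖ := by
  classical
  have key : (Matrix.gram ℝ (fun i : ↥(insert v S) => x i)).det =
      (Matrix.gram ℝ (fun i : S => x i)).det * ‖(perp x S).starProjection (x v)‖ ^ 2 := by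
    set e := (perp x S).starProjection (x v)
    have hp : x v - e ∈ Submodule.span ℝ (x '' S) := by
      have := Submodule.sub_starProjection_mem_orthogonal (K := perp x S) (x v)
      rwa [Submodule.orthogonal_orthogonal] at this
    have he : e ∈ perp x S := Submodule.starProjection_apply_mem _ _
    rw [Set.image_eq_range] at hp
    obtain ⟨c, hc⟩ := (Submodule.mem_span_range_iff_exists_fun ℝ).1 hp
    have hxe : ∀ i : S, ⟪x i, e⟫ = 0 := fun i =>
      he (x i) (Submodule.subset_span (Set.mem_image_of_mem x i.2))
    have hxv : x v = e + ∑ i : S, c i • x i := by rw [hc]; abel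
    let C : Matrix S PUnit.{u + 1} ℝ := Matrix.of fun i _ => c i
    let G := Matrix.gram ℝ (fun i : S => x i)
    have h1 : (Matrix.gram ℝ (fun i : ↥(insert v S) => x i)).submatrix (Equiv.Set.insert hv).symm
        (Equiv.Set.insert hv).symm =
        Matrix.fromBlocks (1 : Matrix S S ℝ) 0 C.transpose (1 : Matrix PUnit.{u + 1} PUnit.{u + 1} ℝ) *
          Matrix.fromBlocks G 0 0 (Matrix.of fun _ _ => ‖e‖ ^ 2) *
          Matrix.fromBlocks (1 : Matrix S S ℝ) C 0 (1 : Matrix PUnit.{u + 1} PUnit.{u + 1} ℝ) := by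
      have hin : ∀ i : S, ⟪x i, x v⟫ = (G * C) i PUnit.unit := fun i => by
        rw [hxv, inner_add_right, hxe, inner_sum, zero_add, Matrix.mul_apply]
        refine Finset.sum_congr rfl fun j _ => ?_
        rw [inner_smul_right, mul_comm]
        rfl
      rw [Matrix.fromBlocks_multiply, Matrix.fromBlocks_multiply]
      ext (i | i) (j | j)
      · simp [G]
      · simp [G, hin]
      · have hG : G.transpose = G := Matrix.isHermitian_gram ℝ (fun i : S => x i)
        have hin' : ⟪x v, x j⟫ = (C.transpose * G) PUnit.unit j := by
          rw [real_inner_comm, hin, ← hG, ← Matrix.transpose_mul, hG, Matrix.transpose_apply]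
        simp [hin']
      · simp only [Matrix.submatrix_apply, Equiv.Set.insert_symm_apply_inr, Matrix.gram_apply]
        have : ⟪x v, x v⟫ = ‖e‖ ^ 2 + ∑ i : S, c i * ⟪x i, x v⟫ := by
          nth_rewrite 1 [hxv]
          rw [inner_add_left, sum_inner]
          congr 1
          · rw [hxv, inner_add_right, inner_sum, real_inner_self_eq_norm_sq]
            simp [inner_smul_right, real_inner_comm, hxe]
          · simp [inner_smul_left]
        rw [this]
        simp only [hin]
        simp [Matrix.mul_apply, C, G, add_comm, Finset.mul_sum, Finset.sum_mul]
        rw [Finset.sum_comm]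
        refine Finset.sum_congr rfl fun i _ => Finset.sum_congr rfl fun j _ => ?_
        rw [real_inner_comm]; ring
    rw [← Matrix.det_submatrix_equiv_self (Equiv.Set.insert hv).symm, h1, Matrix.det_mul,
      Matrix.det_mul, Matrix.det_fromBlocks_zero₁₂, Matrix.det_fromBlocks_zero₁₂,
      Matrix.det_fromBlocks_zero₂₁]
    simp [G]
  rw [genDet, genDet, ← Real.sqrt_sq (norm_nonneg ((perp x S).starProjection (x v))),
    ← Real.sqrt_mul (Matrix.posSemidef_gram ℝ _).det_nonneg]
  congr 1
  convert key

theorem finrank_perp {x : ι → E d} {S : Set ι} (h : genDet x S ≠ 0) :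
    Module.finrank ℝ (perp x S) = d - S.ncard := by
  classical
  have h1 := (Submodule.span ℝ (x '' S)).finrank_add_finrank_orthogonal
  rw [Set.image_eq_range, finrank_span_eq_card ((genDet_ne_zero_iff x S).1 h),
    finrank_euclideanSpace_fin, ← Nat.card_eq_fintype_card, Nat.card_coe_set_eq,
    ← Set.image_eq_range] at h1
  rw [perp]
  omega

theorem le_finrank_perp (x : ι → E d) (S : Set ι) :
    d - S.ncard ≤ Module.finrank ℝ (perp x S) := by
  classical
  have h1 := (Submodule.span ℝ (x '' S)).finrank_add_finrank_orthogonal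
  have h2 : Module.finrank ℝ (Submodule.span ℝ (x '' S)) ≤ S.ncard := by
    rw [Set.image_eq_range]
    refine (finrank_range_le_card _).trans ?_
    rw [← Nat.card_eq_fintype_card, Nat.card_coe_set_eq]
  rw [finrank_euclideanSpace_fin] at h1
  rw [perp]
  omega

theorem perp_ne_bot (x : ι → E d) {S : Set ι} (h : S.ncard < d) : perp x S ≠ ⊥ := by
  intro h0
  have := le_finrank_perp x S
  rw [h0, finrank_bot] at this
  omega

theorem measurable_sDensity (S : Set ι) : Measurable fun x : ι → E d => sDensity d x S :=
  measurable_const.div (measurable_genDet S).ennreal_ofReal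

/-- The density in terms of the dimension of the orthogonal complement. -/
theorem sDensity_eq (x : ι → E d) (S : Set ι) :
    sDensity d x S = ENNReal.ofReal ((sphereArea (d - 1) / sphereArea (d - 2)) ^ S.ncard /
      sphereArea (d - 1)) * ENNReal.ofReal (sphereArea (Module.finrank ℝ (perp x S) - 1)) *
      (ENNReal.ofReal (genDet x S))⁻¹ := by
  have hp := sphereArea_pos
  rw [sDensity, div_eq_mul_inv]
  by_cases h : genDet x S = 0
  -- For dependent vectors the dimension of the complement may differ from `d - S.ncard`, but both
  -- sides are infinite, as the other factors are positive.
  · simp only [h, ENNReal.ofReal_zero, ENNReal.inv_zero]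
    rw [ENNReal.mul_top, ENNReal.mul_top]
    · have := hp (d - 1); have := hp (d - 2); have := hp (Module.finrank ℝ (perp x S) - 1)
      rw [← ENNReal.ofReal_mul (by positivity)]
      simp only [ne_eq, ENNReal.ofReal_eq_zero, not_le]
      positivity
    · have := hp (d - 1); have := hp (d - 2); have := hp (d - S.ncard - 1)
      simp only [ne_eq, ENNReal.ofReal_eq_zero, not_le]
      positivity
  · rw [finrank_perp h, ← ENNReal.ofReal_mul]
    · congr 2
      have h1 := (hp (d - 1)).ne'
      have h2 := (hp (d - 2)).ne'
      rw [zpow_sub₀ h1, zpow_natCast, zpow_one, div_pow]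
      field_simp
    · have := hp (d - 1); have := hp (d - 2)
      positivity

end Gram

end OrthoGraph

end

open MeasureTheory Filter Topology
open scoped ENNReal

noncomputable section

namespace OrthoGraph

open scoped RealInnerProductSpace

/-! ### Slicing a Gaussian vector along a direction. -/

section Slicing

variable {F : Type*} [NormedAddCommGroup F] [InnerProductSpace ℝ F] [MeasurableSpace F]
  [BorelSpace F] [FiniteDimensional ℝ F]

/-- A Gaussian vector is the sum of its projection to the orthogonal complement of a unit vector
and of an independent Gaussian multiple of this unit vector. -/
theorem lintegral_gauss_slice {e : F} (he : ‖e‖ = 1) {f : F → ℝ≥0∞} (hf : Measurable f) :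
    ∫⁻ h, f h ∂gauss F =
      ∫⁻ h, (∫⁻ s : ℝ, gaussWeight s * f ((ℝ ∙ e)ᗮ.starProjection h + s • e)) ∂gauss F := by
  have hΦ : Measurable fun y : F => ∫⁻ s : ℝ, gaussWeight s * f (y + s • e) :=
    Measurable.lintegral_prod_right' (f := fun p : F × ℝ => gaussWeight p.2 * f (p.1 + p.2 • e))
      (by fun_prop)
  have hm : Measurable fun p : ↥(ℝ ∙ e) × ↥(ℝ ∙ e)ᗮ =>
      gaussWeight ‖p.1‖ * (gaussWeight ‖p.2‖ * f (p.1 + p.2)) := by fun_prop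
  rw [lintegral_gauss_starProjection (ℝ ∙ e)ᗮ hΦ, lintegral_gauss hf,
    lintegral_gauss (f := fun z : ↥(ℝ ∙ e)ᗮ => ∫⁻ s : ℝ, gaussWeight s * f (z + s • e))
      (by fun_prop)]
  have h1 := lintegral_orthogonal_decomposition (ℝ ∙ e) hm
  have h2 : ∀ x : F, gaussWeight ‖(ℝ ∙ e).orthogonalProjectionOnto x‖ *
      (gaussWeight ‖(ℝ ∙ e)ᗮ.orthogonalProjectionOnto x‖ *
        f ((ℝ ∙ e).orthogonalProjectionOnto x + (ℝ ∙ e)ᗮ.orthogonalProjectionOnto x)) =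
      gaussWeight ‖x‖ * f x := fun x => by
    rw [← mul_assoc]
    congr 1
    · unfold gaussWeight
      rw [← ENNReal.ofReal_mul (Real.exp_pos _).le, ← Real.exp_add, ← mul_add,
        ← Submodule.norm_sq_eq_add_norm_sq_projection]
    · exact congrArg f ((ℝ ∙ e).starProjection_add_starProjection_orthogonal x)
  simp only [h2] at h1
  rw [h1]
  -- The line spanned by the unit vector `e` is parametrized isometrically by the real variable `s`.
  have h3 := (LinearIsometryEquiv.toSpanUnitSingleton e he).measurePreserving.lintegral_comp
    (f := fun z : ↥(ℝ ∙ e) => ∫⁻ w : ↥(ℝ ∙ e)ᗮ, gaussWeight ‖z‖ *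
      (gaussWeight ‖w‖ * f (z + w)) ∂(@volume _ measureSpaceOfInnerProductSpace))
    (by exact Measurable.lintegral_prod_right' hm)
  rw [← h3, lintegral_lintegral_swap]
  · refine lintegral_congr fun w => ?_
    rw [← lintegral_const_mul _ (by fun_prop)]
    refine lintegral_congr fun s => ?_
    have : gaussWeight ‖s‖ = gaussWeight s := by simp [gaussWeight]
    rw [LinearIsometryEquiv.norm_map, this, add_comm (w : F), mul_left_comm,
      LinearIsometryEquiv.toSpanUnitSingleton_apply]
  · exact (hm.comp (f := fun p : ℝ × ↥(ℝ ∙ e)ᗮ =>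
      (LinearIsometryEquiv.toSpanUnitSingleton e he p.1, p.2)) (by fun_prop)).aemeasurable

omit [MeasurableSpace F] [BorelSpace F] in
theorem inf_orthogonal_starProjection (M : Submodule ℝ F) (x : F) :
    M ⊓ (ℝ ∙ M.starProjection x)ᗮ = M ⊓ (ℝ ∙ x)ᗮ := by
  ext z
  simp only [Submodule.mem_inf, Submodule.mem_orthogonal_singleton_iff_inner_right]
  refine and_congr_right fun hz => ?_
  rw [Submodule.inner_starProjection_left_eq_right, M.starProjection_eq_self_iff.2 hz]

omit [MeasurableSpace F] [BorelSpace F] [FiniteDimensional ℝ F] in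
theorem orthogonal_singleton_smul (x : F) {c : ℝ} (hc : c ≠ 0) : (ℝ ∙ c • x)ᗮ = (ℝ ∙ x)ᗮ := by
  rw [Submodule.span_singleton_smul_eq hc.isUnit]

omit [MeasurableSpace F] [BorelSpace F] [FiniteDimensional ℝ F] in
theorem orthogonal_singleton_nrm (x : F) : (ℝ ∙ nrm x)ᗮ = (ℝ ∙ x)ᗮ := by
  rcases eq_or_ne x 0 with rfl | hx
  · simp [nrm]
  · exact orthogonal_singleton_smul x (inv_ne_zero (norm_ne_zero_iff.2 hx))

omit [MeasurableSpace F] [BorelSpace F] in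
theorem starProjection_congr {N N' : Submodule ℝ F} (h : N = N') (g : F) :
    N.starProjection g = N'.starProjection g := by
  subst h; rfl

/-- The slice formula inside a subspace, with the slicing vector given by its projection. -/
theorem lintegral_gauss_slice_subspace (M : Submodule ℝ F) {x : F} (hx : M.starProjection x ≠ 0)
    {f : F → ℝ≥0∞} (hf : Measurable f) :
    ∫⁻ h, f (M.starProjection h) ∂gauss F =
      ∫⁻ h, (∫⁻ s : ℝ, gaussWeight s * f ((M ⊓ (ℝ ∙ x)ᗮ).starProjection h +
        s • nrm (M.starProjection x))) ∂gauss F := by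
  set e := nrm (M.starProjection x) with he
  have hen : ‖e‖ = 1 := norm_nrm hx
  have heM : M.starProjection e = e :=
    M.starProjection_eq_self_iff.2 (M.smul_mem _ (M.starProjection_apply_mem x))
  rw [lintegral_gauss_slice hen (f := fun h => f (M.starProjection h)) (by fun_prop)]
  refine lintegral_congr fun h => lintegral_congr fun s => ?_
  congr 2
  have hN : M ⊓ (ℝ ∙ x)ᗮ = M ⊓ (ℝ ∙ e)ᗮ := by
    rw [he, orthogonal_singleton_nrm, inf_orthogonal_starProjection]
  rw [map_add, map_smul, heM, starProjection_congr hN,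
    starProjection_inf_orthogonal_singleton, heM, hen]
  have : (ℝ ∙ e)ᗮ.starProjection h = h - ⟪e, h⟫ • e := by
    rw [Submodule.starProjection_orthogonal_val, Submodule.starProjection_unit_singleton ℝ hen]
  rw [this, map_sub, map_smul, heM, ← Submodule.inner_starProjection_left_eq_right, heM]
  simp

omit [MeasurableSpace F] [BorelSpace F] in
theorem finrank_inf_orthogonal {M : Submodule ℝ F} {x : F} (hx : M.starProjection x ≠ 0) :
    Module.finrank ℝ ↥(M ⊓ (ℝ ∙ x)ᗮ) = Module.finrank ℝ M - 1 := by
  rw [← inf_orthogonal_starProjection]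
  have h := Submodule.finrank_add_inf_finrank_orthogonal (𝕜 := ℝ)
    (K₁ := ℝ ∙ M.starProjection x) (K₂ := M)
    ((Submodule.span_singleton_le_iff_mem _ _).2 (M.starProjection_apply_mem x))
  rw [finrank_span_singleton hx, inf_comm] at h
  omega

omit [MeasurableSpace F] [BorelSpace F] in
theorem finrank_le_inf_orthogonal (M : Submodule ℝ F) (x : F) :
    Module.finrank ℝ M - 1 ≤ Module.finrank ℝ ↥(M ⊓ (ℝ ∙ x)ᗮ) := by
  by_cases hx : M.starProjection x = 0
  · have h0 : (ℝ ∙ (0 : F))ᗮ = ⊤ := by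
      rw [Submodule.span_zero_singleton, Submodule.bot_orthogonal_eq_top]
    rw [← inf_orthogonal_starProjection, hx, h0, inf_top_eq]
    omega
  · rw [finrank_inf_orthogonal hx]

/-- The kernel is a proper subspace, hence Lebesgue null, and the Gaussian measure is absolutely
continuous. -/
theorem gauss_ae_ne_zero {A : F →L[ℝ] F} (hA : A ≠ 0) : ∀ᵐ g ∂gauss F, A g ≠ 0 := by
  have h : (gauss F) (LinearMap.ker A.toLinearMap : Set F) = 0 := by
    refine withDensity_absolutelyContinuous _ _ (Measure.addHaar_submodule _ _ fun h => hA ?_)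
    ext x
    have : x ∈ LinearMap.ker A.toLinearMap := h ▸ Submodule.mem_top
    simpa using this
  exact measure_mono_null (fun x hx => by simpa using hx) h

end Slicing

/-! ### The regularizing weight for orthogonal pairs. -/

section Swap

variable {F : Type*} [NormedAddCommGroup F] [InnerProductSpace ℝ F] [MeasurableSpace F]
  [BorelSpace F] [FiniteDimensional ℝ F]

/-- A bounded weight that vanishes where the projections to the other subspace do. -/
def swapWeight (L M : Submodule ℝ F) (x y : F) : ℝ≥0∞ :=
  ENNReal.ofReal (min ‖M.starProjection x‖ 1 * min ‖L.starProjection y‖ 1)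

omit [MeasurableSpace F] [BorelSpace F] in
theorem swapWeight_comm (L M : Submodule ℝ F) (x y : F) :
    swapWeight L M x y = swapWeight M L y x :=
  congrArg _ (mul_comm _ _)

omit [MeasurableSpace F] [BorelSpace F] in
theorem continuous_swapWeight (L M : Submodule ℝ F) :
    Continuous fun p : F × F => swapWeight L M p.1 p.2 := by
  unfold swapWeight
  exact ENNReal.continuous_ofReal.comp (by fun_prop)

-- The first factor of the weight absorbs the singular Jacobian. This bound provides the domination
-- in the limit below and the finiteness of `orthoPair`.
omit [MeasurableSpace F] [BorelSpace F] in
theorem inv_mul_swapWeight_le (L M : Submodule ℝ F) (x y : F) :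
    (ENNReal.ofReal ‖M.starProjection x‖)⁻¹ * swapWeight L M x y ≤ 1 := by
  unfold swapWeight
  rw [ENNReal.ofReal_mul (by positivity), ← mul_assoc]
  refine mul_le_one' ?_ (by simp)
  refine (mul_le_mul_right (ENNReal.ofReal_le_ofReal (min_le_left _ _)) _).trans ?_
  rw [mul_comm]
  exact ENNReal.mul_inv_le_one _

end Swap

end OrthoGraph

end

open MeasureTheory Filter Topology
open scoped ENNReal

noncomputable section

namespace OrthoGraph

open scoped RealInnerProductSpace

/-! ### The thickened integral over nearly orthogonal pairs and its limit. -/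

section Swap

variable {F : Type*} [NormedAddCommGroup F] [InnerProductSpace ℝ F] [MeasurableSpace F]
  [BorelSpace F] [FiniteDimensional ℝ F]

theorem lintegral_real_mul_left {c : ℝ} (hc : 0 < c) {φ : ℝ → ℝ≥0∞} (hφ : Measurable φ) :
    ∫⁻ s, φ s = ENNReal.ofReal c * ∫⁻ s, φ (c * s) := by
  rw [← lintegral_map hφ (measurable_const_mul c), Real.map_volume_mul_left hc.ne',
    lintegral_smul_measure, smul_eq_mul, ← mul_assoc, ← ENNReal.ofReal_mul hc.le,
    abs_of_pos (inv_pos.2 hc), mul_inv_cancel₀ hc.ne', ENNReal.ofReal_one, one_mul]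

/-- The normalized indicator function of an interval. -/
def slab (ε t : ℝ) : ℝ≥0∞ := (Set.Ioo (-ε) ε).indicator (fun _ => ENNReal.ofReal ε⁻¹) t

@[fun_prop]
theorem measurable_slab (ε : ℝ) : Measurable (slab ε) :=
  measurable_const.indicator measurableSet_Ioo

-- Along the slice the inner product with `x` is linear in `s` with slope `‖M.starProjection x‖`. A
-- slab of width `ε` thus restricts `s` alone, to an interval of length proportional to `ε /
-- ‖M.starProjection x‖`.
omit [MeasurableSpace F] [BorelSpace F] in
theorem inner_starProjection_inf_add (M : Submodule ℝ F) {x : F} (hx : M.starProjection x ≠ 0)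
    (h : F) (s : ℝ) :
    ⟪x, (M ⊓ (ℝ ∙ x)ᗮ).starProjection h + s • nrm (M.starProjection x)⟫ =
      s * ‖M.starProjection x‖ := by
  have h1 : ⟪x, (M ⊓ (ℝ ∙ x)ᗮ).starProjection h⟫ = 0 :=
    Submodule.mem_orthogonal_singleton_iff_inner_right.1
      (Submodule.starProjection_apply_mem (M ⊓ (ℝ ∙ x)ᗮ) h).2
  have h2 : ⟪x, M.starProjection x⟫ = ‖M.starProjection x‖ ^ 2 := by
    rw [← real_inner_self_eq_norm_sq, Submodule.inner_starProjection_left_eq_right,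
      M.starProjection_eq_self_iff.2 (M.starProjection_apply_mem x)]
  have h3 : ‖M.starProjection x‖ ≠ 0 := norm_ne_zero_iff.2 hx
  rw [inner_add_right, h1, nrm, smul_smul, inner_smul_right, h2]
  field_simp
  simp

/-- The function whose integral is a thickening of the slice integral. -/
def thickened (L M : Submodule ℝ F) (f : F × F → ℝ≥0∞) (ε : ℝ) (x h : F) (τ : ℝ) : ℝ≥0∞ :=
  (ENNReal.ofReal ‖M.starProjection x‖)⁻¹ * (gaussWeight (ε / ‖M.starProjection x‖ * τ) *
    (swapWeight L M x ((M ⊓ (ℝ ∙ x)ᗮ).starProjection h +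
        (ε / ‖M.starProjection x‖ * τ) • nrm (M.starProjection x)) *
      f (x, (M ⊓ (ℝ ∙ x)ᗮ).starProjection h +
        (ε / ‖M.starProjection x‖ * τ) • nrm (M.starProjection x))))

theorem measurable_swapWeight (L M : Submodule ℝ F) :
    Measurable fun p : F × F => swapWeight L M p.1 p.2 :=
  (continuous_swapWeight L M).measurable

/-- Slice along the projection of `x` to `M` and substitute `s = (ε / m) τ` with `m =
‖M.starProjection x‖`. The slab becomes `|τ| < 1`, and the Jacobian `ε / m` times the height `ε⁻¹`
leaves `m⁻¹`. -/
theorem lintegral_slab (L M : Submodule ℝ F) {f : F × F → ℝ≥0∞} (hf : Measurable f) {ε : ℝ}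
    (hε : 0 < ε) (x : F) :
    ∫⁻ h, swapWeight L M x (M.starProjection h) * f (x, M.starProjection h) *
        slab ε ⟪x, M.starProjection h⟫ ∂gauss F =
      ∫⁻ h, (∫⁻ τ in Set.Ioo (-1) 1, thickened L M f ε x h τ) ∂gauss F := by
  -- Here the weight vanishes and both sides are 0.
  by_cases hx : M.starProjection x = 0
  · simp [thickened, swapWeight, hx]
  have hm : 0 < ‖M.starProjection x‖ := norm_pos_iff.2 hx
  obtain ⟨φ, hφ, hφm⟩ : ∃ φ : F → ℝ≥0∞, (∀ y, φ y = swapWeight L M x y * f (x, y)) ∧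
      Measurable φ :=
    ⟨fun y => swapWeight L M x y * f (x, y), fun y => by rfl,
      ((measurable_swapWeight L M).comp measurable_prodMk_left).mul
        (hf.comp measurable_prodMk_left)⟩
  simp only [thickened, ← hφ]
  have hsm : Measurable fun y => φ y * slab ε ⟪x, y⟫ := by fun_prop
  refine (lintegral_gauss_slice_subspace M hx hsm).trans (lintegral_congr fun h => ?_)
  simp only [inner_starProjection_inf_add M hx]
  generalize (M ⊓ (ℝ ∙ x)ᗮ).starProjection h = y'
  generalize nrm (M.starProjection x) = e
  generalize ‖M.starProjection x‖ = m at hm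
  rw [lintegral_real_mul_left (div_pos hε hm) (by fun_prop),
    ← lintegral_indicator measurableSet_Ioo, ← lintegral_const_mul _ (by fun_prop)]
  refine lintegral_congr fun τ => ?_
  have h1 : ε / m * τ * m = ε * τ := by field_simp
  rw [h1, slab]
  by_cases hτ : τ ∈ Set.Ioo (-1) 1
  · rw [Set.indicator_of_mem hτ, Set.indicator_of_mem (by constructor <;> nlinarith [hτ.1, hτ.2]),
      ← ENNReal.ofReal_inv_of_pos hm]
    have h2 : ENNReal.ofReal m⁻¹ = ENNReal.ofReal (ε / m) * ENNReal.ofReal ε⁻¹ := by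
      rw [← ENNReal.ofReal_mul (by positivity)]
      congr 1
      field_simp
    rw [h2]
    ring
  · rw [Set.indicator_of_notMem hτ, Set.indicator_of_notMem, mul_zero, mul_zero, mul_zero]
    intro h2
    exact hτ ⟨by nlinarith [h2.1], by nlinarith [h2.2]⟩

theorem measurable_starProjection_inf (M : Submodule ℝ F) :
    Measurable fun p : F × F => (M ⊓ (ℝ ∙ p.1)ᗮ).starProjection p.2 := by
  simp only [starProjection_inf_orthogonal_singleton]
  fun_prop

theorem measurable_thickened (L M : Submodule ℝ F) {f : F × F → ℝ≥0∞} (hf : Measurable f) (ε : ℝ) :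
    Measurable fun p : (F × F) × ℝ =>
      thickened L M f ε (L.starProjection p.1.1) p.1.2 p.2 := by
  unfold thickened
  have h1 : Measurable fun p : (F × F) × ℝ =>
      (M ⊓ (ℝ ∙ L.starProjection p.1.1)ᗮ).starProjection p.1.2 :=
    (measurable_starProjection_inf M).comp (f := fun p : (F × F) × ℝ =>
      (L.starProjection p.1.1, p.1.2)) (by fun_prop)
  have h2 : Measurable fun p : (F × F) × ℝ =>
      swapWeight L M (L.starProjection p.1.1)
        ((M ⊓ (ℝ ∙ L.starProjection p.1.1)ᗮ).starProjection p.1.2 +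
          (ε / ‖M.starProjection (L.starProjection p.1.1)‖ * p.2) •
            nrm (M.starProjection (L.starProjection p.1.1))) :=
    (measurable_swapWeight L M).comp (f := fun p : (F × F) × ℝ => (L.starProjection p.1.1, 
        ((M ⊓ (ℝ ∙ L.starProjection p.1.1)ᗮ).starProjection p.1.2 +
          (ε / ‖M.starProjection (L.starProjection p.1.1)‖ * p.2) •
            nrm (M.starProjection (L.starProjection p.1.1))))) (by fun_prop)
  fun_prop

omit [MeasurableSpace F] [BorelSpace F] in
theorem tendsto_thickened (L M : Submodule ℝ F) (f : BoundedContinuousFunction (F × F) NNReal)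
    (x h : F) (τ : ℝ) :
    Tendsto (fun n : ℕ => thickened L M (fun p => f p) ((n : ℝ) + 1)⁻¹ x h τ) atTop
      (𝓝 (thickened L M (fun p => f p) 0 x h τ)) := by
  by_cases hx : M.starProjection x = 0
  · simp [thickened, swapWeight, hx]
  have hm : 0 < ‖M.starProjection x‖ := norm_pos_iff.2 hx
  let G : ℝ → ℝ := fun ε => Real.exp (-Real.pi * (ε / ‖M.starProjection x‖ * τ) ^ 2) *
    ((min ‖M.starProjection x‖ 1 * min ‖L.starProjection ((M ⊓ (ℝ ∙ x)ᗮ).starProjection h +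
        (ε / ‖M.starProjection x‖ * τ) • nrm (M.starProjection x))‖ 1) *
      (f (x, (M ⊓ (ℝ ∙ x)ᗮ).starProjection h +
        (ε / ‖M.starProjection x‖ * τ) • nrm (M.starProjection x)) : NNReal))
  have hG : Continuous G := by fun_prop
  have h1 : ∀ ε, thickened L M (fun p => f p) ε x h τ =
      (ENNReal.ofReal ‖M.starProjection x‖)⁻¹ * ENNReal.ofReal (G ε) := fun ε => by
    simp only [thickened, G, gaussWeight, swapWeight]
    rw [ENNReal.ofReal_mul (Real.exp_pos _).le, ENNReal.ofReal_mul' (NNReal.coe_nonneg _),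
      ENNReal.ofReal_coe_nnreal]
  simp only [h1]
  refine ENNReal.Tendsto.const_mul ?_ (Or.inr ?_)
  · refine (ENNReal.continuous_ofReal.tendsto _).comp ((hG.tendsto _).comp ?_)
    simpa using tendsto_one_div_add_atTop_nhds_zero_nat (𝕜 := ℝ)
  · simpa using hx

omit [MeasurableSpace F] [BorelSpace F] in
theorem thickened_le (L M : Submodule ℝ F) (f : BoundedContinuousFunction (F × F) NNReal)
    (ε : ℝ) (x h : F) (τ : ℝ) :
    thickened L M (fun p => f p) ε x h τ ≤ ENNReal.ofNNReal (nndist f 0) := by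
  rw [thickened, mul_left_comm, ← mul_assoc ((ENNReal.ofReal _)⁻¹)]
  refine (mul_le_mul' ?_ (mul_le_mul' (inv_mul_swapWeight_le L M x _) ?_)).trans
    (by rw [one_mul, one_mul])
  · unfold gaussWeight
    rw [ENNReal.ofReal_le_one, Real.exp_le_one_iff]
    nlinarith [Real.pi_pos, sq_nonneg (ε / ‖M.starProjection x‖ * τ)]
  · exact_mod_cast BoundedContinuousFunction.NNReal.upper_bound f _

/-- Dominated convergence, with boundedness of `f` for the bound and continuity for the pointwise
limit. At `ε = 0` the integrand no longer depends on `τ`, so the length of `(-1, 1)` comes out as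
the factor 2. -/
theorem tendsto_lintegral_slab (L M : Submodule ℝ F)
    (f : BoundedContinuousFunction (F × F) NNReal) :
    Tendsto (fun n : ℕ => ∫⁻ g, ∫⁻ h, swapWeight L M (L.starProjection g) (M.starProjection h) *
        f (L.starProjection g, M.starProjection h) *
        slab ((n : ℝ) + 1)⁻¹ ⟪L.starProjection g, M.starProjection h⟫ ∂gauss F ∂gauss F) atTop
      (𝓝 (2 * ∫⁻ g, ∫⁻ h, (ENNReal.ofReal ‖M.starProjection (L.starProjection g)‖)⁻¹ *
        (swapWeight L M (L.starProjection g)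
          ((M ⊓ (ℝ ∙ L.starProjection g)ᗮ).starProjection h) *
        f (L.starProjection g, (M ⊓ (ℝ ∙ L.starProjection g)ᗮ).starProjection h))
          ∂gauss F ∂gauss F)) := by
  have hf : Measurable fun p => (f p : ℝ≥0∞) :=
    f.continuous.measurable.coe_nnreal_ennreal
  let μ : Measure ((F × F) × ℝ) := ((gauss F).prod (gauss F)).prod (volume.restrict (Set.Ioo (-1) 1))
  have hfin : IsFiniteMeasure (volume.restrict (Set.Ioo (-1 : ℝ) 1)) := ⟨by simp⟩
  have hlim : Tendsto (fun n : ℕ => ∫⁻ p, thickened L M (fun p => f p) ((n : ℝ) + 1)⁻¹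
      (L.starProjection p.1.1) p.1.2 p.2 ∂μ) atTop
      (𝓝 (∫⁻ p, thickened L M (fun p => f p) 0 (L.starProjection p.1.1) p.1.2 p.2 ∂μ)) := by
    refine tendsto_lintegral_of_dominated_convergence (fun _ => ENNReal.ofNNReal (nndist f 0))
      (fun n => measurable_thickened L M hf _)
      (fun n => Eventually.of_forall fun p => thickened_le L M f _ _ _ _) ?_
      (Eventually.of_forall fun p => tendsto_thickened L M f _ _ _)
    rw [lintegral_const]
    exact ENNReal.mul_ne_top ENNReal.coe_ne_top (measure_ne_top _ _)
  have hnest : ∀ ε, ∫⁻ p, thickened L M (fun p => f p) ε (L.starProjection p.1.1) p.1.2 p.2 ∂μ =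
      ∫⁻ g, ∫⁻ h, (∫⁻ τ in Set.Ioo (-1) 1, thickened L M (fun p => f p) ε
        (L.starProjection g) h τ) ∂gauss F ∂gauss F := fun ε => by
    have hmeas := measurable_thickened L M hf ε
    rw [lintegral_prod _ hmeas.aemeasurable, lintegral_prod _
      (Measurable.lintegral_prod_right' (f := fun p : (F × F) × ℝ => thickened L M (fun p => f p) ε
        (L.starProjection p.1.1) p.1.2 p.2) hmeas).aemeasurable]
  simp only [hnest] at hlim
  have h1 := fun n : ℕ => fun x => (lintegral_slab L M hf (inv_pos.2 (Nat.cast_add_one_pos n)) x)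
  simp only [h1]
  convert hlim using 2
  have hmeas := measurable_thickened L M hf 0
  rw [← lintegral_const_mul]
  · refine lintegral_congr fun g => ?_
    rw [← lintegral_const_mul]
    · refine lintegral_congr fun h => ?_
      simp [thickened, gaussWeight, mul_comm]
      norm_num
    · have := hmeas.comp (f := fun h : F => ((g, h), (0 : ℝ))) (by fun_prop)
      simpa [thickened, gaussWeight, Function.comp_def] using this
  · have := Measurable.lintegral_prod_right' (ν := gauss F)
      (hmeas.comp (f := fun p : F × F => (p, (0 : ℝ))) (by fun_prop))
    simpa [thickened, gaussWeight, Function.comp_def] using this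

end Swap

end OrthoGraph

end

open MeasureTheory Filter Topology
open scoped ENNReal

noncomputable section

namespace OrthoGraph

open scoped RealInnerProductSpace

/-! ### Symmetry for pairs of orthogonal Gaussian vectors. -/

section Swap

variable {F : Type*} [NormedAddCommGroup F] [InnerProductSpace ℝ F] [MeasurableSpace F]
  [BorelSpace F] [FiniteDimensional ℝ F]

/-- The law of a pair of orthogonal Gaussian vectors in two subspaces, the first one chosen first,
with the density that makes the choice symmetric up to the weight. -/
def orthoPair (L M : Submodule ℝ F) : Measure (F × F) :=
  (((gauss F).prod (gauss F)).withDensity fun p =>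
    (ENNReal.ofReal ‖M.starProjection (L.starProjection p.1)‖)⁻¹ *
      swapWeight L M (L.starProjection p.1)
        ((M ⊓ (ℝ ∙ L.starProjection p.1)ᗮ).starProjection p.2)).map fun p =>
    (L.starProjection p.1, (M ⊓ (ℝ ∙ L.starProjection p.1)ᗮ).starProjection p.2)

theorem measurable_orthoPair_map (L M : Submodule ℝ F) : Measurable fun p : F × F =>
    (L.starProjection p.1, (M ⊓ (ℝ ∙ L.starProjection p.1)ᗮ).starProjection p.2) := by
  have h1 : Measurable fun p : F × F =>
      (M ⊓ (ℝ ∙ L.starProjection p.1)ᗮ).starProjection p.2 :=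
    (measurable_starProjection_inf M).comp (f := fun p : F × F =>
      (L.starProjection p.1, p.2)) (by fun_prop)
  fun_prop

theorem measurable_orthoPair_density (L M : Submodule ℝ F) : Measurable fun p : F × F =>
    (ENNReal.ofReal ‖M.starProjection (L.starProjection p.1)‖)⁻¹ *
      swapWeight L M (L.starProjection p.1)
        ((M ⊓ (ℝ ∙ L.starProjection p.1)ᗮ).starProjection p.2) := by
  have h2 := (measurable_swapWeight L M).comp (measurable_orthoPair_map L M)
  simp only [Function.comp_def] at h2
  fun_prop

instance (L M : Submodule ℝ F) : IsFiniteMeasure (orthoPair L M) := by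
  have h : IsFiniteMeasure (((gauss F).prod (gauss F)).withDensity fun p =>
    (ENNReal.ofReal ‖M.starProjection (L.starProjection p.1)‖)⁻¹ *
      swapWeight L M (L.starProjection p.1)
        ((M ⊓ (ℝ ∙ L.starProjection p.1)ᗮ).starProjection p.2)) := by
    refine isFiniteMeasure_withDensity (ne_of_lt ?_)
    refine (lintegral_mono fun p => inv_mul_swapWeight_le L M _ _).trans_lt ?_
    simp
  unfold orthoPair
  infer_instance

theorem lintegral_orthoPair (L M : Submodule ℝ F) {f : F × F → ℝ≥0∞} (hf : Measurable f) :
    ∫⁻ p, f p ∂orthoPair L M =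
      ∫⁻ g, ∫⁻ h, (ENNReal.ofReal ‖M.starProjection (L.starProjection g)‖)⁻¹ *
        (swapWeight L M (L.starProjection g)
          ((M ⊓ (ℝ ∙ L.starProjection g)ᗮ).starProjection h) *
        f (L.starProjection g, (M ⊓ (ℝ ∙ L.starProjection g)ᗮ).starProjection h))
          ∂gauss F ∂gauss F := by
  have hm := measurable_orthoPair_map L M
  have hd := measurable_orthoPair_density L M
  have hfm : Measurable fun p : F × F =>
    f (L.starProjection p.1, (M ⊓ (ℝ ∙ L.starProjection p.1)ᗮ).starProjection p.2) := hf.comp hm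
  rw [orthoPair, lintegral_map hf hm,
    lintegral_withDensity_eq_lintegral_mul _ hd hfm, lintegral_prod _ (hd.mul hfm).aemeasurable]
  simp only [Pi.mul_apply, mul_assoc]

/-- Before the limit the thickened integral is symmetric in the two subspaces by Tonelli, so the two
limits agree. Bounded continuous functions determine a finite measure; finiteness is what the weight
was introduced for. -/
theorem orthoPair_swap (L M : Submodule ℝ F) :
    orthoPair L M = (orthoPair M L).map Prod.swap := by
  refine ext_of_forall_lintegral_eq_of_IsFiniteMeasure fun f => ?_
  have hf : Measurable fun p => (f p : ℝ≥0∞) :=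
    f.continuous.measurable.coe_nnreal_ennreal
  let f' : BoundedContinuousFunction (F × F) NNReal :=
    f.compContinuous ⟨Prod.swap, continuous_swap⟩
  have hf' : Measurable fun p => (f' p : ℝ≥0∞) := f'.continuous.measurable.coe_nnreal_ennreal
  rw [lintegral_map hf measurable_swap, lintegral_orthoPair L M hf]
  change _ = ∫⁻ p, (f' p : ℝ≥0∞) ∂orthoPair M L
  rw [lintegral_orthoPair M L hf']
  have h1 := tendsto_lintegral_slab L M f
  have h2 := tendsto_lintegral_slab M L f'
  have h3 : ∀ ε, ∫⁻ g, ∫⁻ h, swapWeight L M (L.starProjection g) (M.starProjection h) *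
        f (L.starProjection g, M.starProjection h) *
        slab ε ⟪L.starProjection g, M.starProjection h⟫ ∂gauss F ∂gauss F =
      ∫⁻ g, ∫⁻ h, swapWeight M L (M.starProjection g) (L.starProjection h) *
        f' (M.starProjection g, L.starProjection h) *
        slab ε ⟪M.starProjection g, L.starProjection h⟫ ∂gauss F ∂gauss F := fun ε => by
    rw [lintegral_lintegral_swap]
    · refine lintegral_congr fun g => lintegral_congr fun h => ?_
      rw [swapWeight_comm, real_inner_comm]
      rfl
    · have hp : Measurable fun p : F × F => (L.starProjection p.1, M.starProjection p.2) := by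
        fun_prop
      have hw := (measurable_swapWeight L M).comp hp
      have hc := hf.comp hp
      simp only [Function.comp_def] at hw hc
      have hs : Measurable fun p : F × F =>
          slab ε ⟪L.starProjection p.1, M.starProjection p.2⟫ := by fun_prop
      exact ((hw.mul hc).mul hs).aemeasurable
  simp only [h3] at h1
  have h4 := tendsto_nhds_unique h1 h2
  exact (ENNReal.mul_right_inj two_ne_zero ENNReal.ofNat_ne_top).1 h4

theorem lintegral_gauss_swap_weight (L M : Submodule ℝ F) {f : F × F → ℝ≥0∞} (hf : Measurable f) :
    ∫⁻ g, ∫⁻ h, (ENNReal.ofReal ‖M.starProjection (L.starProjection g)‖)⁻¹ *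
        (swapWeight L M (L.starProjection g)
          ((M ⊓ (ℝ ∙ L.starProjection g)ᗮ).starProjection h) *
        f (L.starProjection g, (M ⊓ (ℝ ∙ L.starProjection g)ᗮ).starProjection h))
          ∂gauss F ∂gauss F =
      ∫⁻ g, ∫⁻ h, (ENNReal.ofReal ‖L.starProjection (M.starProjection g)‖)⁻¹ *
        (swapWeight M L (M.starProjection g)
          ((L ⊓ (ℝ ∙ M.starProjection g)ᗮ).starProjection h) *
        f ((L ⊓ (ℝ ∙ M.starProjection g)ᗮ).starProjection h, M.starProjection g))
          ∂gauss F ∂gauss F := by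
  rw [← lintegral_orthoPair L M hf, orthoPair_swap, lintegral_map hf measurable_swap,
    lintegral_orthoPair M L (f := fun p => f p.swap) (hf.comp measurable_swap)]
  rfl

omit [MeasurableSpace F] [BorelSpace F] in
theorem starProjection_comp_ne_zero {L M : Submodule ℝ F} (h : L ⊓ M ≠ ⊥) :
    M.starProjection ∘L L.starProjection ≠ 0 := by
  obtain ⟨z, hz, hz0⟩ := (Submodule.ne_bot_iff _).1 h
  intro h0
  have := DFunLike.congr_fun h0 z
  rw [ContinuousLinearMap.comp_apply, L.starProjection_eq_self_iff.2 hz.1,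
    M.starProjection_eq_self_iff.2 hz.2] at this
  exact hz0 (by simpa using this)

/-- Symmetry of the choice of a pair of orthogonal Gaussian vectors from two subspaces. -/
theorem lintegral_gauss_swap {L M : Submodule ℝ F}
    (h2 : 2 ≤ Module.finrank ℝ ↥(L ⊓ M)) {f : F × F → ℝ≥0∞} (hf : Measurable f) :
    ∫⁻ g, ∫⁻ h, (ENNReal.ofReal ‖M.starProjection (L.starProjection g)‖)⁻¹ *
        f (L.starProjection g, (M ⊓ (ℝ ∙ L.starProjection g)ᗮ).starProjection h)
          ∂gauss F ∂gauss F =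
      ∫⁻ g, ∫⁻ h, (ENNReal.ofReal ‖L.starProjection (M.starProjection g)‖)⁻¹ *
        f ((L ⊓ (ℝ ∙ M.starProjection g)ᗮ).starProjection h, M.starProjection g)
          ∂gauss F ∂gauss F := by
  -- The weight is removed by applying the weighted identity to `f` divided by the weight. This is
  -- legitimate where the weight is nonzero, which is almost everywhere.
  have key : ∀ {L M : Submodule ℝ F}, 2 ≤ Module.finrank ℝ ↥(L ⊓ M) →
      ∀ f : F × F → ℝ≥0∞, ∫⁻ g, ∫⁻ h, (ENNReal.ofReal ‖M.starProjection (L.starProjection g)‖)⁻¹ *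
        (swapWeight L M (L.starProjection g)
          ((M ⊓ (ℝ ∙ L.starProjection g)ᗮ).starProjection h) *
        ((swapWeight L M (L.starProjection g)
          ((M ⊓ (ℝ ∙ L.starProjection g)ᗮ).starProjection h))⁻¹ *
            f (L.starProjection g, (M ⊓ (ℝ ∙ L.starProjection g)ᗮ).starProjection h)))
          ∂gauss F ∂gauss F =
      ∫⁻ g, ∫⁻ h, (ENNReal.ofReal ‖M.starProjection (L.starProjection g)‖)⁻¹ *
        f (L.starProjection g, (M ⊓ (ℝ ∙ L.starProjection g)ᗮ).starProjection h)
          ∂gauss F ∂gauss F := by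
    intro L M h2 f
    have hK : L ⊓ M ≠ ⊥ := fun h => by rw [h, finrank_bot] at h2; omega
    refine lintegral_congr_ae ?_
    filter_upwards [gauss_ae_ne_zero (starProjection_comp_ne_zero hK)] with g hg
    refine lintegral_congr_ae ?_
    -- Dimension 2 of `L ⊓ M` is used here: one condition of orthogonality still leaves a nonzero
    -- vector, so the second factor of the weight is almost surely positive.
    have hK2 : (M ⊓ (ℝ ∙ L.starProjection g)ᗮ) ⊓ L ≠ ⊥ := fun h => by
      have h3 := finrank_le_inf_orthogonal (L ⊓ M) (L.starProjection g)
      rw [inf_right_comm, inf_comm M L] at h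
      rw [h, finrank_bot] at h3
      omega
    filter_upwards [gauss_ae_ne_zero (starProjection_comp_ne_zero hK2)] with h hh
    congr 1
    rw [← mul_assoc, ENNReal.mul_inv_cancel, one_mul]
    · have h4 : 0 < ‖M.starProjection (L.starProjection g)‖ := norm_pos_iff.2 hg
      have h5 : 0 < ‖L.starProjection ((M ⊓ (ℝ ∙ L.starProjection g)ᗮ).starProjection h)‖ :=
        norm_pos_iff.2 hh
      simp only [swapWeight, ne_eq, ENNReal.ofReal_eq_zero, not_le]
      positivity
    · exact ENNReal.ofReal_ne_top
  have hw : Measurable fun p : F × F => (swapWeight L M p.1 p.2)⁻¹ :=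
    (measurable_swapWeight L M).inv
  have k2 := key (L := M) (M := L) (by rwa [inf_comm]) (fun p => f (p.2, p.1))
  dsimp only at k2
  rw [← key h2 f, ← k2,
    lintegral_gauss_swap_weight L M (f := fun p => (swapWeight L M p.1 p.2)⁻¹ * f p) (hw.mul hf)]
  simp only [swapWeight_comm M L]

end Swap

/-! ### Symmetry for pairs of orthogonal unit vectors. -/

section SphereSwap

variable {d : ℕ}

theorem measurable_finrank_inf (M : Submodule ℝ (E d)) :
    Measurable fun u : E d => Module.finrank ℝ ↥(M ⊓ (ℝ ∙ u)ᗮ) := by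
  classical
  have : (fun u : E d => Module.finrank ℝ ↥(M ⊓ (ℝ ∙ u)ᗮ)) = fun u =>
      if M.starProjection u = 0 then Module.finrank ℝ M else Module.finrank ℝ M - 1 := by
    ext u
    split_ifs with h
    · have h0 : (ℝ ∙ (0 : E d))ᗮ = ⊤ := by
        rw [Submodule.span_zero_singleton, Submodule.bot_orthogonal_eq_top]
      rw [← inf_orthogonal_starProjection, h, h0, inf_top_eq]
    · exact finrank_inf_orthogonal h
  rw [this]
  refine Measurable.ite ?_ measurable_const measurable_const
  exact (measurableSet_singleton (0 : E d)).preimage M.starProjection.continuous.measurable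

theorem inf_orthogonal_ne_bot {M : Submodule ℝ (E d)} (hM : 2 ≤ Module.finrank ℝ M) (u : E d) :
    M ⊓ (ℝ ∙ u)ᗮ ≠ ⊥ := fun h => by
  have := finrank_le_inf_orthogonal M u
  rw [h, finrank_bot] at this
  omega

theorem measurable_lintegral_surf_inf {M : Submodule ℝ (E d)} (hM : 2 ≤ Module.finrank ℝ M)
    {f : E d × E d → ℝ≥0∞} (hf : Measurable f) :
    Measurable fun u => (ENNReal.ofReal ‖M.starProjection u‖)⁻¹ *
      (∫⁻ v, f (u, v) ∂surf (M ⊓ (ℝ ∙ u)ᗮ)) := by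
  have hinner : ∀ u, ∫⁻ v, f (u, v) ∂surf (M ⊓ (ℝ ∙ u)ᗮ) =
      ENNReal.ofReal (sphereArea (Module.finrank ℝ ↥(M ⊓ (ℝ ∙ u)ᗮ) - 1)) *
        ∫⁻ h, f (u, nrm ((M ⊓ (ℝ ∙ u)ᗮ).starProjection h)) ∂gauss (E d) := fun u =>
    lintegral_surf (inf_orthogonal_ne_bot hM u) (hf.comp measurable_prodMk_left)
  simp only [hinner]
  have h1 : Measurable fun u : E d =>
      ENNReal.ofReal (sphereArea (Module.finrank ℝ ↥(M ⊓ (ℝ ∙ u)ᗮ) - 1)) :=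
    (measurable_from_top (f := fun k : ℕ => ENNReal.ofReal (sphereArea (k - 1)))).comp
      (measurable_finrank_inf M)
  have h2 : Measurable fun u : E d =>
      ∫⁻ h, f (u, nrm ((M ⊓ (ℝ ∙ u)ᗮ).starProjection h)) ∂gauss (E d) :=
    Measurable.lintegral_prod_right' (f := fun p : E d × E d =>
      f (p.1, nrm ((M ⊓ (ℝ ∙ p.1)ᗮ).starProjection p.2)))
      (hf.comp (measurable_fst.prodMk (measurable_nrm.comp (measurable_starProjection_inf M))))
  fun_prop

/-- The integral over pairs of orthogonal unit vectors, in Gaussian form. -/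
theorem lintegral_surf_inf {L M : Submodule ℝ (E d)} (h2 : 2 ≤ Module.finrank ℝ ↥(L ⊓ M))
    {f : E d × E d → ℝ≥0∞} (hf : Measurable f) :
    ∫⁻ u, (ENNReal.ofReal ‖M.starProjection u‖)⁻¹ *
        (∫⁻ v, f (u, v) ∂surf (M ⊓ (ℝ ∙ u)ᗮ)) ∂surf L =
      ENNReal.ofReal (sphereArea (Module.finrank ℝ L - 1)) *
        (ENNReal.ofReal (sphereArea (Module.finrank ℝ M - 1)) *
        ∫⁻ g, ∫⁻ h, (ENNReal.ofReal ‖M.starProjection (L.starProjection g)‖)⁻¹ *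
          (ENNReal.ofReal ‖L.starProjection g‖ *
            ENNReal.ofReal ‖(M ⊓ (ℝ ∙ L.starProjection g)ᗮ).starProjection h‖ *
            f (nrm (L.starProjection g),
              nrm ((M ⊓ (ℝ ∙ L.starProjection g)ᗮ).starProjection h)))
          ∂gauss (E d) ∂gauss (E d)) := by
  have hM2 : 2 ≤ Module.finrank ℝ M := h2.trans (Submodule.finrank_mono inf_le_right)
  have hN := inf_orthogonal_ne_bot hM2
  have hK : L ⊓ M ≠ ⊥ := fun h => by rw [h, finrank_bot] at h2; omega
  have hL : L ≠ ⊥ := fun h => hK (by rw [h, bot_inf_eq])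
  have hmeas := measurable_lintegral_surf_inf hM2 hf
  rw [lintegral_surf hL hmeas]
  congr 1
  rw [← lintegral_const_mul' _ _ ENNReal.ofReal_ne_top]
  refine lintegral_congr_ae ?_
  filter_upwards [gauss_ae_ne_zero (starProjection_comp_ne_zero hK)] with g hg
  set x := L.starProjection g with hx
  have hMx : M.starProjection x ≠ 0 := hg
  have hx0 : x ≠ 0 := fun h => hMx (by rw [h, map_zero])
  have hxn : 0 < ‖x‖ := norm_pos_iff.2 hx0
  -- By homogeneity, replacing the unit vector by the Gaussian vector `x` costs the factor `‖x‖`.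
  have e1 : (ENNReal.ofReal ‖M.starProjection (nrm x)‖)⁻¹ =
      (ENNReal.ofReal ‖M.starProjection x‖)⁻¹ * ENNReal.ofReal ‖x‖ := by
    have h4 : 0 < ‖M.starProjection x‖ := norm_pos_iff.2 hMx
    rw [nrm, map_smul, norm_smul, norm_inv, norm_norm, ← ENNReal.ofReal_inv_of_pos (by positivity),
      ← ENNReal.ofReal_inv_of_pos h4, ← ENNReal.ofReal_mul (by positivity)]
    congr 1
    field_simp
  have e2 : ∫⁻ v, f (nrm x, v) ∂surf (M ⊓ (ℝ ∙ nrm x)ᗮ) =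
      ENNReal.ofReal (sphereArea (Module.finrank ℝ M - 1)) *
        ∫⁻ h, ENNReal.ofReal ‖(M ⊓ (ℝ ∙ x)ᗮ).starProjection h‖ *
          f (nrm x, nrm ((M ⊓ (ℝ ∙ x)ᗮ).starProjection h)) ∂gauss (E d) := by
    have h5 := lintegral_gauss_radial (hN x) (f := fun v => f (nrm x, v))
      (hf.comp measurable_prodMk_left) (ρ := fun r => ENNReal.ofReal r) (by fun_prop)
    simp only [mul_comm (f _)] at h5
    rw [h5, orthogonal_singleton_nrm, mul_left_comm]
    -- The complement of `x` in `M` has one dimension less, and the extra weight `r` compensates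
    -- exactly. The normalizing area is therefore that of the sphere of `M`, and the resulting
    -- formula is symmetric in `L` and `M`.
    have h6 : ∫⁻ r in Set.Ioi (0 : ℝ), ENNReal.ofReal
        (r ^ (Module.finrank ℝ ↥(M ⊓ (ℝ ∙ x)ᗮ) - 1)) * (gaussWeight r * ENNReal.ofReal r) =
        ∫⁻ r in Set.Ioi (0 : ℝ), ENNReal.ofReal (r ^ (Module.finrank ℝ M - 1)) *
          gaussWeight r := by
      refine setLIntegral_congr_fun measurableSet_Ioi fun r hr => ?_
      have hr' : 0 < r := hr
      rw [mul_comm (gaussWeight r), ← mul_assoc, ← ENNReal.ofReal_mul (by positivity),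
        ← pow_succ, finrank_inf_orthogonal hMx]
      congr 4
      omega
    rw [h6, lintegral_rpow_gaussWeight, mul_one]
  rw [e1, e2, ← lintegral_const_mul' _ _ ENNReal.ofReal_ne_top, ← lintegral_const_mul',
    ← lintegral_const_mul' _ _ ENNReal.ofReal_ne_top]
  · refine lintegral_congr fun h => ?_
    ring
  · refine ENNReal.mul_ne_top ?_ ENNReal.ofReal_ne_top
    simpa using hMx

/-- Symmetry of the choice of a pair of orthogonal unit vectors from two subspaces. -/
theorem lintegral_surf_swap {L M : Submodule ℝ (E d)} (h2 : 2 ≤ Module.finrank ℝ ↥(L ⊓ M))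
    {f : E d × E d → ℝ≥0∞} (hf : Measurable f) :
    ∫⁻ u, (ENNReal.ofReal ‖M.starProjection u‖)⁻¹ *
        (∫⁻ v, f (u, v) ∂surf (M ⊓ (ℝ ∙ u)ᗮ)) ∂surf L =
      ∫⁻ v, (ENNReal.ofReal ‖L.starProjection v‖)⁻¹ *
        (∫⁻ u, f (u, v) ∂surf (L ⊓ (ℝ ∙ v)ᗮ)) ∂surf M := by
  have k2 := lintegral_surf_inf (L := M) (M := L) (f := fun p => f (p.2, p.1))
    (by rwa [inf_comm]) (hf.comp measurable_swap)
  dsimp only at k2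
  rw [lintegral_surf_inf h2 hf, k2, mul_left_comm]
  congr 2
  have h := lintegral_gauss_swap h2 (f := fun p : E d × E d => ENNReal.ofReal ‖p.1‖ *
    ENNReal.ofReal ‖p.2‖ * f (nrm p.1, nrm p.2)) (by fun_prop)
  dsimp only at h
  rw [h]
  refine lintegral_congr fun g => lintegral_congr fun h => ?_
  rw [mul_comm (ENNReal.ofReal ‖(L ⊓ _).starProjection h‖)]

end SphereSwap

end OrthoGraph

end

open MeasureTheory Filter Topology
open scoped ENNReal

noncomputable section

namespace OrthoGraph

section Congr

variable {ι : Type*} {d : ℕ}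

theorem perp_congr {x y : ι → E d} {S : Set ι} (h : ∀ i ∈ S, x i = y i) : perp x S = perp y S := by
  rw [perp, perp, Set.image_congr h]

theorem perp_union (x : ι → E d) (S T : Set ι) : perp x (S ∪ T) = perp x S ⊓ perp x T := by
  rw [perp, Set.image_union, Submodule.span_union, ← Submodule.inf_orthogonal]

theorem genDet_congr [Fintype ι] {x y : ι → E d} {S : Set ι} (h : ∀ i ∈ S, x i = y i) :
    genDet x S = genDet y S := by
  have : (fun i : S => x i) = fun i : S => y i := funext fun i => h i i.2
  rw [genDet, genDet, this]

theorem sDensity_congr [Fintype ι] {x y : ι → E d} {S : Set ι} (h : ∀ i ∈ S, x i = y i) :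
    sDensity d x S = sDensity d y S := by
  rw [sDensity, sDensity, genDet_congr h]

/-- The density with respect to the unnormalized surface measure. -/
theorem sDensity_mul_lintegral [Fintype ι] {x : ι → E d} {S : Set ι} (hS : perp x S ≠ ⊥)
    (f : E d → ℝ≥0∞) :
    sDensity d x S * ∫⁻ y, f y ∂uniformSphere (perp x S) =
      ENNReal.ofReal ((sphereArea (d - 1) / sphereArea (d - 2)) ^ S.ncard / sphereArea (d - 1)) *
        (ENNReal.ofReal (genDet x S))⁻¹ * ∫⁻ y, f y ∂surf (perp x S) := by
  rw [uniformSphere_eq, lintegral_smul_measure, lintegral_subspaceSurface_univ hS, sDensity_eq,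
    smul_eq_mul]
  have h : ENNReal.ofReal (sphereArea (Module.finrank ℝ (perp x S) - 1)) *
      (ENNReal.ofReal (sphereArea (Module.finrank ℝ (perp x S) - 1)))⁻¹ = 1 :=
    ENNReal.mul_inv_cancel (by simpa using sphereArea_pos _) ENNReal.ofReal_ne_top
  set c := ENNReal.ofReal (sphereArea (Module.finrank ℝ (perp x S) - 1))
  rw [mul_right_comm _ c, mul_assoc _ c, ← mul_assoc c, h, one_mul]

end Congr

/-! ### Independence of the order of the nodes. -/

section Sequential

variable {V : Type*} [Fintype V] [DecidableEq V] {d : ℕ}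

/-- The neighbors of `v` in `S`. -/
def nbr (H : SimpleGraph V) (v : V) (S : Set V) : Set V := {u | u ∈ S ∧ H.Adj u v}

/-- Integration over the image of the node `v`, added after the nodes in `S`. -/
def addNode (d : ℕ) (H : SimpleGraph V) (v : V) (S : Set V) (F : (V → E d) → ℝ≥0∞)
    (x : V → E d) : ℝ≥0∞ :=
  sDensity d x (nbr H v S) *
    ∫⁻ y, F (Function.update x v y) ∂uniformSphere (perp x (nbr H v S))

/-- Iterated integration over the images of the nodes of a list, the head being the last node. -/
def addNodes (d : ℕ) (H : SimpleGraph V) : List V → ((V → E d) → ℝ≥0∞) → (V → E d) → ℝ≥0∞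
  | [], F => F
  | v :: l, F => addNodes d H l (addNode d H v {u | u ∈ l} F)

-- The star at `v` is a complete bipartite graph with parts of sizes 1 and `n`, so sparsity gives `n
-- + 1 ≤ d`. Hence the sphere from which the image of `v` is drawn is never empty.
omit [DecidableEq V] in
theorem ncard_nbr_lt {H : SimpleGraph V} (hH : DSparse d H) (hd : 1 ≤ d) (v : V) (S : Set V) :
    (nbr H v S).ncard < d := by
  classical
  rcases (nbr H v S).eq_empty_or_nonempty with h | h
  · rw [h, Set.ncard_empty]; omega
  · have := hH {v} (nbr H v S).toFinset (by simp) (by simpa using h) (by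
      intro a ha b hb
      rw [Finset.mem_singleton] at ha
      rw [Set.mem_toFinset] at hb
      exact ha ▸ hb.2.symm)
    rw [Finset.card_singleton, ← Set.ncard_eq_toFinset_card'] at this
    omega

theorem measurable_addNode {H : SimpleGraph V} {v : V} {S : Set V} (hS : (nbr H v S).ncard < d)
    {F : (V → E d) → ℝ≥0∞} (hF : Measurable F) : Measurable (addNode d H v S F) := by
  unfold addNode
  refine (measurable_sDensity _).mul ?_
  have h : ∀ x : V → E d, ∫⁻ y, F (Function.update x v y) ∂uniformSphere (perp x (nbr H v S)) =
      ∫⁻ g, F (Function.update x v (nrm ((perp x (nbr H v S)).starProjection g))) ∂gauss (E d) :=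
    fun x => lintegral_uniformSphere (perp_ne_bot x hS) (hF.comp (measurable_update x))
  simp only [h]
  exact Measurable.lintegral_prod_right' (f := fun p : (V → E d) × E d =>
    F (Function.update p.1 v (nrm ((perp p.1 (nbr H v S)).starProjection p.2))))
    (hF.comp (measurable_update'.comp (measurable_fst.prodMk
      (measurable_nrm.comp (measurable_starProjection_perp _)))))

omit [Fintype V] in
theorem measurable_update_update {v w : V} (x : V → E d) :
    Measurable fun p : E d × E d => Function.update (Function.update x v p.1) w p.2 :=
  measurable_update'.comp (((measurable_update x).comp measurable_fst).prodMk measurable_snd)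

/-- Neither the density nor the sphere of one node depends on the image of the other, so this is
Tonelli's theorem. -/
theorem addNode_comm_of_not_adj {H : SimpleGraph V} (hH : DSparse d H) (hd : 1 ≤ d) {v w : V}
    (hvw : v ≠ w) (hadj : ¬ H.Adj v w) {S : Set V} (hv : v ∉ S) (hw : w ∉ S)
    {F : (V → E d) → ℝ≥0∞} (hF : Measurable F) :
    addNode d H w S (addNode d H v (insert w S) F) =
      addNode d H v S (addNode d H w (insert v S) F) := by
  have h1 : ∀ {v w : V}, ¬ H.Adj v w → nbr H v (insert w S) = nbr H v S := fun {v w} h => by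
    ext u
    simp only [nbr, Set.mem_ofPred_eq, Set.mem_insert_iff]
    constructor
    · rintro ⟨rfl | hu, hu2⟩
      · exact absurd hu2.symm h
      · exact ⟨hu, hu2⟩
    · exact fun hu => ⟨Or.inr hu.1, hu.2⟩
  have h2 : ∀ {v w : V}, w ∉ S → ∀ (x : V → E d) (y : E d), ∀ i ∈ nbr H v S,
      Function.update x w y i = x i := fun {v w} hw x y i hi =>
    Function.update_of_ne (fun h => hw (by rw [← h]; exact hi.1)) _ _
  ext x
  have hpr := fun v => isProbabilityMeasure_uniformSphere
    (perp_ne_bot x (ncard_nbr_lt hH hd v S))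
  have hprv := hpr v
  have hprw := hpr w
  simp only [addNode, h1 hadj, h1 (fun h => hadj h.symm)]
  simp only [sDensity_congr (h2 hw x _), sDensity_congr (h2 hv x _), perp_congr (h2 hw x _),
    perp_congr (h2 hv x _)]
  have hm1 : Measurable fun p : E d × E d =>
      F (Function.update (Function.update x w p.1) v p.2) := hF.comp (measurable_update_update x)
  have hm2 : Measurable fun p : E d × E d =>
      F (Function.update (Function.update x v p.1) w p.2) := hF.comp (measurable_update_update x)
  rw [lintegral_const_mul _ hm1.lintegral_prod_right', lintegral_const_mul _
    hm2.lintegral_prod_right', lintegral_lintegral_swap hm1.aemeasurable, mul_left_comm]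
  congr 3
  ext z
  congr 1
  ext y
  rw [Function.update_comm hvw.symm]

/-- By base times height, the determinant of the later node splits off `‖(perp x (nbr H v
S)).starProjection y‖`, where `y` is the image of the earlier one. This is exactly the weight in
`lintegral_surf_swap`; the bound on `S` leaves the two complements an intersection of dimension at
least 2. -/
theorem addNode_comm_of_adj {H : SimpleGraph V} {v w : V}
    (hadj : H.Adj v w) {S : Set V} (hv : v ∉ S) (hw : w ∉ S) (hS : S.ncard + 2 ≤ d)
    {F : (V → E d) → ℝ≥0∞} (hF : Measurable F) :
    addNode d H w S (addNode d H v (insert w S) F) =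
      addNode d H v S (addNode d H w (insert v S) F) := by
  have hsub : ∀ v, nbr H v S ⊆ S := fun v u hu => hu.1
  have hcard : ∀ {A : Set V}, A ⊆ S → A.ncard + 2 ≤ d := fun {A} hA =>
    (Nat.add_le_add_right (Set.ncard_le_ncard hA) 2).trans hS
  have h1 : ∀ {v w : V}, H.Adj v w → nbr H v (insert w S) = insert w (nbr H v S) :=
    fun {v w} h => by
      ext u
      simp only [nbr, Set.mem_ofPred_eq, Set.mem_insert_iff]
      constructor
      · rintro ⟨rfl | hu, hu2⟩
        · exact Or.inl rfl
        · exact Or.inr ⟨hu, hu2⟩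
      · rintro (rfl | hu)
        · exact ⟨Or.inl rfl, h.symm⟩
        · exact ⟨Or.inr hu.1, hu.2⟩
  have h2 : ∀ {v w : V}, w ∉ S → ∀ (x : V → E d) (y : E d), ∀ i ∈ nbr H v S,
      Function.update x w y i = x i := fun {v w} hw x y i hi =>
    Function.update_of_ne (fun h => hw (by rw [← h]; exact hi.1)) _ _
  let c : ℕ → ℝ := fun n => (sphereArea (d - 1) / sphereArea (d - 2)) ^ n / sphereArea (d - 1)
  have hc : ∀ n, 0 ≤ c n := fun n => by
    have := sphereArea_pos (d - 1); have := sphereArea_pos (d - 2); positivity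
  have key : ∀ {v w : V}, H.Adj v w → w ∉ S → ∀ x : V → E d,
      addNode d H w S (addNode d H v (insert w S) F) x =
        ENNReal.ofReal (c (nbr H w S).ncard) * (ENNReal.ofReal (genDet x (nbr H w S)))⁻¹ *
          (ENNReal.ofReal (c ((nbr H v S).ncard + 1)) *
            (ENNReal.ofReal (genDet x (nbr H v S)))⁻¹ *
          ∫⁻ y, (ENNReal.ofReal ‖(perp x (nbr H v S)).starProjection y‖)⁻¹ *
            (∫⁻ z, F (Function.update (Function.update x w y) v z)
              ∂surf (perp x (nbr H v S) ⊓ (ℝ ∙ y)ᗮ)) ∂surf (perp x (nbr H w S))) := by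
    intro v w hadj hw x
    have hwv : w ∉ nbr H v S := fun h => hw h.1
    have hd2 : 2 ≤ Module.finrank ℝ (perp x (nbr H v S)) := by
      have := le_finrank_perp x (nbr H v S)
      have := hcard (hsub v)
      omega
    have hF2 : Measurable fun p : E d × E d =>
      F (Function.update (Function.update x w p.1) v p.2) := hF.comp (measurable_update_update x)
    have hmeas := measurable_lintegral_surf_inf hd2 hF2
    rw [addNode, sDensity_mul_lintegral (perp_ne_bot x (by have := hcard (hsub w); omega)),
      ← lintegral_const_mul _ hmeas]
    congr 1
    refine lintegral_congr fun y => ?_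
    have hperp : perp (Function.update x w y) (insert w (nbr H v S)) =
        perp x (nbr H v S) ⊓ (ℝ ∙ y)ᗮ := by
      rw [perp_insert, perp_congr (h2 hw x y), Function.update_self]
    rw [addNode, h1 hadj, sDensity_mul_lintegral, genDet_insert _ hwv, hperp,
      starProjection_congr (perp_congr (h2 hw x y)), genDet_congr (h2 hw x y),
      Function.update_self,
      ENNReal.ofReal_mul (genDet_nonneg _ _), ENNReal.mul_inv (Or.inr ENNReal.ofReal_ne_top)
        (Or.inl ENNReal.ofReal_ne_top), Set.ncard_insert_of_notMem hwv]
    · simp only [c, mul_assoc]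
    · rw [hperp]
      exact inf_orthogonal_ne_bot hd2 y
  ext x
  rw [key hadj hw, key hadj.symm hv]
  have hK : 2 ≤ Module.finrank ℝ ↥(perp x (nbr H w S) ⊓ perp x (nbr H v S)) := by
    rw [← perp_union]
    have h3 := le_finrank_perp x (nbr H w S ∪ nbr H v S)
    have h4 := hcard (Set.union_subset (hsub w) (hsub v))
    omega
  have hF2 : Measurable fun p : E d × E d =>
      F (Function.update (Function.update x w p.1) v p.2) := hF.comp (measurable_update_update x)
  have hswap := lintegral_surf_swap hK hF2
  dsimp only at hswap
  simp only [Function.update_comm hadj.ne.symm] at hswap ⊢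
  rw [hswap]
  -- The edge between the two nodes is counted once on either side, so the total exponents agree.
  have hcc : ENNReal.ofReal (c (nbr H w S).ncard) * ENNReal.ofReal (c ((nbr H v S).ncard + 1)) =
      ENNReal.ofReal (c (nbr H v S).ncard) * ENNReal.ofReal (c ((nbr H w S).ncard + 1)) := by
    rw [← ENNReal.ofReal_mul (hc _), ← ENNReal.ofReal_mul (hc _)]
    congr 1
    simp only [c]
    ring
  have hcomm : ∀ {a b a' b' p q I : ℝ≥0∞}, a * b = a' * b' →
      a * p * (b * q * I) = a' * q * (b' * p * I) := fun {a b a' b' p q I} h => by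
    rw [show a * p * (b * q * I) = a * b * (p * q * I) by ring, h]
    ring
  exact hcomm hcc

/-- Iterated integration does not depend on the order of the nodes. -/
theorem addNodes_perm {H : SimpleGraph V} (hH : DSparse d H) (hd : 1 ≤ d) {l l' : List V}
    (hl : l.Nodup) (hll : l.Perm l') {F : (V → E d) → ℝ≥0∞} (hF : Measurable F) :
    addNodes d H l F = addNodes d H l' F := by
  induction hn : l.length generalizing l l' F with
  | zero =>
    obtain rfl := List.length_eq_zero_iff.1 hn
    rw [List.nil_perm.1 hll]
  | succ n ih =>
    -- With the last node fixed, the induction hypothesis permits any order of the others.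
    have hhead : ∀ {v : V} {a b : List V}, (v :: a).Perm l → (v :: b).Perm l →
        addNodes d H (v :: a) F = addNodes d H (v :: b) F := by
      intro v a b ha hb
      have hab : a.Perm b := (ha.trans hb.symm).cons_inv
      have hset : {u | u ∈ a} = {u | u ∈ b} := by
        ext u
        exact hab.mem_iff
      have hnd : (v :: a).Nodup := ha.nodup_iff.2 hl
      have hlen : a.length = n := by
        have := ha.length_eq
        rw [hn, List.length_cons] at this
        omega
      rw [addNodes, addNodes, hset]
      exact ih (List.nodup_cons.1 hnd).2 hab (measurable_addNode (ncard_nbr_lt hH hd _ _) hF) hlen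
    -- `Q v w` says that the value is the same whether `v` or `w` is processed last, whatever the
    -- order of the rest. It remains to relate all nodes of `l`.
    let Q : V → V → Prop := fun v w => ∀ a b : List V, (v :: a).Perm l → (w :: b).Perm l →
      addNodes d H (v :: a) F = addNodes d H (w :: b) F
    have hQtrans : ∀ {v u w}, u ∈ l → Q v u → Q u w → Q v w := fun {v u w} hu h1 h2 a b ha hb =>
      (h1 a _ ha (List.perm_cons_erase hu).symm).trans (h2 _ b (List.perm_cons_erase hu).symm hb)
    have hswap : ∀ {v w}, v ∈ l → w ∈ l → v ≠ w → (¬ H.Adj v w ∨ l.length ≤ d) → Q v w := by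
      intro v w hv hw hvw hor a b ha hb
      have hw' : w ∈ l.erase v := (List.mem_erase_of_ne hvw.symm).2 hw
      set c := (l.erase v).erase w with hc
      have p1 : (v :: w :: c).Perm l :=
        ((List.perm_cons_erase hw').symm.cons v).trans (List.perm_cons_erase hv).symm
      have p2 : (w :: v :: c).Perm l := (List.Perm.swap v w c).trans p1
      rw [hhead ha p1, ← hhead p2 hb]
      have hnd : (v :: w :: c).Nodup := p1.nodup_iff.2 hl
      simp only [List.nodup_cons, List.mem_cons, not_or] at hnd
      have hlen := p1.length_eq
      simp only [List.length_cons] at hlen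
      have hins : ∀ z, {u | u ∈ z :: c} = insert z {u | u ∈ c} := fun z => by
        ext u
        simp
      simp only [addNodes, hins]
      congr 1
      by_cases hadj : H.Adj v w
      · refine addNode_comm_of_adj hadj (S := {u | u ∈ c}) hnd.1.2 hnd.2.1 ?_ hF
        have : ({u | u ∈ c} : Set V) = (c.toFinset : Set V) := by ext u; simp
        rw [this, Set.ncard_coe_finset, List.toFinset_card_of_nodup hnd.2.2, hlen]
        exact hor.resolve_left (not_not.2 hadj)
      · exact addNode_comm_of_not_adj hH hd hvw hadj (S := {u | u ∈ c}) hnd.1.2 hnd.2.1 hF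
    have hQ : ∀ {v w}, v ∈ l → w ∈ l → Q v w := by
      classical
      intro v w hv hw
      by_contra hvw
      have hQv : Q v v := fun a b ha hb => hhead ha hb
      have hne : v ≠ w := fun h => hvw (h ▸ hQv)
      -- If `w` is not related to `v`, the nodes related to `v` are all adjacent in `H` to those
      -- that are not, since non-adjacent nodes can be exchanged. Sparsity bounds the number of
      -- nodes by `d`, and then even adjacent nodes can be exchanged, a contradiction.
      have hcard := hH (l.toFinset.filter fun u => Q v u) (l.toFinset.filter fun u => ¬ Q v u)
        ⟨v, by simpa [hv] using hQv⟩ ⟨w, by simpa [hw] using hvw⟩ (by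
          intro a ha b hb
          simp only [Finset.mem_filter, List.mem_toFinset] at ha hb
          by_contra hadj
          refine hb.2 (hQtrans ha.1 ha.2 (hswap ha.1 hb.1 (fun h => hb.2 (h ▸ ha.2))
            (Or.inl hadj))))
      rw [Finset.card_filter_add_card_filter_not, List.toFinset_card_of_nodup hl] at hcard
      exact hvw (hswap hv hw hne (Or.inr hcard))
    obtain ⟨v, a, hva⟩ := List.exists_cons_of_length_eq_add_one hn
    obtain ⟨w, b, hwb⟩ := List.exists_cons_of_length_eq_add_one (hll.length_eq.symm.trans hn)
    have hpa : (v :: a).Perm l := by rw [hva]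
    have hpb : (w :: b).Perm l := by rw [← hwb]; exact hll.symm
    rw [hwb]
    conv_lhs => rw [hva]
    exact hQ (hpa.mem_iff.1 (by simp)) (hpb.mem_iff.1 (by simp)) a b hpa hpb

end Sequential

end OrthoGraph

end

open MeasureTheory Filter Topology
open scoped ENNReal

noncomputable section

namespace OrthoGraph

/-! ### Relabelling of nodes. -/

section Image

variable {ι κ : Type*} {d : ℕ}

theorem perp_image (y : κ → E d) (p : ι → κ) (S : Set ι) :
    perp y (p '' S) = perp (fun i => y (p i)) S := by
  rw [perp, perp, Set.image_image]

theorem genDet_image [Fintype ι] [Fintype κ] (y : κ → E d) {p : ι → κ}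
    (hp : Function.Injective p) (S : Set ι) :
    genDet y (p '' S) = genDet (fun i => y (p i)) S := by
  classical
  rw [genDet, genDet]
  congr 1
  have h := Matrix.det_submatrix_equiv_self (Equiv.Set.image p S hp)
    (Matrix.gram ℝ (fun i : ↥(p '' S) => y i))
  have h2 : (Matrix.gram ℝ (fun i : ↥(p '' S) => y i)).submatrix (Equiv.Set.image p S hp)
      (Equiv.Set.image p S hp) = Matrix.gram ℝ (fun i : S => y (p i)) := rfl
  rw [h2] at h
  convert h.symm using 2

theorem sDensity_image [Fintype ι] [Fintype κ] (y : κ → E d) {p : ι → κ}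
    (hp : Function.Injective p) (S : Set ι) :
    sDensity d y (p '' S) = sDensity d (fun i => y (p i)) S := by
  rw [sDensity, sDensity, genDet_image y hp, Set.ncard_image_of_injective _ hp]

end Image

/-! ### The sequential measure as an iterated integral. -/

section Bridge

variable {d : ℕ}

theorem measurable_snoc {n : ℕ} : Measurable fun p : (Fin n → E d) × E d =>
    (Fin.snoc (α := fun _ => E d) p.1 p.2 : Fin (n + 1) → E d) := by
  refine measurable_pi_iff.2 fun i => ?_
  induction i using Fin.lastCases with
  | last => simpa using measurable_snd
  | cast i =>
    simp only [Fin.snoc_castSucc]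
    exact (measurable_pi_apply i).comp measurable_fst

theorem measurable_orthoDensity {n : ℕ} (G : SimpleGraph (Fin n)) :
    Measurable (orthoDensity d G) := by
  unfold orthoDensity
  exact Finset.measurable_fun_prod _ fun v _ => measurable_sDensity _

theorem measurable_map_prodMk {α β γ : Type*} [MeasurableSpace α] [MeasurableSpace β]
    [MeasurableSpace γ] (μ : Measure β) [SFinite μ] {f : α × β → γ} (hf : Measurable f) :
    Measurable fun x => μ.map fun y => f (x, y) := by
  have h : (fun x => μ.map fun y => f (x, y)) = fun x => (μ.map (Prod.mk x)).map f := by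
    ext1 x
    rw [Measure.map_map hf measurable_prodMk_left]
    rfl
  rw [h]
  exact (Measure.measurable_map f hf).comp Measurable.map_prodMk_left

/-- The formula for the integral against `Measure.bind` needs a measurable kernel. In the Gaussian
model only the map varies with `x`, and that map is jointly measurable. -/
theorem measurable_seqKernel {n : ℕ} {S : Set (Fin n)} (hS : S.ncard < d) :
    Measurable fun x : Fin n → E d => (uniformSphere (perp x S)).map
      (fun y => (Fin.snoc (α := fun _ => E d) x y : Fin (n + 1) → E d)) := by
  have hm : Measurable fun p : (Fin n → E d) × E d => (Fin.snoc (α := fun _ => E d) p.1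
      (nrm ((perp p.1 S).starProjection p.2)) : Fin (n + 1) → E d) :=
    measurable_snoc.comp (measurable_fst.prodMk
      (measurable_nrm.comp (measurable_starProjection_perp S)))
  have h1 : ∀ x : Fin n → E d, (uniformSphere (perp x S)).map
      (fun y => (Fin.snoc (α := fun _ => E d) x y : Fin (n + 1) → E d)) =
      (gauss (E d)).map fun g => (Fin.snoc (α := fun _ => E d) x
        (nrm ((perp x S).starProjection g)) : Fin (n + 1) → E d) := fun x => by
    have hsn : Measurable fun y => (Fin.snoc (α := fun _ => E d) x y : Fin (n + 1) → E d) :=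
      measurable_snoc.comp measurable_prodMk_left
    have hg : Measurable fun g => nrm ((perp x S).starProjection g) :=
      measurable_nrm.comp (by fun_prop)
    rw [uniformSphere_eq_map (perp_ne_bot x hS), Measure.map_map hsn hg]
    rfl
  simp only [h1]
  exact measurable_map_prodMk (gauss (E d)) hm

theorem orthoDensity_snoc {n : ℕ} (G : SimpleGraph (Fin (n + 1))) (x : Fin n → E d) (y : E d) :
    orthoDensity d G (Fin.snoc (α := fun _ => E d) x y) =
      orthoDensity d (G.comap Fin.castSucc) x *
        sDensity d x {i | G.Adj i.castSucc (Fin.last n)} := by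
  have hx : (fun i : Fin n => (Fin.snoc (α := fun _ => E d) x y : Fin (n + 1) → E d) i.castSucc) =
      x := by
    ext i; simp
  rw [orthoDensity, Fin.prod_univ_castSucc, orthoDensity]
  congr 1
  · refine Finset.prod_congr rfl fun v _ => ?_
    have : {u | u < v.castSucc ∧ G.Adj u v.castSucc} =
        Fin.castSucc '' {u | u < v ∧ (G.comap Fin.castSucc).Adj u v} := by
      ext u
      induction u using Fin.lastCases with
      | last =>
        refine iff_of_false (fun h => absurd h.1 (not_lt.2 (Fin.le_last _))) ?_
        rintro ⟨i, -, hi⟩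
        exact Fin.castSucc_ne_last i hi
      | cast u => simp
    rw [this, sDensity_image _ (Fin.castSucc_injective n), hx]
  · have : {u | u < Fin.last n ∧ G.Adj u (Fin.last n)} =
        Fin.castSucc '' {i | G.Adj i.castSucc (Fin.last n)} := by
      ext u
      induction u using Fin.lastCases with
      | last => simp
      | cast u => simp [Fin.castSucc_lt_last]
    rw [this, sDensity_image _ (Fin.castSucc_injective n), hx]

variable {V : Type*} [Fintype V] [DecidableEq V]

omit [Fintype V] in
theorem extend_snoc {n : ℕ} {p : Fin (n + 1) → V} (hp : Function.Injective p) (x : Fin n → E d)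
    (y : E d) (x₀ : V → E d) :
    Function.extend p (Fin.snoc (α := fun _ => E d) x y : Fin (n + 1) → E d) x₀ =
      Function.update (Function.extend (fun i => p (Fin.castSucc i)) x x₀) (p (Fin.last n)) y := by
  have hp' : Function.Injective fun i : Fin n => p i.castSucc :=
    hp.comp (Fin.castSucc_injective n)
  ext1 v
  by_cases hv : ∃ i, p i = v
  · obtain ⟨i, rfl⟩ := hv
    rw [hp.extend_apply]
    induction i using Fin.lastCases with
    | last => simp
    | cast i =>
      rw [Function.update_of_ne (hp.ne (Fin.castSucc_lt_last i).ne), Fin.snoc_castSucc]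
      exact (hp'.extend_apply x x₀ i).symm
  · rw [Function.extend_apply' _ _ _ hv, Function.update_of_ne (fun h => hv ⟨_, h.symm⟩),
      Function.extend_apply' _ _ _ (fun ⟨i, hi⟩ => hv ⟨_, hi⟩)]

omit [Fintype V] in
theorem measurable_extend {n : ℕ} {p : Fin n → V} (hp : Function.Injective p) (x₀ : V → E d) :
    Measurable fun x : Fin n → E d => Function.extend p x x₀ := by
  refine measurable_pi_iff.2 fun v => ?_
  by_cases hv : ∃ i, p i = v
  · obtain ⟨i, rfl⟩ := hv
    simpa [hp.extend_apply] using measurable_pi_apply i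
  · simp only [Function.extend_apply' _ _ _ hv]
    exact measurable_const

/-- The integral with respect to the measure of sequentially chosen ortho-homomorphisms is an
iterated integral. -/
theorem lintegral_orthoMeasure {H : SimpleGraph V} (hH : DSparse d H) (hd : 1 ≤ d)
    (x₀ : V → E d) {n : ℕ} {p : Fin n → V} (hp : Function.Injective p)
    {F : (V → E d) → ℝ≥0∞} (hF : Measurable F) :
    ∫⁻ x, F (Function.extend p x x₀) ∂orthoMeasure d (H.comap p) =
      addNodes d H (List.ofFn p).reverse F x₀ := by
  -- Integrating out the last node changes the integrand, hence the generalization. The point `x₀`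
  -- only fills the coordinates outside the range of `p`.
  induction n generalizing F with
  | zero =>
    have : Function.extend p Fin.elim0 x₀ = x₀ := by
      ext1 v
      exact Function.extend_apply' _ _ _ (fun ⟨i, _⟩ => i.elim0)
    have hm : Measurable fun x => F (Function.extend p x x₀) :=
      hF.comp (measurable_extend hp x₀)
    rw [orthoMeasure, lintegral_withDensity_eq_lintegral_mul _ (measurable_orthoDensity _) hm,
      seqMeasure, lintegral_dirac' _ ((measurable_orthoDensity _).mul hm)]
    simp [orthoDensity, addNodes, this]
  | succ n ih =>
    set p' : Fin n → V := fun i => p i.castSucc with hp'def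
    have hp' : Function.Injective p' := hp.comp (Fin.castSucc_injective n)
    set A : Set (Fin n) := {i | (H.comap p).Adj i.castSucc (Fin.last n)} with hA
    have hlist : (List.ofFn p).reverse = p (Fin.last n) :: (List.ofFn p').reverse := by
      rw [List.ofFn_succ', List.concat_eq_append, List.reverse_append]
      rfl
    have hnbr : nbr H (p (Fin.last n)) {u | u ∈ (List.ofFn p').reverse} = p' '' A := by
      ext u
      simp only [nbr, List.mem_reverse, List.mem_ofFn, Set.mem_ofPred_eq, Set.mem_image, hA,
        SimpleGraph.comap_adj]
      constructor
      · rintro ⟨⟨i, rfl⟩, h⟩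
        exact ⟨i, h, rfl⟩
      · rintro ⟨i, h, rfl⟩
        exact ⟨⟨i, rfl⟩, h⟩
    have hAd : A.ncard < d := by
      have := ncard_nbr_lt hH hd (p (Fin.last n)) {u | u ∈ (List.ofFn p').reverse}
      rwa [hnbr, Set.ncard_image_of_injective _ hp'] at this
    have hTm := measurable_addNode (ncard_nbr_lt hH hd (p (Fin.last n))
      {u | u ∈ (List.ofFn p').reverse}) hF
    have hcomap : (H.comap p).comap Fin.castSucc = H.comap p' := rfl
    rw [hlist, addNodes, ← ih hp' hTm]
    have hm : Measurable fun x => F (Function.extend p x x₀) :=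
      hF.comp (measurable_extend hp x₀)
    have hm' : Measurable fun x => addNode d H (p (Fin.last n))
        {u | u ∈ (List.ofFn p').reverse} F (Function.extend p' x x₀) :=
      hTm.comp (measurable_extend hp' x₀)
    have hprod : Measurable fun x => orthoDensity d (H.comap p) x * F (Function.extend p x x₀) :=
      (measurable_orthoDensity _).mul hm
    rw [orthoMeasure, orthoMeasure,
      lintegral_withDensity_eq_lintegral_mul _ (measurable_orthoDensity _) hm,
      lintegral_withDensity_eq_lintegral_mul _ (measurable_orthoDensity _) hm',
      seqMeasure, hcomap]
    change ∫⁻ x, orthoDensity d (H.comap p) x * F (Function.extend p x x₀) ∂_ =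
      ∫⁻ x, orthoDensity d (H.comap p') x * addNode d H (p (Fin.last n))
        {u | u ∈ (List.ofFn p').reverse} F (Function.extend p' x x₀) ∂_
    rw [Measure.lintegral_bind (measurable_seqKernel hAd).aemeasurable hprod.aemeasurable]
    refine lintegral_congr fun x => ?_
    have hsn : Measurable fun y => (Fin.snoc (α := fun _ => E d) x y : Fin (n + 1) → E d) :=
      measurable_snoc.comp measurable_prodMk_left
    have hext : (fun i => Function.extend p' x x₀ (p' i)) = x :=
      funext fun i => hp'.extend_apply x x₀ i
    rw [lintegral_map hprod hsn]
    simp only [orthoDensity_snoc, extend_snoc hp]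
    have hup : Measurable fun y => F (Function.update
        (Function.extend (fun i => p (Fin.castSucc i)) x x₀) (p (Fin.last n)) y) :=
      hF.comp (measurable_update _)
    rw [lintegral_const_mul _ hup, addNode, hnbr,
      sDensity_image _ hp', perp_image, hext, hcomap, mul_assoc]

end Bridge

end OrthoGraph

end

/-! ### The ortho-homomorphism number of a bipartite graph as one integral. -/

open MeasureTheory Filter Topology
open scoped ENNReal

noncomputable section

namespace OrthoGraph

theorem uniformSphere_top_prob {d : ℕ} (hd : 1 ≤ d) :
    IsProbabilityMeasure (uniformSphere (⊤ : Submodule ℝ (E d))) := by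
  refine isProbabilityMeasure_uniformSphere fun h => ?_
  have := congrArg (fun L : Submodule ℝ (E d) => Module.finrank ℝ L) h
  simp at this
  omega

theorem sDensity_empty {ι : Type*} [Fintype ι] {d : ℕ} (x : ι → E d) :
    sDensity d x ∅ = 1 := by
  have h := sphereArea_pos (d - 1)
  simp [sDensity, genDet_empty, h.ne']

variable {V : Type*} [Fintype V] [DecidableEq V] {d : ℕ} {H : SimpleGraph V}

/-- In an independent set no node has an earlier neighbor: each density is 1, each sphere is the
whole unit sphere, and the images are independent. -/
theorem addNodes_eq_lmarginal (hd : 1 ≤ d) {l : List V} (hl : l.Nodup)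
    (hind : ∀ u ∈ l, ∀ v ∈ l, ¬ H.Adj u v) {F : (V → E d) → ℝ≥0∞} (hF : Measurable F) :
    addNodes d H l F = lmarginal (fun _ => uniformSphere (⊤ : Submodule ℝ (E d))) l.toFinset F := by
  have := uniformSphere_top_prob hd
  induction l generalizing F with
  | nil => simp [addNodes]
  | cons v l ih =>
    have hn : nbr H v {u | u ∈ l} = ∅ := by
      ext u
      simp only [nbr, Set.mem_ofPred_eq, Set.mem_empty_iff_false, iff_false, not_and]
      exact fun hu => hind u (List.mem_cons_of_mem _ hu) v List.mem_cons_self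
    have hT : addNode d H v {u | u ∈ l} F =
        fun x => ∫⁻ y, F (Function.update x v y) ∂uniformSphere (⊤ : Submodule ℝ (E d)) := by
      ext x
      have hp : perp x ∅ = ⊤ := by
        rw [perp, Set.image_empty, Submodule.span_empty, Submodule.bot_orthogonal_eq_top]
      rw [addNode, hn, sDensity_empty, one_mul, hp]
    have hTm : Measurable (addNode d H v {u | u ∈ l} F) :=
      measurable_addNode (by rw [hn, Set.ncard_empty]; omega) hF
    rw [addNodes, ih (List.nodup_cons.1 hl).2 (fun u hu w hw => hind u (List.mem_cons_of_mem _ hu)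
      w (List.mem_cons_of_mem _ hw)) hTm, hT, List.toFinset_cons,
      lmarginal_insert' _ hF (by simpa using (List.nodup_cons.1 hl).1)]

/-- The nodes of `l` come after all their neighbors and the integrand ignores their images. Each
integrates to its density, which depends only on images of nodes outside `W`. -/
theorem addNodes_append_right (hH : DSparse d H) (hd : 1 ≤ d) {W : Set V}
    (hW : ∀ u ∈ W, ∀ v ∈ W, ¬ H.Adj u v) {l lU : List V} (hl : l.Nodup) (hlW : ∀ v ∈ l, v ∈ W)
    (hlU : ∀ v, v ∈ lU ↔ v ∉ W) {F : (V → E d) → ℝ≥0∞}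
    (hF' : ∀ x, ∀ v ∈ l, ∀ y, F (Function.update x v y) = F x) :
    addNodes d H (l ++ lU) F =
      addNodes d H lU fun x => (∏ w ∈ l.toFinset, sDensity d x {u | H.Adj u w}) * F x := by
  induction l generalizing F with
  | nil => simp
  | cons v l ih =>
    have hv : v ∈ W := hlW v List.mem_cons_self
    have hn : nbr H v {u | u ∈ l ++ lU} = {u | H.Adj u v} := by
      ext u
      simp only [nbr, Set.mem_ofPred_eq, List.mem_append, and_iff_right_iff_imp]
      exact fun h => Or.inr ((hlU u).2 fun hu => hW u hu v hv h)
    have hT : addNode d H v {u | u ∈ l ++ lU} F =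
        fun x => sDensity d x {u | H.Adj u v} * F x := by
      ext x
      have hlt := ncard_nbr_lt hH hd v {u | u ∈ l ++ lU}
      rw [hn] at hlt
      have := isProbabilityMeasure_uniformSphere (perp_ne_bot x hlt)
      rw [addNode, hn]
      simp [hF' x v List.mem_cons_self]
    rw [List.cons_append, addNodes, hT, ih (List.nodup_cons.1 hl).2
      (fun u hu => hlW u (List.mem_cons_of_mem _ hu))]
    · congr 1
      ext x
      rw [List.toFinset_cons, Finset.prod_insert (by simpa using (List.nodup_cons.1 hl).1)]
      ring
    · intro x w hw y
      rw [hF' x w (List.mem_cons_of_mem _ hw), sDensity_congr]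
      intro i hi
      refine Function.update_of_ne ?_ _ _
      rintro rfl
      exact hW i (hlW _ (List.mem_cons_of_mem _ hw)) v hv hi

/-- Order independence allows the class `W` to be processed last. The other class then carries the
product measure, and `W` contributes the densities. -/
theorem orthoNumber_bipartite (hH : DSparse d H) (hd : 1 ≤ d) {W : Finset V}
    (hW : ∀ u ∈ W, ∀ v ∈ W, ¬ H.Adj u v) (hU : ∀ u ∉ W, ∀ v ∉ W, ¬ H.Adj u v)
    {n : ℕ} (p : Fin n ≃ V) :
    orthoNumber d H p = ∫⁻ x : V → E d, ∏ w ∈ W, sDensity d x {u | H.Adj u w}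
      ∂Measure.pi fun _ => uniformSphere (⊤ : Submodule ℝ (E d)) := by
  have := uniformSphere_top_prob hd
  set lU := (Wᶜ).toList with hlU
  have hmeas : Measurable fun x : V → E d => ∏ w ∈ W, sDensity d x {u | H.Adj u w} :=
    Finset.measurable_fun_prod _ fun v _ => measurable_sDensity _
  have hperm : List.Perm (List.ofFn p).reverse (W.toList ++ lU) := by
    rw [List.perm_ext_iff_of_nodup]
    · intro v
      simp [hlU, List.mem_ofFn, p.surjective v, em]
    · exact List.nodup_reverse.2 (List.nodup_ofFn.2 p.injective)
    · refine List.Nodup.append (Finset.nodup_toList _) (Finset.nodup_toList _) ?_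
      intro v h1 h2
      simp [hlU] at h1 h2
      exact h2 h1
  have h1 := lintegral_orthoMeasure hH hd 0 p.injective (F := fun _ => 1) measurable_const
  rw [lintegral_const, one_mul, addNodes_perm hH hd
    (List.nodup_reverse.2 (List.nodup_ofFn.2 p.injective)) hperm measurable_const,
    addNodes_append_right hH hd (W := W) (by simpa using hW) (Finset.nodup_toList _)
    (by simp) (by simp [hlU]) (by simp)] at h1
  rw [orthoNumber, h1, addNodes_eq_lmarginal hd (Finset.nodup_toList _) (by simpa [hlU] using hU)
    (by simpa using hmeas)]
  simp only [Finset.toList_toFinset, mul_one]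
  -- The integrand does not depend on the coordinates in `W`, so integrating over these as well,
  -- against probability measures, changes nothing.
  rw [lintegral_eq_lmarginal_univ 0, ← Finset.union_compl W, Finset.union_comm,
    lmarginal_union _ _ hmeas disjoint_compl_left]
  congr 1
  ext x
  rw [lmarginal]
  have : ∀ y : (W → E d), ∏ w ∈ W, sDensity d (Function.updateFinset x W y) {u | H.Adj u w} =
      ∏ w ∈ W, sDensity d x {u | H.Adj u w} := fun y => by
    refine Finset.prod_congr rfl fun w hw => sDensity_congr fun i hi => ?_
    have : i ∉ W := fun h => hW i h w hw hi
    simp [Function.updateFinset, this]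
  simp [this]

end OrthoGraph

end

open MeasureTheory Filter Topology
open scoped ENNReal

noncomputable section

namespace OrthoGraph

open scoped RealInnerProductSpace

/-! ### Volumes of slabs and integrals over balls. -/

section Slab

variable {F : Type*} [NormedAddCommGroup F] [InnerProductSpace ℝ F] [MeasurableSpace F]
  [BorelSpace F] [FiniteDimensional ℝ F] {κ : Type*} [Fintype κ] [DecidableEq κ]

/-- The volume of the parallelepiped dual to a basis. -/
theorem volume_slab (hκ : Module.finrank ℝ F = Fintype.card κ) {v : κ → F}
    (hv : (Matrix.gram ℝ v).det ≠ 0) (r : ℝ) :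
    volume {z : F | ∀ i, |⟪v i, z⟫| < r} =
      ENNReal.ofReal (2 * r) ^ Fintype.card κ / ENNReal.ofReal (√(Matrix.gram ℝ v).det) := by
  have e : Fin (Module.finrank ℝ F) ≃ κ := Fintype.equivOfCardEq (by simpa using hκ)
  let b : OrthonormalBasis κ ℝ F := (stdOrthonormalBasis ℝ F).reindex e
  -- The rows of `M` are the coordinates of the `v i` in an orthonormal basis. The Gram matrix is `M
  -- * Mᵀ`, and the set is the preimage of a cube under `M`.
  let M : Matrix κ κ ℝ := Matrix.of fun i j => ⟪v i, b j⟫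
  have hM : Matrix.gram ℝ v = M * M.transpose := by
    ext i j
    rw [Matrix.gram_apply, Matrix.mul_apply, ← b.sum_inner_mul_inner]
    exact Finset.sum_congr rfl fun k _ => by
      simp [M, real_inner_comm]
  have hdet : (Matrix.gram ℝ v).det = M.det ^ 2 := by
    rw [hM, Matrix.det_mul, Matrix.det_transpose, sq]
  have hM0 : M.det ≠ 0 := fun h => hv (by rw [hdet, h]; simp)
  have hmp : MeasurePreserving (fun z : F => WithLp.ofLp (b.repr z)) volume volume :=
    (PiLp.volume_preserving_ofLp κ).comp b.measurePreserving_repr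
  have hset : {z : F | ∀ i, |⟪v i, z⟫| < r} = (fun z : F => WithLp.ofLp (b.repr z)) ⁻¹'
      (Matrix.toLin' M ⁻¹' Set.univ.pi fun _ => Set.Ioo (-r) r) := by
    ext z
    simp only [Set.mem_ofPred_eq, Set.mem_preimage, Set.mem_univ_pi, Set.mem_Ioo, abs_lt]
    refine forall_congr' fun i => ?_
    have : Matrix.toLin' M (WithLp.ofLp (b.repr z)) i = ⟪v i, z⟫ := by
      rw [Matrix.toLin'_apply, Matrix.mulVec, dotProduct, ← b.sum_inner_mul_inner]
      exact Finset.sum_congr rfl fun k _ => by simp [M, b.repr_apply_apply]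
    rw [this]
  have hbox : MeasurableSet (Set.univ.pi fun _ : κ => Set.Ioo (-r) r) :=
    MeasurableSet.univ_pi fun _ => measurableSet_Ioo
  have hlin : Measurable (Matrix.toLin' M) := (LinearMap.continuous_of_finiteDimensional _).measurable
  rw [hset, hmp.measure_preimage (hlin hbox).nullMeasurableSet,
    ← Measure.map_apply hlin hbox, Real.map_matrix_volume_pi_eq_smul_volume_pi hM0,
    Measure.smul_apply, volume_pi_pi, hdet, Real.sqrt_sq_eq_abs, smul_eq_mul, abs_inv,
    ENNReal.ofReal_inv_of_pos (abs_pos.2 hM0), mul_comm, div_eq_mul_inv]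
  congr 1
  simp [Real.volume_Ioo, two_mul]

theorem lintegral_smul_variable {ε : ℝ} (hε : 0 < ε) {f : F → ℝ≥0∞} (hf : Measurable f) :
    ∫⁻ z : F, f z = ENNReal.ofReal ε ^ Module.finrank ℝ F * ∫⁻ z : F, f (ε • z) := by
  have h := Measure.map_addHaar_smul (volume : Measure F) hε.ne'
  have hpow : 0 < ε ^ Module.finrank ℝ F := pow_pos hε _
  rw [← lintegral_map hf (measurable_const_smul ε), h, lintegral_smul_measure, smul_eq_mul,
    ← mul_assoc, abs_inv, abs_of_pos hpow, ← ENNReal.ofReal_pow hε.le,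
    ← ENNReal.ofReal_mul hpow.le, mul_inv_cancel₀ hpow.ne', ENNReal.ofReal_one, one_mul]

/-- The integral `∫_0^1 r ^ (k - 1) dr`. -/
def radial (k : ℕ) : ℝ≥0∞ :=
  ∫⁻ r in Set.Ioi (0 : ℝ), ENNReal.ofReal (r ^ (k - 1)) * (Set.Iio (1 : ℝ)).indicator 1 r

theorem radial_le_one (k : ℕ) : radial k ≤ 1 := by
  calc radial k ≤ ∫⁻ r : ℝ, (Set.Ioo (0 : ℝ) 1).indicator 1 r := by
        rw [radial, ← lintegral_indicator measurableSet_Ioi]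
        refine lintegral_mono fun r => ?_
        by_cases h0 : r ∈ Set.Ioi (0 : ℝ)
        · by_cases h1 : r ∈ Set.Iio (1 : ℝ)
          · have : r ∈ Set.Ioo (0 : ℝ) 1 := ⟨h0, h1⟩
            simp only [Set.indicator_of_mem, h0, h1, this, Pi.one_apply, mul_one]
            exact ENNReal.ofReal_le_one.2 (pow_le_one₀ (le_of_lt h0) (le_of_lt h1))
          · have h2 : (Set.Iio (1 : ℝ)).indicator (1 : ℝ → ℝ≥0∞) r = 0 :=
              Set.indicator_of_notMem h1 _
            rw [Set.indicator_of_mem h0, h2, mul_zero]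
            exact zero_le
        · simp [h0]
    _ = 1 := by
        rw [lintegral_indicator_one measurableSet_Ioo]
        simp

theorem lintegral_ball_nrm_mul [Nontrivial F] {f : F → ℝ≥0∞} (hf : Measurable f) :
    ∫⁻ x in Metric.ball (0 : F) 1, f (nrm x) =
      (∫⁻ y, f y ∂((volume : Measure F).toSphere.map Subtype.val)) *
        radial (Module.finrank ℝ F) := by
  rw [radial, ← lintegral_polar hf (measurable_one.indicator measurableSet_Iio),
    ← lintegral_indicator Metric.isOpen_ball.measurableSet]
  refine lintegral_congr fun x => ?_
  by_cases h : ‖x‖ < 1 <;> simp [h, Set.indicator]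

theorem volume_ball_eq [Nontrivial F] : volume (Metric.ball (0 : F) 1) =
    ENNReal.ofReal (sphereArea (Module.finrank ℝ F - 1)) * radial (Module.finrank ℝ F) := by
  have h := lintegral_ball_nrm_mul (F := F) (f := fun _ => 1) measurable_const
  rwa [lintegral_one, lintegral_one, Measure.restrict_apply_univ,
    Measure.map_apply measurable_subtype_coe MeasurableSet.univ, Set.preimage_univ,
    toSphere_univ] at h

theorem lintegral_ball_norm_pow [Nontrivial F] (n : ℕ) :
    ∫⁻ x in Metric.ball (0 : F) 1, ENNReal.ofReal ‖x‖ ^ n =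
      ENNReal.ofReal (sphereArea (Module.finrank ℝ F - 1)) * radial (Module.finrank ℝ F + n) := by
  have hk : 0 < Module.finrank ℝ F := Module.finrank_pos
  have h := lintegral_polar (F := F) (f := fun _ => 1) measurable_const
    (ρ := fun r => ENNReal.ofReal r ^ n * (Set.Iio (1 : ℝ)).indicator 1 r)
    ((by fun_prop : Measurable fun r : ℝ => ENNReal.ofReal r ^ n).mul
      (measurable_one.indicator measurableSet_Iio))
  rw [lintegral_one, Measure.map_apply measurable_subtype_coe MeasurableSet.univ,
    Set.preimage_univ, toSphere_univ] at h
  have h2 : radial (Module.finrank ℝ F + n) = ∫⁻ r in Set.Ioi (0 : ℝ),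
      ENNReal.ofReal (r ^ (Module.finrank ℝ F - 1)) *
        (ENNReal.ofReal r ^ n * (Set.Iio (1 : ℝ)).indicator 1 r) := by
    refine setLIntegral_congr_fun measurableSet_Ioi fun r (hr : 0 < r) => ?_
    rw [← mul_assoc, ← ENNReal.ofReal_pow hr.le, ← ENNReal.ofReal_mul (by positivity), ← pow_add]
    congr 4
    omega
  rw [h2, ← h, ← lintegral_indicator Metric.isOpen_ball.measurableSet]
  refine lintegral_congr fun x => ?_
  by_cases h : ‖x‖ < 1 <;> simp [h, Set.indicator]

end Slab

/-- A uniform point of the ball has a uniform direction. This connects the sphere with Lebesgue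
measure, both for cap measures and for lattice points in the ball. -/
theorem lintegral_ball_nrm {d : ℕ} (hd : 1 ≤ d) {f : E d → ℝ≥0∞} (hf : Measurable f) :
    ∫⁻ x in Metric.ball (0 : E d) 1, f (nrm x) =
      volume (Metric.ball (0 : E d) 1) * ∫⁻ y, f y ∂uniformSphere (⊤ : Submodule ℝ (E d)) := by
  have : Nontrivial (E d) := by
    have : Nonempty (Fin d) := ⟨⟨0, hd⟩⟩
    infer_instance
  have hk := lintegral_rpow_gaussWeight (d - 1)
  have htop : (⊤ : Submodule ℝ (E d)) ≠ ⊥ := top_ne_bot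
  have h1 := lintegral_polar (F := E d) hf measurable_gaussWeight
  have h2 : ∫⁻ y, f y ∂uniformSphere (⊤ : Submodule ℝ (E d)) =
      ∫⁻ x : E d, f (nrm x) * gaussWeight ‖x‖ := by
    rw [lintegral_uniformSphere htop hf, lintegral_gauss
      (f := fun x => f (nrm ((⊤ : Submodule ℝ (E d)).starProjection x)))
      (hf.comp (measurable_nrm.comp (by fun_prop)))]
    simp [mul_comm, Submodule.starProjection_top]
  rw [lintegral_ball_nrm_mul hf, h2, h1, volume_ball_eq]
  simp only [finrank_euclideanSpace, Fintype.card_fin]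
  set I := ∫⁻ r in Set.Ioi (0 : ℝ), ENNReal.ofReal (r ^ (d - 1)) * gaussWeight r
  calc _ = (∫⁻ y, f y ∂((volume : Measure (E d)).toSphere.map Subtype.val)) * radial d *
      (ENNReal.ofReal (sphereArea (d - 1)) * I) := by rw [hk, mul_one]
    _ = _ := by ring

end OrthoGraph

end

/-! ### Asymptotics of the measure of nearly orthogonal unit vectors. -/

open MeasureTheory Filter Topology
open scoped ENNReal

noncomputable section

namespace OrthoGraph

open scoped RealInnerProductSpace

variable {ι : Type*} [Fintype ι] {d : ℕ}

/-- The measure of the unit vectors that are `ε`-nearly orthogonal to the vectors `x i`, `i ∈ S`. -/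
def cap (x : ι → E d) (S : Set ι) (ε : ℝ) : ℝ≥0∞ :=
  uniformSphere (⊤ : Submodule ℝ (E d)) {y | ∀ i ∈ S, |⟪x i, y⟫| < ε}

/-- The limit of the normalized measure of nearly orthogonal unit vectors. -/
def capDensity (d : ℕ) (x : ι → E d) (S : Set ι) : ℝ≥0∞ :=
  ENNReal.ofReal (sphereArea (d - S.ncard - 1)) / ENNReal.ofReal (sphereArea (d - 1)) /
    ENNReal.ofReal (genDet x S)

theorem measurableSet_cap (x : ι → E d) (S : Set ι) (ε : ℝ) :
    MeasurableSet {y | ∀ i ∈ S, |⟪x i, y⟫| < ε} := by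
  have : {y | ∀ i ∈ S, |⟪x i, y⟫| < ε} = ⋂ i ∈ S, {y | |⟪x i, y⟫| < ε} := by
    ext; simp
  rw [this]
  exact MeasurableSet.biInter S.to_countable fun i _ =>
    measurableSet_lt (by fun_prop) measurable_const

theorem volume_ball_mul_cap (hd : 1 ≤ d) (x : ι → E d) (S : Set ι) (ε : ℝ) :
    volume (Metric.ball (0 : E d) 1) * cap x S ε =
      volume {h : E d | ‖h‖ < 1 ∧ ∀ i ∈ S, |⟪x i, nrm h⟫| < ε} := by
  have hm := measurableSet_cap x S ε
  have h := lintegral_ball_nrm hd (f := {y | ∀ i ∈ S, |⟪x i, y⟫| < ε}.indicator 1)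
    (measurable_one.indicator hm)
  rw [lintegral_indicator_one hm] at h
  rw [cap, ← h, ← lintegral_indicator Metric.isOpen_ball.measurableSet]
  have hm' : MeasurableSet {h : E d | ‖h‖ < 1 ∧ ∀ i ∈ S, |⟪x i, nrm h⟫| < ε} :=
    (measurableSet_lt measurable_norm measurable_const).inter (measurable_nrm hm)
  rw [← lintegral_indicator_one hm']
  refine lintegral_congr fun y => ?_
  simp only [Set.indicator, mem_ball_zero_iff, Set.mem_ofPred_eq, Pi.one_apply]
  split_ifs <;> tauto

section Decomposition

variable (x : ι → E d) (S : Set ι)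

/-- The region in `L × Lᗮ`, where `L` is spanned by the `x i`, obtained from the nearly orthogonal
vectors in the unit ball by scaling the `L` component. -/
def capRegion (ε : ℝ) : Set (Submodule.span ℝ (x '' S) × perp x S) :=
  {p | ε ^ 2 * ‖p.1‖ ^ 2 + ‖p.2‖ ^ 2 < 1 ∧
    ∀ i ∈ S, ⟪x i, (p.1 : E d)⟫ ^ 2 < ε ^ 2 * ‖p.1‖ ^ 2 + ‖p.2‖ ^ 2}

theorem measurableSet_capRegion (ε : ℝ) : MeasurableSet (capRegion x S ε) := by
  have : capRegion x S ε = {p | ε ^ 2 * ‖p.1‖ ^ 2 + ‖p.2‖ ^ 2 < 1} ∩ ⋂ i ∈ S,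
      {p | ⟪x i, (p.1 : E d)⟫ ^ 2 < ε ^ 2 * ‖p.1‖ ^ 2 + ‖p.2‖ ^ 2} := by
    ext; simp [capRegion]
  rw [this]
  exact (measurableSet_lt (by fun_prop) measurable_const).inter
    (MeasurableSet.biInter S.to_countable fun i _ => measurableSet_lt (by fun_prop) (by fun_prop))

/-- The product of the Lebesgue measures of a subspace and its orthogonal complement. -/
abbrev volProd : Measure (Submodule.span ℝ (x '' S) × perp x S) :=
  (@volume _ measureSpaceOfInnerProductSpace).prod (@volume _ measureSpaceOfInnerProductSpace)

/-- Split a vector along the span `L` of the `x i` and its complement. The constraints `|⟪x i, h⟫| <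
ε ‖h‖` involve the `L` component only through inner products of order `ε`; rescaling that component
by `ε` extracts the power of `ε` and leaves a region with a limit. -/
theorem volume_capSet (hd : 1 ≤ d) {ε : ℝ} (hε : 0 < ε) :
    volume {h : E d | ‖h‖ < 1 ∧ ∀ i ∈ S, |⟪x i, nrm h⟫| < ε} =
      ENNReal.ofReal ε ^ Module.finrank ℝ (Submodule.span ℝ (x '' S)) *
        volProd x S (capRegion x S ε) := by
  have : Nontrivial (E d) := by
    have : Nonempty (Fin d) := ⟨⟨0, hd⟩⟩
    infer_instance
  set L := Submodule.span ℝ (x '' S) with hL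
  let R : Set (L × Lᗮ) := {p | ‖p.1‖ ^ 2 + ‖p.2‖ ^ 2 < 1 ∧
    ∀ i ∈ S, ⟪x i, (p.1 : E d)⟫ ^ 2 < ε ^ 2 * (‖p.1‖ ^ 2 + ‖p.2‖ ^ 2)}
  have hR : MeasurableSet R := by
    have : R = {p | ‖p.1‖ ^ 2 + ‖p.2‖ ^ 2 < 1} ∩ ⋂ i ∈ S,
        {p | ⟪x i, (p.1 : E d)⟫ ^ 2 < ε ^ 2 * (‖p.1‖ ^ 2 + ‖p.2‖ ^ 2)} := by
      ext; simp [R]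
    rw [this]
    exact (measurableSet_lt (by fun_prop) measurable_const).inter
      (MeasurableSet.biInter S.to_countable fun i _ => measurableSet_lt (by fun_prop) (by fun_prop))
  have hmR : Measurable (R.indicator (1 : L × Lᗮ → ℝ≥0∞)) := measurable_one.indicator hR
  have hdec := lintegral_orthogonal_decomposition L hmR
  have hmp : Measurable fun h : E d => (L.orthogonalProjectionOnto h, Lᗮ.orthogonalProjectionOnto h) :=
    by fun_prop
  have h1 : volume {h : E d | ‖h‖ < 1 ∧ ∀ i ∈ S, |⟪x i, nrm h⟫| < ε} =
      ∫⁻ h : E d, R.indicator 1 (L.orthogonalProjectionOnto h, Lᗮ.orthogonalProjectionOnto h) := by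
    have h2 : ∫⁻ h : E d, R.indicator 1
        (L.orthogonalProjectionOnto h, Lᗮ.orthogonalProjectionOnto h) =
        volume ((fun h : E d => (L.orthogonalProjectionOnto h, Lᗮ.orthogonalProjectionOnto h)) ⁻¹'
          R) := by
      rw [← lintegral_indicator_one (hmp hR)]
      rfl
    rw [h2]
    refine measure_congr ?_
    have h0 : ∀ᵐ h : E d, h ≠ 0 := by
      rw [ae_iff]
      simp
    filter_upwards [h0] with h hh
    refine propext ?_
    change (‖h‖ < 1 ∧ ∀ i ∈ S, |⟪x i, nrm h⟫| < ε) ↔ _ ∈ R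
    have hn := Submodule.norm_sq_eq_add_norm_sq_projection h L
    have hpos : 0 < ‖h‖ := norm_pos_iff.2 hh
    have hin : ∀ i ∈ S, ⟪x i, (L.orthogonalProjectionOnto h : E d)⟫ = ⟪x i, h⟫ := fun i hi => by
      have hmem : x i ∈ L := Submodule.subset_span ⟨i, hi, rfl⟩
      have := L.starProjection_inner_eq_zero h (x i) hmem
      rw [inner_sub_left, sub_eq_zero, real_inner_comm, real_inner_comm (x i)] at this
      exact this.symm
    simp only [R, Set.mem_ofPred_eq]
    rw [← hn]
    refine and_congr (by rw [sq_lt_one_iff₀ (norm_nonneg _)]) (forall₂_congr fun i hi => ?_)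
    rw [hin i hi, nrm, inner_smul_right, abs_mul, abs_inv, abs_norm, inv_mul_lt_iff₀ hpos,
      ← mul_pow, ← sq_abs, sq_lt_sq₀ (abs_nonneg _) (by positivity), mul_comm]
  rw [h1, hdec]
  have hmeas : Measurable fun z : L => ∫⁻ w : Lᗮ, R.indicator 1 (z, w)
      ∂(@volume _ measureSpaceOfInnerProductSpace) := hmR.lintegral_prod_right'
  rw [lintegral_smul_variable hε hmeas, volProd, ← lintegral_indicator_one
    (measurableSet_capRegion x S ε), lintegral_prod _
    (measurable_one.indicator (measurableSet_capRegion x S ε)).aemeasurable]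
  congr 1
  refine lintegral_congr fun z => lintegral_congr fun w => ?_
  have : ((ε • z, w) ∈ R) ↔ (z, w) ∈ capRegion x S ε := by
    simp only [R, capRegion, Set.mem_ofPred_eq, norm_smul, Real.norm_eq_abs, abs_of_pos hε,
      mul_pow, Submodule.coe_smul, inner_smul_right]
    refine and_congr Iff.rfl (forall₂_congr fun i hi => ?_)
    exact mul_lt_mul_iff_of_pos_left (by positivity)
  by_cases h : (z, w) ∈ capRegion x S ε
  · rw [Set.indicator_of_mem h, Set.indicator_of_mem (this.2 h)]; rfl
  · rw [Set.indicator_of_notMem h, Set.indicator_of_notMem (fun h' => h (this.1 h'))]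

theorem finrank_span_image (hx : genDet x S ≠ 0) :
    Module.finrank ℝ (Submodule.span ℝ (x '' S)) = S.ncard := by
  classical
  rw [Set.image_eq_range, finrank_span_eq_card ((genDet_ne_zero_iff x S).1 hx),
    ← Nat.card_eq_fintype_card, Nat.card_coe_set_eq]

theorem volume_span_slab (hx : genDet x S ≠ 0) (r : ℝ) :
    @volume (Submodule.span ℝ (x '' S)) measureSpaceOfInnerProductSpace
      {z | ∀ i ∈ S, |⟪x i, (z : E d)⟫| < r} =
      ENNReal.ofReal (2 * r) ^ S.ncard / ENNReal.ofReal (genDet x S) := by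
  classical
  let v : S → Submodule.span ℝ (x '' S) := fun i => ⟨x i, Submodule.subset_span ⟨i, i.2, rfl⟩⟩
  have hg : Matrix.gram ℝ v = Matrix.gram ℝ fun i : S => x i := by
    ext i j
    simp [Matrix.gram_apply, v]
  have hdet : genDet x S = √(Matrix.gram ℝ v).det := by
    rw [genDet, hg]
  have hcard : Fintype.card S = S.ncard := by
    rw [← Nat.card_eq_fintype_card, Nat.card_coe_set_eq]
  have h := volume_slab (v := v) (by rw [finrank_span_image x S hx, hcard]) (fun h0 => hx (by
    rw [hdet, h0, Real.sqrt_zero])) r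
  rw [← hdet, hcard] at h
  rw [← h]
  congr 1
  ext z
  simp [v]

theorem volProd_slab (hx : genDet x S ≠ 0) (hS : S.ncard < d) :
    (volProd x S) ({z : Submodule.span ℝ (x '' S) | ∀ i ∈ S, |⟪x i, (z : E d)⟫| < 1} ×ˢ
      Metric.ball 0 1) =
      2 ^ S.ncard / ENNReal.ofReal (genDet x S) *
        (ENNReal.ofReal (sphereArea (d - S.ncard - 1)) * radial (d - S.ncard)) := by
  have : Nontrivial (perp x S) := Submodule.nontrivial_iff_ne_bot.2 (perp_ne_bot x hS)
  rw [Measure.prod_prod, volume_span_slab x S hx, volume_ball_eq, finrank_perp hx]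
  simp

/-- Above `w` in the complement lies a slab of half-width `‖w‖`, of volume proportional to `‖w‖ ^
n`, where `n = S.ncard`. Integrating this over the ball of dimension `d - n` produces `radial d`,
which later cancels against the volume of the full ball. -/
theorem volProd_capRegion_zero (hx : genDet x S ≠ 0) (hS : S.ncard < d) :
    (volProd x S) (capRegion x S 0) =
      2 ^ S.ncard / ENNReal.ofReal (genDet x S) *
        (ENNReal.ofReal (sphereArea (d - S.ncard - 1)) * radial d) := by
  have : Nontrivial (perp x S) := Submodule.nontrivial_iff_ne_bot.2 (perp_ne_bot x hS)
  have h := lintegral_ball_norm_pow (F := perp x S) S.ncard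
  rw [finrank_perp hx, Nat.sub_add_cancel hS.le] at h
  rw [Measure.prod_apply_symm (measurableSet_capRegion x S 0), ← h,
    ← lintegral_indicator Metric.isOpen_ball.measurableSet, ← lintegral_const_mul]
  · refine lintegral_congr fun w => ?_
    by_cases hw : ‖w‖ < 1
    · have hset : (fun z => (z, w)) ⁻¹' capRegion x S 0 =
          {z : Submodule.span ℝ (x '' S) | ∀ i ∈ S, |⟪x i, (z : E d)⟫| < ‖w‖} := by
        ext z
        simp only [capRegion, Set.mem_preimage, Set.mem_ofPred_eq, ne_eq, OfNat.ofNat_ne_zero,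
          not_false_eq_true, zero_pow, zero_mul, zero_add, sq_lt_one_iff₀ (norm_nonneg _), hw,
          true_and]
        refine forall₂_congr fun i _ => ?_
        rw [sq_lt_sq, abs_norm]
      rw [hset, volume_span_slab x S hx, Set.indicator_of_mem (by simpa using hw),
        ENNReal.ofReal_mul (by norm_num), mul_pow]
      simp only [ENNReal.ofReal_ofNat, div_eq_mul_inv]
      ring
    · have hset : (fun z => (z, w)) ⁻¹' capRegion x S 0 = ∅ := by
        ext z
        simp only [capRegion, Set.mem_preimage, Set.mem_ofPred_eq, ne_eq, OfNat.ofNat_ne_zero,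
          not_false_eq_true, zero_pow, zero_mul, zero_add, sq_lt_one_iff₀ (norm_nonneg _), hw,
          false_and, Set.mem_empty_iff_false]
      rw [hset, measure_empty, Set.indicator_of_notMem (by simpa using hw), mul_zero]
  · exact Measurable.indicator (by fun_prop) Metric.isOpen_ball.measurableSet

-- One set for all `ε`, of finite volume for independent vectors: it gives both the convergence of
-- the volumes and a bound uniform in `ε`.
omit [Fintype ι] in
theorem capRegion_subset {ε : ℝ} : capRegion x S ε ⊆
    {z : Submodule.span ℝ (x '' S) | ∀ i ∈ S, |⟪x i, (z : E d)⟫| < 1} ×ˢ Metric.ball 0 1 := by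
  rintro ⟨z, w⟩ ⟨h1, h2⟩
  refine ⟨fun i hi => ?_, ?_⟩
  · exact (sq_lt_one_iff_abs_lt_one _).1 ((h2 i hi).trans h1)
  · rw [mem_ball_zero_iff, ← sq_lt_one_iff₀ (norm_nonneg _)]
    have : 0 ≤ ε ^ 2 * ‖z‖ ^ 2 := by positivity
    dsimp only at h1
    linarith

/-- For fixed first component each excluded equality puts the second one on a sphere, a null set.
Off these sets the strict inequalities at `ε = 0` are decided in the same way for small `ε`. -/
theorem ae_capRegion_boundary (hS : S.ncard < d) :
    ∀ᵐ p ∂volProd x S, ‖p.2‖ ^ 2 ≠ 1 ∧ ∀ i ∈ S, ⟪x i, (p.1 : E d)⟫ ^ 2 ≠ ‖p.2‖ ^ 2 := by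
  have : Nontrivial (perp x S) := Submodule.nontrivial_iff_ne_bot.2 (perp_ne_bot x hS)
  have hs : ∀ r : ℝ, ∀ᵐ w : perp x S ∂(@volume _ measureSpaceOfInnerProductSpace),
      r ^ 2 ≠ ‖w‖ ^ 2 := fun r => by
    have h0 := Measure.addHaar_sphere
      (@volume (perp x S) measureSpaceOfInnerProductSpace) (0 : perp x S) |r|
    rw [ae_iff]
    refine measure_mono_null (fun w hw => ?_) h0
    simp only [Set.mem_ofPred_eq, not_not] at hw
    rw [mem_sphere_zero_iff_norm, ← abs_norm, eq_comm]
    exact (sq_eq_sq_iff_abs_eq_abs _ _).1 hw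
  have key : ∀ f : Submodule.span ℝ (x '' S) → ℝ, Measurable f →
      ∀ᵐ p ∂volProd x S, f p.1 ^ 2 ≠ ‖p.2‖ ^ 2 := fun f hf => by
    refine (Measure.ae_prod_iff_ae_ae ?_).2 (Eventually.of_forall fun z => hs (f z))
    exact (measurableSet_eq_fun (by fun_prop) (by fun_prop)).compl
  filter_upwards [key (fun _ => 1) measurable_const, (ae_ball_iff S.to_countable).2
    fun i _ => key (fun z => ⟪x i, (z : E d)⟫) (by fun_prop)] with p h1 h2
  exact ⟨fun h => h1 (by rw [h, one_pow]), h2⟩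

theorem tendsto_volProd_capRegion (hx : genDet x S ≠ 0) (hS : S.ncard < d) :
    Tendsto (fun ε => volProd x S (capRegion x S ε)) (𝓝[>] 0)
      (𝓝 (volProd x S (capRegion x S 0))) := by
  have hfin : (volProd x S) ({z : Submodule.span ℝ (x '' S) | ∀ i ∈ S, |⟪x i, (z : E d)⟫| < 1} ×ˢ
      Metric.ball 0 1) ≠ ∞ := by
    rw [volProd_slab x S hx hS]
    have h2 := (radial_le_one (d - S.ncard)).trans_lt ENNReal.one_lt_top
    have h3 : ENNReal.ofReal (genDet x S) ≠ 0 := by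
      simpa using lt_of_le_of_ne (genDet_nonneg x S) (Ne.symm hx)
    exact ENNReal.mul_ne_top (ENNReal.div_ne_top (by simp) h3)
      (ENNReal.mul_ne_top ENNReal.ofReal_ne_top h2.ne)
  have hB : MeasurableSet ({z : Submodule.span ℝ (x '' S) | ∀ i ∈ S, |⟪x i, (z : E d)⟫| < 1} ×ˢ
      Metric.ball (0 : perp x S) 1) := by
    refine MeasurableSet.prod ?_ Metric.isOpen_ball.measurableSet
    exact measurable_subtype_coe (measurableSet_cap x S 1)
  refine tendsto_measure_of_ae_tendsto_indicator _ (measurableSet_capRegion x S 0)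
    (fun ε => measurableSet_capRegion x S ε) hB hfin
    (Eventually.of_forall fun ε => capRegion_subset x S) ?_
  filter_upwards [ae_capRegion_boundary x S hS] with p hp
  have ht : Tendsto (fun ε : ℝ => ε ^ 2 * ‖p.1‖ ^ 2 + ‖p.2‖ ^ 2) (𝓝[>] 0)
      (𝓝 (0 ^ 2 * ‖p.1‖ ^ 2 + ‖p.2‖ ^ 2)) := by
    refine Tendsto.mono_left (Continuous.tendsto ?_ 0) nhdsWithin_le_nhds
    fun_prop
  have h0 : (0 : ℝ) ^ 2 * ‖p.1‖ ^ 2 + ‖p.2‖ ^ 2 = ‖p.2‖ ^ 2 := by ring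
  rw [h0] at ht
  have e1 : ∀ᶠ ε in 𝓝[>] (0 : ℝ), (ε ^ 2 * ‖p.1‖ ^ 2 + ‖p.2‖ ^ 2 < 1 ↔ ‖p.2‖ ^ 2 < 1) := by
    rcases lt_or_gt_of_ne hp.1 with h | h
    · filter_upwards [ht.eventually_lt_const h] with ε hε
      exact iff_of_true hε h
    · filter_upwards [ht.eventually_const_lt h] with ε hε
      exact iff_of_false hε.not_gt h.not_gt
  have e2 : ∀ i : ι, ∀ᶠ ε in 𝓝[>] (0 : ℝ), i ∈ S → (⟪x i, (p.1 : E d)⟫ ^ 2 <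
      ε ^ 2 * ‖p.1‖ ^ 2 + ‖p.2‖ ^ 2 ↔ ⟪x i, (p.1 : E d)⟫ ^ 2 < ‖p.2‖ ^ 2) := fun i => by
    by_cases hi : i ∈ S
    · rcases lt_or_gt_of_ne (hp.2 i hi) with h | h
      · filter_upwards [ht.eventually_const_lt h] with ε hε _
        exact iff_of_true hε h
      · filter_upwards [ht.eventually_lt_const h] with ε hε _
        exact iff_of_false hε.not_gt h.not_gt
    · exact Eventually.of_forall fun _ h => absurd h hi
  filter_upwards [e1, eventually_all.2 e2] with ε h1 h2
  simp only [capRegion, Set.mem_ofPred_eq, h0]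
  exact and_congr h1 (forall₂_congr fun i hi => h2 i hi)

end Decomposition

theorem radial_ne_zero (hd : 1 ≤ d) : radial d ≠ 0 := by
  have : Nontrivial (E d) := by
    have : Nonempty (Fin d) := ⟨⟨0, hd⟩⟩
    infer_instance
  have h := volume_ball_eq (F := E d)
  intro h0
  rw [finrank_euclideanSpace_fin, h0, mul_zero] at h
  exact (Metric.measure_ball_pos volume (0 : E d) one_pos).ne' h

theorem cap_div_eq (hd : 1 ≤ d) {x : ι → E d} {S : Set ι} (hx : genDet x S ≠ 0) {ε : ℝ}
    (hε : 0 < ε) :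
    cap x S ε / ENNReal.ofReal (2 * ε) ^ S.ncard = volProd x S (capRegion x S ε) /
      (ENNReal.ofReal (sphereArea (d - 1)) * radial d * 2 ^ S.ncard) := by
  have : Nontrivial (E d) := by
    have : Nonempty (Fin d) := ⟨⟨0, hd⟩⟩
    infer_instance
  have hr0 := radial_ne_zero hd
  have hr1 := ((radial_le_one d).trans_lt ENNReal.one_lt_top).ne
  have h := volume_ball_mul_cap hd x S ε
  rw [volume_capSet x S hd hε, finrank_span_image x S hx, volume_ball_eq,
    finrank_euclideanSpace_fin] at h
  set a := ENNReal.ofReal (sphereArea (d - 1)) * radial d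
  have ha0 : a ≠ 0 := mul_ne_zero (by simpa using sphereArea_pos _) hr0
  have ha1 : a ≠ ∞ := ENNReal.mul_ne_top ENNReal.ofReal_ne_top hr1
  have hε0 : ENNReal.ofReal ε ^ S.ncard ≠ 0 := pow_ne_zero _ (by simpa using hε)
  have hε1 : ENNReal.ofReal ε ^ S.ncard ≠ ∞ := by simp
  have h20 : (2 : ℝ≥0∞) ^ S.ncard ≠ 0 := pow_ne_zero _ (by simp)
  have h21 : (2 : ℝ≥0∞) ^ S.ncard ≠ ∞ := by simp
  have h2 : cap x S ε = ENNReal.ofReal ε ^ S.ncard * volProd x S (capRegion x S ε) / a := by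
    rw [← h, mul_comm, ENNReal.mul_div_cancel_right ha0 ha1]
  rw [h2, ENNReal.ofReal_mul (by norm_num), ENNReal.ofReal_ofNat, mul_pow, div_eq_mul_inv,
    div_eq_mul_inv, div_eq_mul_inv, ENNReal.mul_inv (Or.inl h20) (Or.inl h21),
    ENNReal.mul_inv (Or.inl ha0) (Or.inl ha1)]
  calc _ = volProd x S (capRegion x S ε) * (a⁻¹ * (2 ^ S.ncard)⁻¹) *
      (ENNReal.ofReal ε ^ S.ncard * (ENNReal.ofReal ε ^ S.ncard)⁻¹) := by ring
    _ = _ := by rw [ENNReal.mul_inv_cancel hε0 hε1, mul_one]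

/-- Taken with `c = r = radial d` for the limit, and with `c = 1`, `r = radial d` for the upper
bound. -/
theorem slab_div_eq (x : ι → E d) (S : Set ι) (c r : ℝ≥0∞) :
    2 ^ S.ncard / ENNReal.ofReal (genDet x S) *
        (ENNReal.ofReal (sphereArea (d - S.ncard - 1)) * c) /
      (ENNReal.ofReal (sphereArea (d - 1)) * r * 2 ^ S.ncard) = c / r * capDensity d x S := by
  have h20 : (2 : ℝ≥0∞) ^ S.ncard ≠ 0 := pow_ne_zero _ (by simp)
  have h21 : (2 : ℝ≥0∞) ^ S.ncard ≠ ∞ := by simp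
  have ha0 : ENNReal.ofReal (sphereArea (d - 1)) ≠ 0 := by simpa using sphereArea_pos _
  simp only [div_eq_mul_inv, capDensity]
  rw [ENNReal.mul_inv (Or.inr h21) (Or.inr h20),
    ENNReal.mul_inv (Or.inl ha0) (Or.inl ENNReal.ofReal_ne_top)]
  calc _ = (2 ^ S.ncard * (2 ^ S.ncard)⁻¹) * (c * r⁻¹ * (ENNReal.ofReal
        (sphereArea (d - S.ncard - 1)) * (ENNReal.ofReal (sphereArea (d - 1)))⁻¹ *
        (ENNReal.ofReal (genDet x S))⁻¹)) := by ring
    _ = _ := by rw [ENNReal.mul_inv_cancel h20 h21, one_mul]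

theorem tendsto_cap {x : ι → E d} {S : Set ι} (hx : genDet x S ≠ 0) (hS : S.ncard < d) :
    Tendsto (fun ε => cap x S ε / ENNReal.ofReal (2 * ε) ^ S.ncard) (𝓝[>] 0)
      (𝓝 (capDensity d x S)) := by
  have hd : 1 ≤ d := by omega
  have hr0 := radial_ne_zero hd
  have hr1 := ((radial_le_one d).trans_lt ENNReal.one_lt_top).ne
  have h1 := slab_div_eq x S (radial d) (radial d)
  rw [ENNReal.div_self hr0 hr1, one_mul, ← volProd_capRegion_zero x S hx hS] at h1
  rw [← h1]
  refine Tendsto.congr' ?_ (ENNReal.Tendsto.div_const (tendsto_volProd_capRegion x S hx hS)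
    (Or.inr ?_))
  · filter_upwards [self_mem_nhdsWithin] with ε hε
    exact (cap_div_eq hd hx hε).symm
  · exact mul_ne_zero (mul_ne_zero (by simpa using sphereArea_pos _) hr0)
      (pow_ne_zero _ (by simp))

/-- The bound is a constant multiple of the limit itself, so the dominating function is integrable
as soon as the limit is. -/
theorem cap_div_le {x : ι → E d} {S : Set ι} (hx : genDet x S ≠ 0) (hS : S.ncard < d) {ε : ℝ}
    (hε : 0 < ε) :
    cap x S ε / ENNReal.ofReal (2 * ε) ^ S.ncard ≤ (radial d)⁻¹ * capDensity d x S := by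
  have hd : 1 ≤ d := by omega
  have hr0 := radial_ne_zero hd
  have hr1 := ((radial_le_one d).trans_lt ENNReal.one_lt_top).ne
  rw [cap_div_eq hd hx hε]
  calc _ ≤ 2 ^ S.ncard / ENNReal.ofReal (genDet x S) *
        (ENNReal.ofReal (sphereArea (d - S.ncard - 1)) * 1) /
      (ENNReal.ofReal (sphereArea (d - 1)) * radial d * 2 ^ S.ncard) := by
        refine ENNReal.div_le_div_right ?_ _
        refine (measure_mono (capRegion_subset x S)).trans ?_
        rw [volProd_slab x S hx hS]
        gcongr
        exact radial_le_one _
    _ = _ := by rw [slab_div_eq x S 1 (radial d), one_div]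

end OrthoGraph

end

/-! ### Probability of approximate ortho-homomorphisms. -/

open MeasureTheory Filter Topology
open scoped ENNReal

noncomputable section

namespace OrthoGraph

open scoped RealInnerProductSpace

variable {V : Type*} [Fintype V] {d : ℕ}

/-- The product of the uniform distributions on the unit sphere. -/
abbrev spherePi (d : ℕ) (V : Type*) [Fintype V] : Measure (V → E d) :=
  Measure.pi fun _ => uniformSphere (⊤ : Submodule ℝ (E d))

/-- The probability that independent random unit vectors form an approximate
ortho-homomorphism. -/
def nearDensity (d : ℕ) (H : SimpleGraph V) (ε : ℝ) : ℝ≥0∞ :=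
  spherePi d V {x | ∀ u v, H.Adj u v → |⟪x u, x v⟫| < ε}

theorem measurable_capDensity (S : Set V) : Measurable fun x : V → E d => capDensity d x S := by
  unfold capDensity
  exact measurable_const.div (ENNReal.measurable_ofReal.comp (measurable_genDet S))

theorem measurable_cap (hd : 1 ≤ d) (S : Set V) (ε : ℝ) :
    Measurable fun x : V → E d => cap x S ε := by
  have := uniformSphere_top_prob hd
  have hm : MeasurableSet {p : (V → E d) × E d | ∀ i ∈ S, |⟪p.1 i, p.2⟫| < ε} := by
    have : {p : (V → E d) × E d | ∀ i ∈ S, |⟪p.1 i, p.2⟫| < ε} =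
        ⋂ i ∈ S, {p : (V → E d) × E d | |⟪p.1 i, p.2⟫| < ε} := by
      ext; simp
    rw [this]
    exact MeasurableSet.biInter S.to_countable fun i _ =>
      measurableSet_lt (by fun_prop) measurable_const
  exact measurable_measure_prodMk_left hm

theorem measurableSet_near (H : SimpleGraph V) (ε : ℝ) :
    MeasurableSet {x : V → E d | ∀ u v, H.Adj u v → |⟪x u, x v⟫| < ε} := by
  have : {x : V → E d | ∀ u v, H.Adj u v → |⟪x u, x v⟫| < ε} =
      ⋂ u, ⋂ v, ⋂ _ : H.Adj u v, {x : V → E d | |⟪x u, x v⟫| < ε} := by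
    ext; simp
  rw [this]
  exact MeasurableSet.iInter fun u => MeasurableSet.iInter fun v => MeasurableSet.iInter fun _ =>
    measurableSet_lt (by fun_prop) measurable_const

/-- Given the images outside `W`, the constraints split into one for each node of `W`, and these are
independent. -/
theorem nearDensity_eq (hd : 1 ≤ d) {H : SimpleGraph V} {W : Finset V}
    (hW : ∀ u ∈ W, ∀ v ∈ W, ¬ H.Adj u v) (hU : ∀ u ∉ W, ∀ v ∉ W, ¬ H.Adj u v) (ε : ℝ) :
    nearDensity d H ε = ∫⁻ x, ∏ w ∈ W, cap x {u | H.Adj u w} ε ∂spherePi d V := by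
  classical
  have := uniformSphere_top_prob hd
  set A : Set (V → E d) := {x | ∀ u v, H.Adj u v → |⟪x u, x v⟫| < ε} with hA
  have hAm : MeasurableSet A := measurableSet_near H ε
  have hfm : Measurable (A.indicator (1 : (V → E d) → ℝ≥0∞)) := measurable_one.indicator hAm
  rw [nearDensity, ← lintegral_indicator_one hAm]
  refine lintegral_eq_of_lmarginal_eq W hfm
    (Finset.measurable_fun_prod _ fun w _ => measurable_cap hd _ ε) ?_
  ext x
  have hN : ∀ w ∈ W, ∀ u, H.Adj u w → u ∉ W := fun w hw u h hu => hW u hu w hw h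
  have h1 : ∀ y : W → E d, ∏ w ∈ W, cap (Function.updateFinset x W y) {u | H.Adj u w} ε =
      ∏ w ∈ W, cap x {u | H.Adj u w} ε := fun y => Finset.prod_congr rfl fun w hw => by
    unfold cap
    congr 1
    ext z
    refine forall₂_congr fun u hu => ?_
    simp [Function.updateFinset, hN w hw u hu]
  have h2 : ∀ y : W → E d, A.indicator (1 : (V → E d) → ℝ≥0∞) (Function.updateFinset x W y) =
      (Set.univ.pi fun w : W => {z | ∀ u ∈ {u | H.Adj u w}, |⟪x u, z⟫| < ε}).indicator 1 y :=
    fun y => by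
    have : Function.updateFinset x W y ∈ A ↔
        y ∈ Set.univ.pi fun w : W => {z | ∀ u ∈ {u | H.Adj u w}, |⟪x u, z⟫| < ε} := by
      simp only [hA, Set.mem_univ_pi, Set.mem_ofPred_eq]
      constructor
      · intro h w u hu
        have := h u w hu
        simpa [Function.updateFinset, hN w w.2 u hu] using this
      · have key : (∀ w : W, ∀ u, H.Adj u w → |⟪x u, y w⟫| < ε) → ∀ u, ∀ v ∈ W, H.Adj u v →
            |⟪Function.updateFinset x W y u, Function.updateFinset x W y v⟫| < ε := by
          intro h u v hv huv
          have := h ⟨v, hv⟩ u huv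
          simpa [Function.updateFinset, hN v hv u huv, hv] using this
        intro h u v huv
        by_cases hv : v ∈ W
        · exact key h u v hv huv
        · have hu : u ∈ W := by
            by_contra hu
            exact hU u hu v hv huv
          rw [real_inner_comm]
          exact key h v u hu huv.symm
    by_cases hy : Function.updateFinset x W y ∈ A
    · rw [Set.indicator_of_mem hy, Set.indicator_of_mem (this.1 hy)]; rfl
    · rw [Set.indicator_of_notMem hy, Set.indicator_of_notMem fun h => hy (this.2 h)]
  rw [lmarginal, lmarginal]
  simp only [h1, h2]
  rw [lintegral_indicator_one (MeasurableSet.univ_pi fun w => measurableSet_cap x _ ε),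
    Measure.pi_pi]
  simp only [lintegral_const, measure_univ, mul_one]
  exact Finset.prod_coe_sort W fun w => cap x {u | H.Adj u w} ε

theorem uniformSphere_ae_starProjection_ne_zero (hd : 1 ≤ d) {L : Submodule ℝ (E d)}
    (hL : L ≠ ⊥) : ∀ᵐ y ∂uniformSphere (⊤ : Submodule ℝ (E d)), L.starProjection y ≠ 0 := by
  have : Nontrivial (E d) := by
    have : Nonempty (Fin d) := ⟨⟨0, hd⟩⟩
    infer_instance
  have hm : MeasurableSet {y | L.starProjection y ≠ 0} :=
    (measurableSet_eq_fun (by fun_prop) measurable_const).compl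
  have hA : L.starProjection ≠ 0 := by
    intro h
    obtain ⟨v, hv, hv0⟩ := Submodule.exists_mem_ne_zero_of_ne_bot hL
    refine hv0 ?_
    rw [← Submodule.starProjection_eq_self_iff.2 hv, h]
    rfl
  have hn : Measurable fun g => nrm ((⊤ : Submodule ℝ (E d)).starProjection g) :=
    measurable_nrm.comp (by fun_prop)
  rw [uniformSphere_eq_map top_ne_bot, ae_map_iff hn.aemeasurable hm]
  filter_upwards [gauss_ae_ne_zero hA] with g hg
  have hg0 : g ≠ 0 := fun h => hg (by rw [h, map_zero])
  rw [Submodule.starProjection_top, nrm, map_smul]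
  exact smul_ne_zero (inv_ne_zero (norm_ne_zero_iff.2 hg0)) hg

/-- Vectors are added one at a time: while fewer than `d` are present, their complement is nonzero,
so the projection of the next independent vector to it is almost surely nonzero and the determinant
stays nonzero. -/
theorem ae_genDet_ne_zero {S : Set V} (hS : S.ncard < d) :
    ∀ᵐ x ∂spherePi d V, genDet x S ≠ 0 := by
  classical
  have hd : 1 ≤ d := by omega
  have := uniformSphere_top_prob hd
  induction S, Set.toFinite S using Set.Finite.induction_on with
  | empty => simp [genDet_empty]
  | @insert v S hv hfin ih =>
    have hSv : S.ncard < d :=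
      (Set.ncard_le_ncard (Set.subset_insert v S)).trans_lt hS
    have hpm : Measurable fun x : V → E d => (perp x S).starProjection (x v) :=
      Measurable.comp (g := fun p : (V → E d) × E d => (perp p.1 S).starProjection p.2)
        (f := fun x => (x, x v)) (measurable_starProjection_perp S)
        (measurable_id.prodMk (measurable_pi_apply v))
    have hm : MeasurableSet {x : V → E d | (perp x S).starProjection (x v) = 0} :=
      hpm (measurableSet_singleton 0)
    have h0 : ∀ᵐ x ∂spherePi d V, (perp x S).starProjection (x v) ≠ 0 := by
      rw [ae_iff]
      simp only [not_not]
      rw [← lintegral_indicator_one hm, ← lintegral_zero (μ := spherePi d V)]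
      refine lintegral_eq_of_lmarginal_eq {v} (measurable_one.indicator hm) measurable_const ?_
      ext x
      rw [lmarginal_singleton, lmarginal_singleton, lintegral_zero]
      have hp : ∀ y, perp (Function.update x v y) S = perp x S := fun y =>
        perp_congr fun i hi => Function.update_of_ne (fun h : i = v => hv (h ▸ hi)) _ _
      have hs : ∀ y, ({x : V → E d | (perp x S).starProjection (x v) = 0}.indicator
          (1 : (V → E d) → ℝ≥0∞)) (Function.update x v y) =
          {y | (perp x S).starProjection y = 0}.indicator 1 y := fun y => by
        simp only [Set.indicator, Set.mem_ofPred_eq, Function.update_self, Pi.one_apply,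
          starProjection_congr (hp y)]
      simp only [hs]
      rw [lintegral_indicator_one (measurableSet_eq_fun (by fun_prop) measurable_const)]
      have := uniformSphere_ae_starProjection_ne_zero hd (perp_ne_bot x hSv)
      rw [ae_iff] at this
      simpa using this
    filter_upwards [ih hSv, h0] with x h1 h2
    rw [genDet_insert x hv]
    exact mul_ne_zero h1 (norm_ne_zero_iff.2 h2)

theorem tendsto_nearDensity (hd : 1 ≤ d) {H : SimpleGraph V} {W : Finset V}
    (hW : ∀ u ∈ W, ∀ v ∈ W, ¬ H.Adj u v) (hU : ∀ u ∉ W, ∀ v ∉ W, ¬ H.Adj u v)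
    (hN : ∀ w ∈ W, {u | H.Adj u w}.ncard < d) :
    Tendsto (fun ε => nearDensity d H ε /
        ENNReal.ofReal (2 * ε) ^ ∑ w ∈ W, {u | H.Adj u w}.ncard) (𝓝[>] 0)
      (𝓝 (∫⁻ x, ∏ w ∈ W, capDensity d x {u | H.Adj u w} ∂spherePi d V)) := by
  have := uniformSphere_top_prob hd
  set N : V → Set V := fun w => {u | H.Adj u w} with hNdef
  set F : ℝ → (V → E d) → ℝ≥0∞ := fun ε x =>
    ∏ w ∈ W, (cap x (N w) ε / ENNReal.ofReal (2 * ε) ^ (N w).ncard) with hF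
  set G : (V → E d) → ℝ≥0∞ := fun x => ∏ w ∈ W, capDensity d x (N w) with hG
  have hGm : Measurable G := Finset.measurable_fun_prod _ fun w _ => measurable_capDensity _
  have hFm : ∀ ε, Measurable (F ε) := fun ε => Finset.measurable_fun_prod _ fun w _ =>
    (measurable_cap hd _ ε).div_const _
  have hind : ∀ᵐ x ∂spherePi d V, ∀ w ∈ W, genDet x (N w) ≠ 0 :=
    (ae_ball_iff W.countable_toSet).2 fun w hw => ae_genDet_ne_zero (hN w hw)
  have heq : ∀ᶠ ε in 𝓝[>] (0 : ℝ), ∫⁻ x, F ε x ∂spherePi d V = nearDensity d H ε /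
        ENNReal.ofReal (2 * ε) ^ ∑ w ∈ W, (N w).ncard := by
    filter_upwards [self_mem_nhdsWithin] with ε (hε : 0 < ε)
    rw [nearDensity_eq hd hW hU, div_eq_mul_inv, ← lintegral_mul_const _
      (Finset.measurable_fun_prod _ fun w _ => measurable_cap hd _ ε)]
    refine lintegral_congr fun x => ?_
    simp only [hF, div_eq_mul_inv]
    rw [Finset.prod_mul_distrib, ← Finset.prod_pow_eq_pow_sum, ENNReal.prod_inv_distrib]
    intro i _ j _ _
    exact Or.inl (pow_ne_zero _ (by simpa using hε))
  have hlim : ∀ᵐ x ∂spherePi d V, Tendsto (fun ε => F ε x) (𝓝[>] 0) (𝓝 (G x)) := by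
    filter_upwards [hind] with x hx
    refine ENNReal.tendsto_finsetProd_of_ne_top _ (fun w hw => tendsto_cap (hx w hw) (hN w hw))
      fun w hw => ?_
    refine ENNReal.div_ne_top (ENNReal.div_ne_top ENNReal.ofReal_ne_top ?_) ?_
    · simpa using sphereArea_pos _
    · simpa using lt_of_le_of_ne (genDet_nonneg x _) (Ne.symm (hx w hw))
  refine Tendsto.congr' heq ?_
  -- If the limit integral is infinite, Fatou's lemma suffices. Otherwise a multiple of `G` is an
  -- integrable bound.
  by_cases hfin : ∫⁻ x, G x ∂spherePi d V = ∞
  · refine tendsto_of_le_liminf_of_limsup_le ?_ (by rw [hfin]; exact le_top)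
    calc ∫⁻ x, G x ∂spherePi d V
        = ∫⁻ x, liminf (fun ε => F ε x) (𝓝[>] 0) ∂spherePi d V :=
          lintegral_congr_ae (hlim.mono fun x hx => hx.liminf_eq.symm)
      _ ≤ _ := lintegral_liminf_le' fun ε => (hFm ε).aemeasurable
  · refine tendsto_lintegral_filter_of_dominated_convergence
      (fun x => (radial d)⁻¹ ^ W.card * G x) (Eventually.of_forall hFm) ?_ ?_ hlim
    · filter_upwards [self_mem_nhdsWithin] with ε hε
      filter_upwards [hind] with x hx
      calc F ε x ≤ ∏ w ∈ W, ((radial d)⁻¹ * capDensity d x (N w)) :=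
            Finset.prod_le_prod' fun w hw => cap_div_le (hx w hw) (hN w hw) hε
        _ = _ := by rw [Finset.prod_mul_distrib, Finset.prod_const]
    · rw [lintegral_const_mul _ hGm]
      exact ENNReal.mul_ne_top (ENNReal.pow_ne_top (ENNReal.inv_ne_top.2 (radial_ne_zero hd))) hfin

end OrthoGraph

end

open MeasureTheory Filter Topology
open scoped ENNReal

noncomputable section

namespace OrthoGraph

open scoped RealInnerProductSpace

/-! ### Normalization by the density of an edge. -/

section Constants

variable {ι : Type*} [Fintype ι] {d : ℕ}

/-- The density `s_{d,n}` is normalized by one factor $\kappa=A_{d-2}/A_{d-1}$ per edge, and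
$\kappa$ is the limiting density of a single edge. -/
theorem capDensity_eq (x : ι → E d) (S : Set ι) :
    capDensity d x S =
      ENNReal.ofReal (sphereArea (d - 2) / sphereArea (d - 1)) ^ S.ncard * sDensity d x S := by
  have h1 := sphereArea_pos (d - 1)
  have h2 := sphereArea_pos (d - 2)
  have h3 := sphereArea_pos (d - S.ncard - 1)
  rw [capDensity, sDensity, ← ENNReal.ofReal_div_of_pos h1, ← ENNReal.ofReal_pow (by positivity),
    ← mul_div_assoc, ← ENNReal.ofReal_mul (by positivity)]
  congr 2
  rw [zpow_sub_one₀ h1.ne', zpow_natCast, div_pow]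
  field_simp

theorem sDensity_singleton (x : ι → E d) {i : ι} (hi : ‖x i‖ = 1) :
    sDensity d x {i} = 1 := by
  have h2 := sphereArea_pos (d - 2)
  have hd : d - 1 - 1 = d - 2 := by omega
  have hg : genDet x {i} = 1 := by
    have hp : perp x ∅ = ⊤ := by
      rw [perp, Set.image_empty, Submodule.span_empty, Submodule.bot_orthogonal_eq_top]
    have h := genDet_insert x (S := ∅) (Set.notMem_empty i)
    rw [insert_empty_eq, genDet_empty, one_mul, starProjection_congr hp,
      Submodule.starProjection_top] at h
    rw [h]
    exact hi
  rw [sDensity, hg, Set.ncard_singleton, hd]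
  simp [h2.ne']

theorem uniformSphere_ae_norm (hd : 1 ≤ d) :
    ∀ᵐ y ∂uniformSphere (⊤ : Submodule ℝ (E d)), ‖y‖ = 1 := by
  have : Nontrivial (E d) := by
    have : Nonempty (Fin d) := ⟨⟨0, hd⟩⟩
    infer_instance
  have hn : Measurable fun g => nrm ((⊤ : Submodule ℝ (E d)).starProjection g) :=
    measurable_nrm.comp (by fun_prop)
  rw [uniformSphere_eq_map top_ne_bot, ae_map_iff hn.aemeasurable
    (measurableSet_eq_fun measurable_norm measurable_const)]
  filter_upwards [gauss_ae_ne_zero (A := ContinuousLinearMap.id ℝ (E d))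
    (fun h => by
      obtain ⟨v, hv⟩ := exists_ne (0 : E d)
      exact hv (congrArg (fun A : E d →L[ℝ] E d => A v) h))] with g hg
  rw [Submodule.starProjection_top]
  exact norm_nrm hg

end Constants

/-- Each edge has exactly one end in `W`. -/
theorem sum_ncard_eq {V : Type*} [Fintype V] {H : SimpleGraph V} {W : Finset V}
    (hW : ∀ u ∈ W, ∀ v ∈ W, ¬ H.Adj u v) (hU : ∀ u ∉ W, ∀ v ∉ W, ¬ H.Adj u v) :
    ∑ w ∈ W, {u | H.Adj u w}.ncard = H.edgeSet.ncard := by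
  classical
  have hb : H.IsBipartiteWith (W : Set V) ((Wᶜ : Finset V) : Set V) := by
    refine ⟨by simpa using disjoint_compl_right, fun v w h => ?_⟩
    have h1 := hW v
    have h2 := hU v
    by_cases hv : v ∈ W <;> by_cases hw : w ∈ W
    · exact absurd h (hW v hv w hw)
    · exact Or.inl ⟨hv, by simpa using hw⟩
    · exact Or.inr ⟨by simpa using hv, hw⟩
    · exact absurd h (hU v hv w hw)
  have h := SimpleGraph.isBipartiteWith_sum_degrees_eq_card_edges hb
  rw [← SimpleGraph.coe_edgeFinset, Set.ncard_coe_finset, ← h]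
  refine Finset.sum_congr rfl fun w _ => ?_
  rw [← SimpleGraph.card_neighborFinset_eq_degree, ← Set.ncard_coe_finset,
    SimpleGraph.coe_neighborFinset]
  congr 1
  ext u
  simp [SimpleGraph.adj_comm]

variable {d : ℕ}

theorem tendsto_nearDensity_singleEdge (hd : 2 ≤ d) :
    Tendsto (fun ε => nearDensity d singleEdge ε / ENNReal.ofReal (2 * ε)) (𝓝[>] 0)
      (𝓝 (ENNReal.ofReal (sphereArea (d - 2) / sphereArea (d - 1)))) := by
  have := uniformSphere_top_prob (d := d) (by omega)
  have hN : {u | singleEdge.Adj u 1} = {0} := by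
    ext u
    fin_cases u <;> simp [singleEdge]
  have h := tendsto_nearDensity (d := d) (by omega) (H := singleEdge) (W := {1})
    (by simp) (by
      intro u hu v hv
      rw [Finset.mem_singleton] at hu hv
      have : u = v := by omega
      rw [this]
      exact singleEdge.loopless.irrefl v) (by
      intro w hw
      rw [Finset.mem_singleton.1 hw, hN, Set.ncard_singleton]
      omega)
  simp only [Finset.sum_singleton, Finset.prod_singleton, hN, Set.ncard_singleton, pow_one] at h
  convert h using 2
  have h1 : ∀ᵐ x ∂spherePi d (Fin 2), capDensity d x {(0 : Fin 2)} =
      ENNReal.ofReal (sphereArea (d - 2) / sphereArea (d - 1)) := by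
    have h2 : ∀ᵐ x ∂spherePi d (Fin 2), ‖x 0‖ = 1 :=
      (Measure.quasiMeasurePreserving_eval (fun _ : Fin 2 =>
        uniformSphere (⊤ : Submodule ℝ (E d))) 0).ae (uniformSphere_ae_norm (by omega))
    filter_upwards [h2] with x hx
    rw [capDensity_eq, sDensity_singleton x hx]
    simp
  rw [lintegral_congr_ae h1]
  simp

/-- Numerator and denominator both carry $(2\varepsilon\kappa)^m$ to leading order, where $m$ is the
number of edges. The remaining integral is the ortho-homomorphism number for any ordering `p`. -/
theorem tendsto_nearDensity_ratio {V : Type*} [Fintype V] (hd : 2 ≤ d) {H : SimpleGraph V}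
    (hH : DSparse d H) {W : Finset V}
    (hW : ∀ u ∈ W, ∀ v ∈ W, ¬ H.Adj u v) (hU : ∀ u ∉ W, ∀ v ∉ W, ¬ H.Adj u v)
    {n : ℕ} (p : Fin n ≃ V) :
    Tendsto (fun ε => nearDensity d H ε / nearDensity d singleEdge ε ^ H.edgeSet.ncard) (𝓝[>] 0)
      (𝓝 (orthoNumber d H p)) := by
  classical
  set κ := ENNReal.ofReal (sphereArea (d - 2) / sphereArea (d - 1)) with hκ
  have hκ0 : κ ≠ 0 := by
    simpa [hκ] using div_pos (sphereArea_pos (d - 2)) (sphereArea_pos (d - 1))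
  have hκ1 : κ ≠ ∞ := ENNReal.ofReal_ne_top
  have hE := sum_ncard_eq hW hU
  set m := H.edgeSet.ncard
  have hm0 : κ ^ m ≠ 0 := pow_ne_zero _ hκ0
  have hm1 : κ ^ m ≠ ∞ := ENNReal.pow_ne_top hκ1
  have h1 := tendsto_nearDensity (d := d) (by omega) hW hU (fun w _ => by
    have := ncard_nbr_lt hH (by omega) w Set.univ
    simpa [nbr] using this)
  have h2 : ∫⁻ x, ∏ w ∈ W, capDensity d x {u | H.Adj u w} ∂spherePi d V =
      κ ^ m * orthoNumber d H p := by
    rw [orthoNumber_bipartite hH (by omega) hW hU p, ← lintegral_const_mul _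
      (Finset.measurable_fun_prod _ fun v _ => measurable_sDensity _)]
    refine lintegral_congr fun x => ?_
    simp only [capDensity_eq]
    rw [Finset.prod_mul_distrib, Finset.prod_pow_eq_pow_sum, hE]
  rw [h2, hE] at h1
  have h3 := ENNReal.Tendsto.pow (n := m) (tendsto_nearDensity_singleEdge hd)
  have h4 := ENNReal.Tendsto.div h1 (Or.inr hm0) h3 (Or.inl hm1)
  rw [mul_comm, ENNReal.mul_div_cancel_right hm0 hm1] at h4
  refine Tendsto.congr' ?_ h4
  filter_upwards [self_mem_nhdsWithin] with ε (hε : 0 < ε)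
  have he0 : ENNReal.ofReal (2 * ε) ^ m ≠ 0 := pow_ne_zero _ (by simpa using hε)
  have he1 : ENNReal.ofReal (2 * ε) ^ m ≠ ∞ := ENNReal.pow_ne_top ENNReal.ofReal_ne_top
  simp only [div_eq_mul_inv]
  rw [mul_pow, ← ENNReal.inv_pow, ENNReal.mul_inv (Or.inr (ENNReal.inv_ne_top.2 he0))
    (Or.inr (ENNReal.inv_ne_zero.2 he1)), inv_inv, mul_comm _ (ENNReal.ofReal (2 * ε) ^ m),
    mul_assoc, ← mul_assoc _ (ENNReal.ofReal (2 * ε) ^ m), ENNReal.inv_mul_cancel he0 he1, one_mul]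

end OrthoGraph

end

/-! ### The region of nearly orthogonal tuples in the ball. -/

open MeasureTheory Filter Topology
open scoped ENNReal

noncomputable section

namespace OrthoGraph

open scoped RealInnerProductSpace

variable {V : Type*} [Fintype V] {d : ℕ}

/-- The tuples of nonzero vectors in the open unit ball whose normalizations form an approximate
ortho-homomorphism. -/
def nearRegion (d : ℕ) (H : SimpleGraph V) (ε : ℝ) : Set (V → E d) :=
  {x | (∀ v, x v ≠ 0 ∧ ‖x v‖ < 1) ∧ ∀ u v, H.Adj u v → |⟪nrm (x u), nrm (x v)⟫| < ε}

theorem map_nrm_ball (hd : 1 ≤ d) : (volume.restrict (Metric.ball (0 : E d) 1)).map nrm =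
    volume (Metric.ball (0 : E d) 1) • uniformSphere (⊤ : Submodule ℝ (E d)) := by
  ext s hs
  have h := lintegral_ball_nrm hd (f := s.indicator 1) (measurable_one.indicator hs)
  rw [lintegral_indicator_one hs] at h
  rw [Measure.smul_apply, smul_eq_mul, ← h, ← lintegral_indicator_one hs,
    lintegral_map (measurable_one.indicator hs) measurable_nrm]

theorem volume_eval_preimage_null (v : V) {s : Set (E d)} (hs : volume s = 0) :
    volume {x : V → E d | x v ∈ s} = 0 :=
  (Measure.quasiMeasurePreserving_eval (fun _ : V => (volume : Measure (E d))) v).preimage_null hs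

theorem nrm_inner_eq {x y : E d} : ⟪nrm x, nrm y⟫ = ‖x‖⁻¹ * (‖y‖⁻¹ * ⟪x, y⟫) := by
  rw [nrm, nrm, inner_smul_left, inner_smul_right]
  simp

/-- Normalizing every coordinate carries Lebesgue measure on the product of balls to a multiple of
the product of the uniform distributions. -/
theorem volume_nearRegion (hd : 1 ≤ d) (H : SimpleGraph V) (ε : ℝ) :
    volume (nearRegion d H ε) =
      volume (Metric.ball (0 : E d) 1) ^ Fintype.card V * nearDensity d H ε := by
  have := uniformSphere_top_prob hd
  have : Nontrivial (E d) := by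
    have : Nonempty (Fin d) := ⟨⟨0, hd⟩⟩
    infer_instance
  set B := Metric.ball (0 : E d) 1
  have hB : volume B ≠ ∞ := Metric.isBounded_ball.measure_lt_top.ne
  have hsf : IsFiniteMeasure (volume B • uniformSphere (⊤ : Submodule ℝ (E d))) :=
    ⟨by simpa using hB.lt_top⟩
  set A : Set (V → E d) := {x | ∀ u v, H.Adj u v → |⟪x u, x v⟫| < ε}
  have hA : MeasurableSet A := measurableSet_near H ε
  have hpow : Measure.pi (fun _ : V => volume B • uniformSphere (⊤ : Submodule ℝ (E d))) =
      volume B ^ Fintype.card V • spherePi d V := by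
    refine Measure.pi_eq fun s _ => ?_
    simp only [Measure.smul_apply, Measure.pi_pi, smul_eq_mul]
    rw [Finset.prod_mul_distrib, Finset.prod_const, Finset.card_univ]
  have hfin : IsFiniteMeasure ((volume.restrict B).map (nrm : E d → E d)) := by
    rw [map_nrm_ball hd]; exact hsf
  have hmap : (Measure.pi fun _ : V => (volume.restrict B : Measure (E d))).map
      (fun (x : V → E d) (v : V) => nrm (x v)) =
      Measure.pi fun _ : V => volume B • uniformSphere (⊤ : Submodule ℝ (E d)) := by
    rw [← map_nrm_ball hd]
    exact Measure.pi_map_pi (f := fun _ => nrm) fun _ => measurable_nrm.aemeasurable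
  have hm : Measurable fun (x : V → E d) (v : V) => nrm (x v) :=
    measurable_pi_iff.2 fun v => measurable_nrm.comp (measurable_pi_apply v)
  have h1 : volume (nearRegion d H ε) =
      ((volume : Measure (V → E d)).restrict (Set.univ.pi fun _ => B))
        ((fun (x : V → E d) (v : V) => nrm (x v)) ⁻¹' A) := by
    rw [Measure.restrict_apply (hm hA)]
    refine measure_congr ?_
    have h0 : ∀ᵐ x : V → E d, ∀ v, x v ≠ 0 := by
      refine ae_all_iff.2 fun v => ?_
      rw [ae_iff]
      simp only [not_not]
      exact volume_eval_preimage_null v (s := {0}) (by simp)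
    filter_upwards [h0] with x hx
    refine propext ?_
    change ((∀ v, x v ≠ 0 ∧ ‖x v‖ < 1) ∧ ∀ u v, H.Adj u v → |⟪nrm (x u), nrm (x v)⟫| < ε) ↔
      (∀ u v, H.Adj u v → |⟪nrm (x u), nrm (x v)⟫| < ε) ∧ x ∈ Set.univ.pi fun _ => B
    simp only [Set.mem_univ_pi, B, mem_ball_zero_iff, hx, ne_eq, not_false_eq_true, true_and]
    exact and_comm
  rw [h1, volume_pi, Measure.restrict_pi_pi, ← Measure.map_apply hm hA, hmap, hpow, Measure.smul_apply, smul_eq_mul, nearDensity]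

-- Normalization is discontinuous at 0; with denominators cleared, the conditions compare continuous
-- functions.
omit [Fintype V] in
theorem nearRegion_eq (H : SimpleGraph V) (ε : ℝ) :
    nearRegion d H ε = {x | (∀ v, x v ≠ 0 ∧ ‖x v‖ < 1) ∧
      ∀ u v, H.Adj u v → |⟪x u, x v⟫| < ε * (‖x u‖ * ‖x v‖)} := by
  ext x
  refine and_congr_right fun hx => forall₂_congr fun u v => imp_congr_right fun _ => ?_
  have hu := norm_pos_iff.2 (hx u).1
  have hv := norm_pos_iff.2 (hx v).1
  rw [nrm_inner_eq, ← mul_assoc, ← mul_inv, abs_mul, abs_inv, abs_of_pos (mul_pos hu hv),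
    inv_mul_lt_iff₀ (mul_pos hu hv), mul_comm ε]

theorem isOpen_nearRegion (H : SimpleGraph V) (ε : ℝ) : IsOpen (nearRegion d H ε) := by
  have : nearRegion d H ε = (⋂ v, {x | x v ≠ 0} ∩ {x | ‖x v‖ < 1}) ∩
      ⋂ u, ⋂ v, ⋂ _ : H.Adj u v, {x | |⟪x u, x v⟫| < ε * (‖x u‖ * ‖x v‖)} := by
    rw [nearRegion_eq]
    ext x
    simp
  rw [this]
  refine (isOpen_iInter_of_finite fun v => ?_).inter (isOpen_iInter_of_finite fun u =>
    isOpen_iInter_of_finite fun v => isOpen_iInter_of_finite fun _ => ?_)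
  · exact (isOpen_ne_fun (by fun_prop) continuous_const).inter
      (isOpen_lt (by fun_prop) continuous_const)
  · exact isOpen_lt (by fun_prop) (by fun_prop)

/-- A boundary point has a zero coordinate, a coordinate on the unit sphere, or an edge with
equality. The first two cases are null, the third is null by hypothesis on `ε`. -/
theorem volume_frontier_nearRegion (hd : 1 ≤ d) {H : SimpleGraph V} {ε : ℝ}
    (hε : ∀ u v, H.Adj u v → volume {x : V → E d | |⟪nrm (x u), nrm (x v)⟫| = ε} = 0) :
    volume (frontier (nearRegion d H ε)) = 0 := by
  have : Nontrivial (E d) := by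
    have : Nonempty (Fin d) := ⟨⟨0, hd⟩⟩
    infer_instance
  have hcl : closure (nearRegion d H ε) ⊆ {x | (∀ v, ‖x v‖ ≤ 1) ∧
      ∀ u v, H.Adj u v → |⟪x u, x v⟫| ≤ ε * (‖x u‖ * ‖x v‖)} := by
    refine closure_minimal ?_ ?_
    · rw [nearRegion_eq]
      exact fun x hx => ⟨fun v => (hx.1 v).2.le, fun u v huv => (hx.2 u v huv).le⟩
    · have : {x : V → E d | (∀ v, ‖x v‖ ≤ 1) ∧
          ∀ u v, H.Adj u v → |⟪x u, x v⟫| ≤ ε * (‖x u‖ * ‖x v‖)} = (⋂ v, {x | ‖x v‖ ≤ 1}) ∩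
          ⋂ u, ⋂ v, ⋂ _ : H.Adj u v, {x | |⟪x u, x v⟫| ≤ ε * (‖x u‖ * ‖x v‖)} := by
        ext x
        simp
      rw [this]
      exact (isClosed_iInter fun v => isClosed_le (by fun_prop) continuous_const).inter
        (isClosed_iInter fun u => isClosed_iInter fun v => isClosed_iInter fun _ =>
          isClosed_le (by fun_prop) (by fun_prop))
  have hsub : frontier (nearRegion d H ε) ⊆ (⋃ v, {x | x v ∈ ({0} : Set (E d))}) ∪
      (⋃ v, {x | x v ∈ Metric.sphere (0 : E d) 1}) ∪
      ⋃ u, ⋃ v, ⋃ _ : H.Adj u v, {x : V → E d | |⟪nrm (x u), nrm (x v)⟫| = ε} := by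
    intro x hx
    rw [(isOpen_nearRegion H ε).frontier_eq] at hx
    obtain ⟨h1, h2⟩ := hcl hx.1
    by_contra hc
    simp only [Set.mem_union, Set.mem_iUnion, Set.mem_ofPred_eq, Set.mem_singleton_iff,
      mem_sphere_zero_iff_norm, not_or, not_exists] at hc
    obtain ⟨⟨h3, h4⟩, h5⟩ := hc
    refine hx.2 ⟨fun v => ⟨h3 v, lt_of_le_of_ne (h1 v) (h4 v)⟩, fun u v huv => ?_⟩
    refine lt_of_le_of_ne ?_ (h5 u v huv)
    have hu := norm_pos_iff.2 (h3 u)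
    have hv := norm_pos_iff.2 (h3 v)
    rw [nrm_inner_eq, ← mul_assoc, ← mul_inv, abs_mul, abs_inv, abs_of_pos (mul_pos hu hv),
      inv_mul_le_iff₀ (mul_pos hu hv), mul_comm _ ε]
    exact h2 u v huv
  refine measure_mono_null hsub ?_
  simp only [measure_union_null_iff, measure_iUnion_null_iff]
  exact ⟨⟨fun v => volume_eval_preimage_null v (by simp), fun v =>
    volume_eval_preimage_null v (Measure.addHaar_sphere volume 0 1)⟩, hε⟩

/-- The level sets of one measurable function are disjoint, so only countably many of them can have
positive measure. -/
theorem countable_generic (d k : ℕ) : {ε : ℝ | ∃ u v : Fin k,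
    volume {x : Fin k → E d | |⟪nrm (x u), nrm (x v)⟫| = ε} ≠ 0}.Countable := by
  have : {ε : ℝ | ∃ u v : Fin k, volume {x : Fin k → E d | |⟪nrm (x u), nrm (x v)⟫| = ε} ≠ 0} =
      ⋃ u, ⋃ v, {ε : ℝ | 0 < volume {x : Fin k → E d | |⟪nrm (x u), nrm (x v)⟫| = ε}} := by
    ext ε
    simp [pos_iff_ne_zero]
  rw [this]
  refine Set.countable_iUnion fun u => Set.countable_iUnion fun v => ?_
  refine Measure.countable_meas_level_set_pos ?_
  have h : ∀ u : Fin k, Measurable fun x : Fin k → E d => nrm (x u) := fun u =>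
    measurable_nrm.comp (measurable_pi_apply u)
  exact (Measurable.inner (𝕜 := ℝ) (h u) (h v)).norm

end OrthoGraph

end

/-! ### Lattice graphs and lattice point counting. -/

open MeasureTheory Filter Topology
open scoped ENNReal

noncomputable section

namespace OrthoGraph

open scoped RealInnerProductSpace Pointwise

variable {V : Type*} [Fintype V] {d : ℕ}

/-- The coordinates of a tuple of vectors. -/
def coords (d : ℕ) (V : Type*) [Fintype V] : (V → E d) ≃ₜ (V × Fin d → ℝ) where
  toFun x p := x p.1 p.2
  invFun y v := WithLp.toLp 2 fun j => y (v, j)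
  left_inv x := rfl
  right_inv y := rfl
  continuous_toFun := by fun_prop
  continuous_invFun := by fun_prop

theorem measurePreserving_coords :
    MeasurePreserving (coords d V) (volume : Measure (V → E d)) volume := by
  refine ⟨(coords d V).continuous.measurable, Eq.symm ?_⟩
  refine Measure.pi_eq fun s hs => ?_
  have hset : coords d V ⁻¹' Set.univ.pi s = Set.univ.pi fun v =>
      (WithLp.ofLp : E d → Fin d → ℝ) ⁻¹' Set.univ.pi fun j => s (v, j) := by
    ext x
    simp [coords]
  rw [Measure.map_apply (coords d V).continuous.measurable (MeasurableSet.univ_pi hs), hset,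
    volume_pi, Measure.pi_pi, Fintype.prod_prod_type]
  refine Finset.prod_congr rfl fun v _ => ?_
  rw [(PiLp.volume_preserving_ofLp (Fin d)).measure_preimage
    (MeasurableSet.univ_pi fun j => hs _).nullMeasurableSet, volume_pi_pi]

/-- The nonzero points of the lattice `N⁻¹ ℤ^d` in the open unit ball. -/
def latticePoints (d N : ℕ) : Set (E d) :=
  {z | (z ≠ 0 ∧ ‖z‖ < 1) ∧ ∀ j, ∃ k : ℤ, (k : ℝ) = N * z j}

/-- The graph on lattice points in which nearly orthogonal points are adjacent. -/
def latticeGraph (d N : ℕ) (ε : ℝ) : SimpleGraph (latticePoints d N) where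
  Adj z w := z ≠ w ∧ |⟪nrm (z : E d), nrm (w : E d)⟫| < ε
  symm := ⟨fun z w h => ⟨h.1.symm, by rw [real_inner_comm]; exact h.2⟩⟩
  loopless := ⟨fun z h => h.1 rfl⟩

/-- A unit vector has inner product 1 with itself, so for `ε ≤ 1` looplessness costs nothing:
homomorphisms may be counted as if only near orthogonality were required. -/
theorem latticeGraph_adj {N : ℕ} {ε : ℝ} (hε : ε ≤ 1) {z w : latticePoints d N} :
    (latticeGraph d N ε).Adj z w ↔ |⟪nrm (z : E d), nrm (w : E d)⟫| < ε := by
  refine ⟨fun h => h.2, fun h => ⟨?_, h⟩⟩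
  rintro rfl
  rw [real_inner_self_eq_norm_sq, norm_nrm z.2.1.1] at h
  norm_num at h
  linarith

/-- Homomorphisms to the lattice graph are lattice points in a region. -/
def latticeHomEquiv (H : SimpleGraph V) {N : ℕ} [NeZero N] {ε : ℝ} (hε : ε ≤ 1) :
    (H →g latticeGraph d N ε) ≃
      ↑(coords d V '' nearRegion d H ε ∩
        (N : ℝ)⁻¹ • (Submodule.span ℤ (Set.range (Pi.basisFun ℝ (V × Fin d))) : Set (V × Fin d → ℝ))) where
  toFun f := ⟨coords d V fun v => f v, ⟨_, ⟨fun v => (f v).2.1, fun u v huv =>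
      (latticeGraph_adj hε).1 (f.map_adj huv)⟩, rfl⟩, by
    refine BoxIntegral.unitPartition.mem_smul_span_iff.2 fun p => ?_
    exact (f p.1).2.2 p.2⟩
  invFun x :=
    { toFun := fun v => ⟨(coords d V).symm x v, by
        obtain ⟨y, hy, hyx⟩ := x.2.1
        rw [← hyx, Homeomorph.symm_apply_apply]
        refine ⟨hy.1 v, fun j => ?_⟩
        have := BoxIntegral.unitPartition.mem_smul_span_iff.1 x.2.2 (v, j)
        rw [← hyx] at this
        exact this⟩
      map_rel' := fun {u v} huv => by
        obtain ⟨y, hy, hyx⟩ := x.2.1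
        refine (latticeGraph_adj hε).2 ?_
        simp only [← hyx, Homeomorph.symm_apply_apply]
        exact hy.2 u v huv }
  left_inv f := rfl
  right_inv x := rfl

theorem isBounded_nearRegion (H : SimpleGraph V) (ε : ℝ) :
    Bornology.IsBounded (coords d V '' nearRegion d H ε) := by
  refine (Metric.isBounded_closedBall (x := (0 : V × Fin d → ℝ)) (r := 1)).subset ?_
  rintro _ ⟨x, hx, rfl⟩
  rw [mem_closedBall_zero_iff, pi_norm_le_iff_of_nonneg zero_le_one]
  exact fun p => (PiLp.norm_apply_le (x p.1) p.2).trans (hx.1 p.1).2.le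

/-- Homomorphisms are the points of $N^{-1}\mathbb Z^{V\times d}$ in `nearRegion`, which is bounded
with null boundary. Their number, divided by $N^{d|V|}$, tends to the volume. -/
theorem tendsto_card_latticeHom (hd : 1 ≤ d) {H : SimpleGraph V} {ε : ℝ} (hε1 : ε ≤ 1)
    (hε : ∀ u v, H.Adj u v → volume {x : V → E d | |⟪nrm (x u), nrm (x v)⟫| = ε} = 0) :
    Tendsto (fun N : ℕ => (Nat.card (H →g latticeGraph d N ε) : ℝ) /
      ((N : ℝ) ^ d) ^ Fintype.card V) atTop
      (𝓝 ((volume (Metric.ball (0 : E d) 1)).toReal ^ Fintype.card V *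
        (nearDensity d H ε).toReal)) := by
  have himg : coords d V '' nearRegion d H ε = (coords d V).symm ⁻¹' nearRegion d H ε :=
    (coords d V).toEquiv.image_eq_preimage_symm _
  have hfr : frontier (coords d V '' nearRegion d H ε) =
      coords d V '' frontier (nearRegion d H ε) := ((coords d V).image_frontier _).symm
  have hvol : ∀ s : Set (V → E d), MeasurableSet s → volume (coords d V '' s) = volume s :=
    fun s hs => by
    have hpre : coords d V ⁻¹' (coords d V '' s) = s := Set.preimage_image_eq _ (coords d V).injective
    have hms : MeasurableSet (coords d V '' s) := by
      rw [show coords d V '' s = (coords d V).symm ⁻¹' s from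
        (coords d V).toEquiv.image_eq_preimage_symm _]
      exact (coords d V).symm.continuous.measurable hs
    rw [← measurePreserving_coords.measure_preimage hms.nullMeasurableSet, hpre]
  have hopen := isOpen_nearRegion (d := d) H ε
  have h := tendsto_card_div_pow_atTop_volume (coords d V '' nearRegion d H ε)
    (isBounded_nearRegion H ε) ((coords d V).isOpenMap _ hopen).measurableSet (by
      rw [hfr, hvol _ isClosed_frontier.measurableSet, volume_frontier_nearRegion hd hε])
  rw [Measure.real, hvol _ hopen.measurableSet, volume_nearRegion hd, ENNReal.toReal_mul,
    ENNReal.toReal_pow] at h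
  refine h.congr' ?_
  filter_upwards [eventually_ne_atTop 0] with N hN
  have : NeZero N := ⟨hN⟩
  rw [Nat.card_congr (latticeHomEquiv (d := d) H hε1).symm, Fintype.card_prod, Fintype.card_fin,
    ← pow_mul, mul_comm d]

theorem finite_latticePoints (d : ℕ) {N : ℕ} (hN : N ≠ 0) : Finite (latticePoints d N) := by
  have : NeZero N := ⟨hN⟩
  -- The region of the edgeless graph on one node is the punctured ball; scaled by `N`, it contains
  -- finitely many integer points.
  have hfin := ZSpan.setFinite_inter (Pi.basisFun ℝ (Fin 1 × Fin d))
    ((isBounded_nearRegion (d := d) (⊥ : SimpleGraph (Fin 1)) 1).smul₀ (N : ℝ))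
  let f : latticePoints d N → ↑(((N : ℝ) • coords d (Fin 1) '' nearRegion d ⊥ 1) ∩
      (Submodule.span ℤ (Set.range (Pi.basisFun ℝ (Fin 1 × Fin d))) :
        Set (Fin 1 × Fin d → ℝ))) := fun z =>
    ⟨(N : ℝ) • coords d (Fin 1) fun _ => z, Set.smul_mem_smul_set ⟨_, ⟨fun _ => z.2.1,
      fun u v h => absurd h (by simp)⟩, rfl⟩, by
      have : coords d (Fin 1) (fun _ => z) ∈
          (N : ℝ)⁻¹ • Submodule.span ℤ (Set.range (Pi.basisFun ℝ (Fin 1 × Fin d))) :=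
        BoxIntegral.unitPartition.mem_smul_span_iff.2 fun p => z.2.2 p.2
      exact (Set.mem_inv_smul_set_iff₀ (by exact_mod_cast hN) _ _).1 this⟩
  have := hfin.to_subtype
  refine Finite.of_injective f fun z w h => ?_
  have h1 := congrArg Subtype.val h
  have h2 := smul_right_injective _ (show (N : ℝ) ≠ 0 by exact_mod_cast hN) h1
  exact Subtype.ext (congrFun ((coords d (Fin 1)).injective h2) 0)

/-- The node count is the homomorphism count of the graph with one node and no edges. -/
theorem tendsto_card_latticePoints (hd : 1 ≤ d) :
    Tendsto (fun N : ℕ => (Nat.card (latticePoints d N) : ℝ) / (N : ℝ) ^ d) atTop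
      (𝓝 (volume (Metric.ball (0 : E d) 1)).toReal) := by
  have := uniformSphere_top_prob hd
  have h := tendsto_card_latticeHom (d := d) hd (H := (⊥ : SimpleGraph (Fin 1))) le_rfl
    (fun u v h => absurd h (by simp))
  have h1 : nearDensity d (⊥ : SimpleGraph (Fin 1)) 1 = 1 := by
    simp [nearDensity]
  simp only [Fintype.card_fin, pow_one, h1, ENNReal.toReal_one, mul_one] at h
  refine h.congr fun N => ?_
  congr 2
  refine Nat.card_congr
    { toFun := fun f => f 0
      invFun := fun z => ⟨fun _ => z, fun {u v} h => absurd h (by simp)⟩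
      left_inv := fun f => by
        ext1 i
        rw [Subsingleton.elim i 0]
        rfl
      right_inv := fun z => rfl }

theorem tendsto_homDensity_latticeGraph (hd : 1 ≤ d) {H : SimpleGraph V} {ε : ℝ} (hε1 : ε ≤ 1)
    (hε : ∀ u v, H.Adj u v → volume {x : V → E d | |⟪nrm (x u), nrm (x v)⟫| = ε} = 0) :
    Tendsto (fun N : ℕ => homDensity H (latticeGraph d N ε)) atTop
      (𝓝 (nearDensity d H ε).toReal) := by
  have hB : 0 < (volume (Metric.ball (0 : E d) 1)).toReal :=
    ENNReal.toReal_pos (Metric.measure_ball_pos volume _ one_pos).ne'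
      Metric.isBounded_ball.measure_lt_top.ne
  have h := (tendsto_card_latticeHom hd hε1 hε).div
    ((tendsto_card_latticePoints hd).pow (Fintype.card V)) (pow_pos hB _).ne'
  rw [mul_div_cancel_left₀ _ (pow_pos hB _).ne'] at h
  refine h.congr' ?_
  filter_upwards [eventually_ne_atTop 0] with N hN
  have hN' : ((N : ℝ) ^ d) ^ Fintype.card V ≠ 0 := by positivity
  rw [homDensity, Nat.card_eq_fintype_card (α := V), Pi.div_apply, div_pow,
    div_div_div_cancel_right₀ hN']

end OrthoGraph

end

open MeasureTheory Filter Topology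
open scoped ENNReal

noncomputable section

namespace OrthoGraph

/-! ### Isomorphism invariance and perturbation of limits. -/

section Transfer

theorem homDensity_congr {V V' W W' : Type*} {H : SimpleGraph V} {H' : SimpleGraph V'}
    {G : SimpleGraph W} {G' : SimpleGraph W'} (φ : H ≃g H') (ψ : G ≃g G') :
    homDensity H G = homDensity H' G' := by
  have h1 : Nat.card (H →g G) = Nat.card (H' →g G') := Nat.card_congr
    { toFun := fun f => (ψ.toHom.comp f).comp φ.symm.toHom
      invFun := fun f => (ψ.symm.toHom.comp f).comp φ.toHom
      left_inv := fun f => by ext v; simp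
      right_inv := fun f => by ext v; simp }
  rw [homDensity, homDensity, h1, Nat.card_congr φ.toEquiv, Nat.card_congr ψ.toEquiv]

theorem DSparse.comap {V V' : Type*} {d : ℕ} {H : SimpleGraph V} (hH : DSparse d H)
    (p : V' ↪ V) : DSparse d (H.comap p) := by
  intro A B hA hB h
  have := hH (A.map p) (B.map p) (by simpa using hA) (by simpa using hB) (by
    intro a ha b hb
    obtain ⟨a, ha', rfl⟩ := Finset.mem_map.1 ha
    obtain ⟨b, hb', rfl⟩ := Finset.mem_map.1 hb
    exact h a ha' b hb')
  simpa using this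

/-- The limit may be infinite, so the sequences are compared by squeezing in `ℝ≥0∞` instead of
subtracting limits. -/
theorem tendsto_ofReal_of_sub {a b : ℕ → ℝ} {L : ℝ≥0∞}
    (hb : Tendsto (fun i => ENNReal.ofReal (b i)) atTop (𝓝 L))
    (hab : Tendsto (fun i => |a i - b i|) atTop (𝓝 0)) :
    Tendsto (fun i => ENNReal.ofReal (a i)) atTop (𝓝 L) := by
  have h0 : Tendsto (fun i => ENNReal.ofReal |a i - b i|) atTop (𝓝 0) := by
    simpa using ENNReal.tendsto_ofReal hab
  have hlow := ENNReal.Tendsto.sub hb h0 (Or.inr ENNReal.zero_ne_top)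
  have hup := hb.add h0
  rw [tsub_zero] at hlow
  rw [add_zero] at hup
  refine tendsto_of_tendsto_of_tendsto_of_le_of_le hlow hup (fun i => ?_) (fun i => ?_)
  · refine tsub_le_iff_right.2 ((ENNReal.ofReal_le_ofReal ?_).trans ENNReal.ofReal_add_le)
    have := neg_abs_le (a i - b i)
    linarith
  · refine (ENNReal.ofReal_le_ofReal ?_).trans ENNReal.ofReal_add_le
    have := le_abs_self (a i - b i)
    linarith

end Transfer

variable {d : ℕ}

/-! ### Choice of the graph sequence. -/

theorem nearDensity_ne_top (hd : 1 ≤ d) {V : Type*} [Fintype V] (H : SimpleGraph V) (ε : ℝ) :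
    nearDensity d H ε ≠ ∞ := by
  have := uniformSphere_top_prob hd
  exact measure_ne_top _ _

/-- The normalized density of approximate ortho-homomorphisms. -/
def nearRatio (d : ℕ) {V : Type*} [Fintype V] (H : SimpleGraph V) (ε : ℝ) : ℝ :=
  (nearDensity d H ε).toReal / (nearDensity d singleEdge ε).toReal ^ H.edgeSet.ncard

theorem ofReal_nearRatio (hd : 1 ≤ d) {V : Type*} [Fintype V] (H : SimpleGraph V) {ε : ℝ}
    (hε : nearDensity d singleEdge ε ≠ 0) :
    ENNReal.ofReal (nearRatio d H ε) =
      nearDensity d H ε / nearDensity d singleEdge ε ^ H.edgeSet.ncard := by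
  have h1 := nearDensity_ne_top hd singleEdge ε
  rw [nearRatio, ENNReal.ofReal_div_of_pos (pow_pos (ENNReal.toReal_pos hε h1) _),
    ENNReal.ofReal_pow ENNReal.toReal_nonneg, ENNReal.ofReal_toReal h1,
    ENNReal.ofReal_toReal (nearDensity_ne_top hd H ε)]

theorem exists_generic (hd : 2 ≤ d) {δ : ℝ} (hδ : 0 < δ) :
    ∃ ε : ℝ, 0 < ε ∧ ε < δ ∧ nearDensity d singleEdge ε ≠ 0 ∧
      ∀ (k : ℕ) (u v : Fin k), volume {x : Fin k → E d |
        |inner ℝ (nrm (x u)) (nrm (x v))| = ε} = 0 := by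
  -- The edge density divided by `2 * ε` has a nonzero limit, so it cannot vanish for small `ε`.
  have h1 : ∀ᶠ ε in 𝓝[>] (0 : ℝ), nearDensity d singleEdge ε ≠ 0 := by
    have h := tendsto_nearDensity_singleEdge hd
    have h0 : ENNReal.ofReal (sphereArea (d - 2) / sphereArea (d - 1)) ≠ 0 := by
      simpa using div_pos (sphereArea_pos (d - 2)) (sphereArea_pos (d - 1))
    filter_upwards [h.eventually_ne h0] with ε hε h
    exact hε (by rw [h, ENNReal.zero_div])
  obtain ⟨δ', hδ', hsub⟩ := mem_nhdsGT_iff_exists_Ioo_subset.1 h1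
  have hδ' : (0 : ℝ) < δ' := hδ'
  have hc : (⋃ k, {ε : ℝ | ∃ u v : Fin k, volume {x : Fin k → E d |
      |inner ℝ (nrm (x u)) (nrm (x v))| = ε} ≠ 0}).Countable :=
    Set.countable_iUnion fun k => countable_generic d k
  -- The complement of a countable set is dense, so a value generic for all `k` at once lies in the
  -- interval.
  obtain ⟨ε, hε, hε1, hε2⟩ := (hc.dense_compl ℝ).exists_between (lt_min hδ hδ')
  refine ⟨ε, hε1, hε2.trans_le (min_le_left _ _), hsub ⟨hε1, hε2.trans_le (min_le_right _ _)⟩,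
    fun k u v => ?_⟩
  by_contra h
  exact hε (Set.mem_iUnion.2 ⟨k, u, v, h⟩)

/-- There are finitely many graphs on fewer than `m` labelled nodes, so a single large `N`
approximates the ratio for all of them. -/
theorem exists_approximating_graph (hd : 1 ≤ d) {ε : ℝ} (hε1 : ε ≤ 1)
    (hε0 : nearDensity d singleEdge ε ≠ 0)
    (hgen : ∀ (k : ℕ) (u v : Fin k), volume {x : Fin k → E d |
        |inner ℝ (nrm (x u)) (nrm (x v))| = ε} = 0) (m : ℕ) {η : ℝ} (hη : 0 < η) :
    ∃ (N : ℕ) (G : SimpleGraph (Fin N)), 0 < homDensity singleEdge G ∧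
      ∀ k < m, ∀ H : SimpleGraph (Fin k),
        |homDensity H G / homDensity singleEdge G ^ H.edgeSet.ncard - nearRatio d H ε| < η := by
  have hpos : 0 < (nearDensity d singleEdge ε).toReal :=
    ENNReal.toReal_pos hε0 (nearDensity_ne_top hd _ _)
  have hlim : ∀ (k : ℕ) (H : SimpleGraph (Fin k)),
      Tendsto (fun N : ℕ => homDensity H (latticeGraph d N ε)) atTop
      (𝓝 (nearDensity d H ε).toReal) := fun k H =>
    tendsto_homDensity_latticeGraph hd hε1 fun u v _ => hgen k u v
  have he := hlim 2 singleEdge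
  have hr : ∀ (k : ℕ) (H : SimpleGraph (Fin k)), ∀ᶠ N : ℕ in atTop,
      |homDensity H (latticeGraph d N ε) /
        homDensity singleEdge (latticeGraph d N ε) ^ H.edgeSet.ncard - nearRatio d H ε| < η :=
    fun k H => by
    have h := (hlim k H).div (he.pow H.edgeSet.ncard) (pow_pos hpos _).ne'
    exact Metric.tendsto_nhds.1 h η hη
  have hall : ∀ᶠ N : ℕ in atTop, ∀ k ∈ Finset.range m, ∀ H : SimpleGraph (Fin k),
      |homDensity H (latticeGraph d N ε) /
        homDensity singleEdge (latticeGraph d N ε) ^ H.edgeSet.ncard - nearRatio d H ε| < η :=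
    (eventually_all_finset _).2 fun k _ => eventually_all.2 (hr k)
  obtain ⟨N, hN1, hN2, hN3⟩ := (hall.and ((he.eventually_const_lt hpos).and
    (eventually_ne_atTop 0))).exists
  have hfin := finite_latticePoints d hN3
  let e := Finite.equivFin (latticePoints d N)
  let ψ : (latticeGraph d N ε).comap e.symm ≃g latticeGraph d N ε :=
    SimpleGraph.Iso.comap e.symm _
  refine ⟨_, (latticeGraph d N ε).comap e.symm, ?_, fun k hk H => ?_⟩
  · rwa [homDensity_congr SimpleGraph.Iso.refl ψ]
  · rw [homDensity_congr SimpleGraph.Iso.refl ψ, homDensity_congr SimpleGraph.Iso.refl ψ]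
    exact hN1 k (Finset.mem_range.2 hk) H

/-- A diagonal choice: the graph with index `i` has `ε i < 1 / (i + 1)` and error below `1 / (i +
1)` for all graphs on fewer than `i` nodes. Any fixed `H` is covered from some index on. -/
theorem exists_graph_sequence (hd : 2 ≤ d) :
    ∃ (N : ℕ → ℕ) (G : (i : ℕ) → SimpleGraph (Fin (N i))),
      (∀ i, 0 < homDensity singleEdge (G i)) ∧
      ∀ (n : ℕ) (H : SimpleGraph (Fin n)), H.IsBipartite → DSparse d H →
        Tendsto (fun i => ENNReal.ofReal
          (homDensity H (G i) / homDensity singleEdge (G i) ^ H.edgeSet.ncard))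
          atTop (𝓝 (orthoNumber d H (Equiv.refl _))) := by
  have hδ : ∀ i : ℕ, (0 : ℝ) < 1 / ((i : ℝ) + 1) := fun i => by positivity
  choose ε hε0 hεlt hεe hεgen using fun i : ℕ => exists_generic hd (hδ i)
  have hε1 : ∀ i, ε i ≤ 1 := fun i => (hεlt i).le.trans (by
    rw [div_le_one (by positivity)]
    have : (0 : ℝ) ≤ i := by positivity
    linarith)
  choose N G hG hGr using fun i : ℕ =>
    exists_approximating_graph (by omega) (hε1 i) (hεe i) (hεgen i) i (hδ i)
  refine ⟨N, G, hG, fun n H hb hH => ?_⟩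
  obtain ⟨c⟩ := hb
  have hW : ∀ u ∈ Finset.univ.filter (fun v => c v = 1), ∀ v ∈ Finset.univ.filter
      (fun v => c v = 1), ¬ H.Adj u v := fun u hu v hv h => c.valid h (by
    simp only [Finset.mem_filter, Finset.mem_univ, true_and] at hu hv
    rw [hu, hv])
  have hU : ∀ u ∉ Finset.univ.filter (fun v => c v = 1), ∀ v ∉ Finset.univ.filter
      (fun v => c v = 1), ¬ H.Adj u v := fun u hu v hv h => c.valid h (by
    simp only [Finset.mem_filter, Finset.mem_univ, true_and] at hu hv
    omega)
  have hεlim : Tendsto ε atTop (𝓝[>] 0) := by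
    refine tendsto_nhdsWithin_iff.2 ⟨?_, Eventually.of_forall hε0⟩
    exact squeeze_zero (fun i => (hε0 i).le) (fun i => (hεlt i).le)
      tendsto_one_div_add_atTop_nhds_zero_nat
  have h1 := (tendsto_nearDensity_ratio hd hH hW hU (Equiv.refl _)).comp hεlim
  have h2 : Tendsto (fun i => ENNReal.ofReal (nearRatio d H (ε i))) atTop
      (𝓝 (orthoNumber d H (Equiv.refl _))) :=
    h1.congr fun i => (ofReal_nearRatio (by omega) H (hεe i)).symm
  refine tendsto_ofReal_of_sub h2 ?_
  refine squeeze_zero' (Eventually.of_forall fun i => abs_nonneg _) ?_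
    tendsto_one_div_add_atTop_nhds_zero_nat
  filter_upwards [eventually_gt_atTop n] with i hi
  exact (hGr i n hi H).le

end OrthoGraph

end
theorem theorem26 (d : ℕ) (hd : 3 ≤ d) :
    ∃ (N : ℕ → ℕ) (G : (i : ℕ) → SimpleGraph (Fin (N i))),
      (∀ i, 0 < OrthoGraph.homDensity OrthoGraph.singleEdge (G i)) ∧
      ∀ (V : Type*) (n : ℕ) (p : Fin n ≃ V) (H : SimpleGraph V),
        H.IsBipartite → OrthoGraph.DSparse d H →
          Tendsto
            (fun i => ENNReal.ofReal
              (OrthoGraph.homDensity H (G i) /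
                OrthoGraph.homDensity OrthoGraph.singleEdge (G i) ^ H.edgeSet.ncard))
            atTop (𝓝 (OrthoGraph.orthoNumber d H p)) := by
  obtain ⟨N, G, hG, h⟩ := OrthoGraph.exists_graph_sequence (d := d) (by omega)
  refine ⟨N, G, hG, fun V n p H hb hH => ?_⟩
  let φ : H.comap p ≃g H := SimpleGraph.Iso.comap p H
  have hb' : (H.comap p).IsBipartite := hb.of_hom φ.toHom
  have hcard : (H.comap p).edgeSet.ncard = H.edgeSet.ncard := by
    rw [← Nat.card_coe_set_eq, ← Nat.card_coe_set_eq]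
    exact Nat.card_congr φ.mapEdgeSet
  -- By definition `orthoNumber d H p` is the number of `H.comap p` in its natural order. An
  -- arbitrary ordering is therefore a relabelling, and the homomorphism density is invariant under
  -- it.
  have h1 := h n (H.comap p) hb' (hH.comap p.toEmbedding)
  rw [hcard] at h1
  refine h1.congr fun i => ?_
  rw [OrthoGraph.homDensity_congr φ SimpleGraph.Iso.refl]
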